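/- Let $G$ be a compact semisimple real Lie group with Lie algebra $\mathfrak g$ and Killing form $K$, and let $(\mathfrak g=\mathfrak h\oplus\mathfrak m,\,A)$ be a Hermitian symmetric structure: $[\mathfrak h,\mathfrak h]\subseteq\mathfrak h$, $[\mathfrak h,\mathfrak m]\subseteq\mathfrak m$, $[\mathfrak m,\mathfrak m]\subseteq\mathfrak h$, $\mathfrak m\neq 0$, the centralizer of $A$ in $\mathfrak g$ is $\mathfrak h$, and $\mathrm{ad}(A)^2=-\mathrm{id}$ on $\mathfrak m$. Let $H\subset G$ be the stabilizer of $A$ under $\mathrm{Ad}$. Let $\mathrm{Aff}(G,H)=(G\ltimes\mathfrak g)/G$, where $(g_1,a_1)(g_2,a_2)=(g_1g_2,\mathrm{Ad}(g_1)a_2+a_1)$; the space and its tangent spaces are identified with $\mathfrak g$. On $\mathfrak g_{\rm aff}=\mathfrak g\ltimes\mathfrak g$ use the bracket $[(a,a'),(b,b')]=([a,b],[a,b']+[a',b])$ and the inner product $\langle(a,a'),(b,b')\rangle=-K(a,b)-K(a',b')$; put $\mathfrak h_{\rm aff}=\{(a,0)\}$, $\mathfrak m_{\rm aff}=\{(0,a)\}$,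 $g(X,Y)=\langle(0,X),(0,Y)\rangle$ and $\chi=\langle(0,A),(0,A)\rangle$. A framing of a smooth curve flow $\gamma(x,t)$ in $\mathrm{Aff}(G,H)$, $(x,t)\in\mathbb R^2$, is a smooth map $\psi:\mathbb R^2\to G$, $(x,t)\mapsto\psi(x,t)$; its linear coframe and linear connection along $\gamma$ are $e=(0,\mathrm{Ad}(\psi^{-1})\,\cdot\,)$ and $\omega=(\psi^{-1}d\psi,0)$. Write $e_x=e\rfloor\gamma_x$, $e_t=e\rfloor\gamma_t$, $\omega_x=\omega\rfloor\gamma_x=(\psi^{-1}D_x\psi,0)$, $\omega_t=\omega\rfloor\gamma_t=(\psi^{-1}D_t\psi,0)$. Consider the flows in the class of $\chi^{-1/2}(0,A)$: at each $(x,t)$ there is $k\in G$ with $(0,\mathrm{Ad}(k^{-1})\gamma_x)=\chi^{-1/2}(0,A)$. A framing $\psi$ is called $G$-parallel if $e_x=\chi^{-1/2}(0,A)$ for all $(x,t)$ and $\omega_x$ always lies in the orthogonal complement, in $\mathfrak h_{\rm aff}$, of the centralizer of $e_x$ in $\mathfrak h_{\rm aff}$. Then: 1. $\chi=\dim\mathfrak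 m$; every coframe is isometric, $\langle (0,\mathrm{Ad}(k^{-1})X),(0,\mathrm{Ad}(k^{-1})Y)\rangle=g(X,Y)$ for $k\in G$; and $g(\gamma_x,\gamma_x)=1$ for every flow $\gamma$ in the class, so $\gamma$ is non-stretching with arclength $x$. 2. Every flow in the class has a $G$-parallel framing. 3. For every $G$-parallel framing of such a flow there are unique functions $q,h_\perp,w_\perp$ with values in $\mathfrak m$ and $h_\parallel,w_\parallel$ with values in $\mathfrak h$, and these are smooth, such that $$\omega_x=(q,0),\qquad e_t=(0,h_\parallel+h_\perp),\qquad \omega_t=(w_\parallel+w_\perp,0).$$ The structure equations $$D_xe_t-D_te_x+[\omega_x,e_t]-[\omega_t,e_x]=0,\qquad D_x\omega_t-D_t\omega_x+[\omega_x,\omega_t]=0$$ hold, and so do $$D_xh_\parallel+[q,h_\perp]=0,\qquad D_xh_\perp+[q,h_\parallel]+\chi^{-1/2}[A,w_\perp]=0,$$ $$D_xw_\parallel+[q,w_\perp]=0,\qquad D_xw_\perp-q_t+[q,w_\parallel]=0.$$ Moreover, for arbitrary smooth functions $q,h_\perp,w_\perp$ into $\mathfrak m$ and $h_\parallel,w_\parallel$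 into $\mathfrak h$, the structure equations with $e_x=\chi^{-1/2}(0,A)$ and $\omega_x,e_t,\omega_t$ as above are equivalent to these four equations. 4. The equivalence group is $H$: if $\psi$ is a $G$-parallel framing of $\gamma$, then for constant $k\in G$ the framing $\psi k$ is $G$-parallel if and only if $k\in H$; more generally, for smooth $k:\mathbb R^2\to G$, $\psi k$ is $G$-parallel if and only if $k$ is $H$-valued and independent of $x$. For constant $k\in H$, passing from $\psi$ to $\psi k$ applies $\mathrm{Ad}(k^{-1})$ to $q,h_\parallel,h_\perp,w_\parallel,w_\perp$. If $\gamma(x+l,t)=\gamma(x,t)$ for all $(x,t)$, then for every $t$ there is $k\in H$ with $\psi(x+l,t)=\psi(x,t)k$ for all $x$. 5. The four equations are $H$-invariant: for $k\in H$, applying $\mathrm{Ad}(k)$ to all of $q,h_\parallel,h_\perp,w_\parallel,w_\perp$ preserves their smoothness and their values in $\mathfrak m$, respectively $\mathfrak h$, and the transformed functions satisfy the four equations if and only if the original ones do. -/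

import Mathlib

open scoped Manifold ContDiff

noncomputable section

namespace AffHermitian

/-- Over `ℝ`, a smooth Lie group is regular enough for its Lie algebra to be defined. -/
instance instLEInftyMinSmoothness : ENat.LEInfty (minSmoothness ℝ 3) :=
  ⟨by
    rw [minSmoothness_of_isRCLikeNormedField]
    exact ENat.LEInfty.out⟩

/-! ### Hermitian symmetric Lie algebras -/

/-- A Hermitian symmetric structure on a real Lie algebra `L`: a symmetric decomposition
`L = h ⊕ m` together with an element `A` whose centralizer in `L` is `h` and for which `ad A`
squares to `-1` on `m`. The decomposition is nontrivial, `m ≠ 0`. -/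
structure HermitianSymmetric (L : Type*) [LieRing L] [LieAlgebra ℝ L] where
  h : LieSubalgebra ℝ L
  m : Submodule ℝ L
  A : L
  isCompl : IsCompl h.toSubmodule m
  lie_h_m : ∀ a ∈ h, ∀ b ∈ m, ⁅a, b⁆ ∈ m
  lie_m_m : ∀ a ∈ m, ∀ b ∈ m, ⁅a, b⁆ ∈ h
  centralizer_A : ∀ a : L, a ∈ h ↔ ⁅A, a⁆ = 0
  ad_A_sq : ∀ a ∈ m, ⁅A, ⁅A, a⁆⁆ = -a
  m_ne_bot : m ≠ ⊥

/-! ### The semidirect Lie algebra `L ⋊ L`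

Its elements are the pairs `(a, a')`; the first slot is the linear (rotation) part `h_aff`, the
second slot is the translation part `m_aff`. -/

section AffineAlgebra

variable {L : Type*} [LieRing L] [LieAlgebra ℝ L]

/-- The bracket of `L ⋊ L`: `[(a, a'), (b, b')] = ([a, b], [a, b'] + [a', b])`. -/
def affBracket (u v : L × L) : L × L := (⁅u.1, v.1⁆, ⁅u.1, v.2⁆ + ⁅u.2, v.1⁆)

/-- The inner product `⟨(a, a'), (b, b')⟩ = -K(a, b) - K(a', b')`, `K` the Killing form of `L`. -/
def affInner (u v : L × L) : ℝ := -killingForm ℝ L u.1 v.1 - killingForm ℝ L u.2 v.2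

/-- The centralizer of `e` in the subalgebra `h_aff = {(a, 0)}`. -/
def hAffPar (e : L × L) : Set (L × L) := {u | u.2 = 0 ∧ affBracket e u = 0}

/-- The orthogonal complement, inside `h_aff = {(a, 0)}`, of the centralizer of `e`. -/
def hAffPerp (e : L × L) : Set (L × L) := {u | u.2 = 0 ∧ ∀ v ∈ hAffPar e, affInner u v = 0}

/-- `χ = ⟨(0, A), (0, A)⟩`. -/
def HermitianSymmetric.chi (S : HermitianSymmetric L) : ℝ := affInner (0, S.A) (0, S.A)

/-- The element `χ^{-1/2} (0, A)` of `m_aff`. -/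
def HermitianSymmetric.e (S : HermitianSymmetric L) : L × L := (√S.chi)⁻¹ • (0, S.A)

end AffineAlgebra

/-! ### The adjoint representation of a Lie group -/

section Group

variable (E : Type*) [NormedAddCommGroup E] [NormedSpace ℝ E]
  {G : Type*} [TopologicalSpace G] [ChartedSpace E G] [Group G]

/-- `Ad g` is the derivative at `1` of the conjugation `z ↦ g z g⁻¹`. -/
def Ad (g : G) : GroupLieAlgebra 𝓘(ℝ, E) G →L[ℝ] GroupLieAlgebra 𝓘(ℝ, E) G :=
  mfderiv 𝓘(ℝ, E) 𝓘(ℝ, E) (fun z : G => g * z * g⁻¹) 1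

theorem Ad_one : Ad E (1 : G) = ContinuousLinearMap.id ℝ _ := by
  have : (fun z : G => (1 : G) * z * (1 : G)⁻¹) = id := by ext z; simp
  unfold Ad
  rw [this]
  exact mfderiv_id

variable [LieGroup 𝓘(ℝ, E) ∞ G]

theorem mdifferentiable_conj (g : G) :
    MDifferentiable 𝓘(ℝ, E) 𝓘(ℝ, E) (fun z : G => g * z * g⁻¹) := by
  have h : ContMDiff 𝓘(ℝ, E) 𝓘(ℝ, E) ∞ (fun z : G => g * z * g⁻¹) :=
    (contMDiff_const.mul contMDiff_id).mul contMDiff_const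
  exact h.mdifferentiable (by simp)

theorem Ad_mul (g k : G) : Ad E (g * k) = (Ad E g).comp (Ad E k) := by
  have hc : (fun z : G => (g * k) * z * (g * k)⁻¹)
      = (fun z : G => g * z * g⁻¹) ∘ (fun z : G => k * z * k⁻¹) := by
    ext z; simp [mul_assoc]
  have h1 : k * 1 * k⁻¹ = 1 := by simp
  unfold Ad
  rw [hc, mfderiv_comp (I' := 𝓘(ℝ, E)) _ (mdifferentiable_conj E g _)
    (mdifferentiable_conj E k _), h1]
  rfl

/-- The adjoint action as a homomorphism to the automorphisms of the additive group of the Lie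
algebra (written multiplicatively, as the semidirect product requires). -/
def AdHom : G →* MulAut (Multiplicative (GroupLieAlgebra 𝓘(ℝ, E) G)) where
  toFun g := AddEquiv.toMultiplicative
    { toFun := Ad E g
      invFun := Ad E g⁻¹
      left_inv := fun a => by
        rw [← ContinuousLinearMap.comp_apply, ← Ad_mul, inv_mul_cancel, Ad_one]
        rfl
      right_inv := fun a => by
        rw [← ContinuousLinearMap.comp_apply, ← Ad_mul, mul_inv_cancel, Ad_one]
        rfl
      map_add' := fun a b => map_add _ a b }
  map_one' := by
    ext a
    change Multiplicative.ofAdd (Ad E (1 : G) (Multiplicative.toAdd a)) = a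
    rw [Ad_one]
    rfl
  map_mul' g k := by
    ext a
    change Multiplicative.ofAdd (Ad E (g * k) (Multiplicative.toAdd a)) =
      Multiplicative.ofAdd (Ad E g (Ad E k (Multiplicative.toAdd a)))
    rw [Ad_mul]
    rfl

/-- The stabilizer of a Lie algebra element under the adjoint action. -/
def stabilizer (A : GroupLieAlgebra 𝓘(ℝ, E) G) : Subgroup G where
  carrier := {g | Ad E g A = A}
  one_mem' := by
    change Ad E (1 : G) A = A
    rw [Ad_one]
    rfl
  mul_mem' {g k} hg hk := by
    change Ad E (g * k) A = A
    rw [Ad_mul, ContinuousLinearMap.comp_apply, show Ad E k A = A from hk]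
    exact hg
  inv_mem' {g} hg := by
    change Ad E g⁻¹ A = A
    have hg' : Ad E g A = A := hg
    conv_lhs => rw [← hg']
    rw [← ContinuousLinearMap.comp_apply, ← Ad_mul, inv_mul_cancel, Ad_one]
    rfl

/-! ### The affine space `(G ⋉ L) / G` -/

variable (G) in
/-- The group `G ⋉ L`, with `(a₁, g₁)(a₂, g₂) = (a₁ + Ad(g₁) a₂, g₁ g₂)`. -/
abbrev AffGroup : Type _ := Multiplicative (GroupLieAlgebra 𝓘(ℝ, E) G) ⋊[AdHom E] G

variable (G) in
/-- The affine symmetric space `(G ⋉ L) / G`. -/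
abbrev Aff : Type _ :=
  AffGroup E G ⧸ (SemidirectProduct.inr : G →* AffGroup E G).range

variable (G) in
/-- The coset of `(a, g)` is determined by `a`; this identifies `(G ⋉ L) / G` with the vector space
`L`. It is the global chart that gives the space its manifold structure, and it identifies
each of its tangent spaces with `L`. -/
def Aff.chart : Aff E G ≃ GroupLieAlgebra 𝓘(ℝ, E) G where
  toFun := Quotient.lift (fun p : AffGroup E G => Multiplicative.toAdd p.left) (by
    intro p r hpr
    obtain ⟨k, hk⟩ := QuotientGroup.leftRel_apply.mp hpr
    have hr : r = p * SemidirectProduct.inr k := by rw [hk]; group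
    rw [hr]
    simp)
  invFun a := QuotientGroup.mk (SemidirectProduct.inl (Multiplicative.ofAdd a))
  left_inv := by
    intro p
    induction p using QuotientGroup.induction_on with
    | H p =>
      refine QuotientGroup.eq.mpr ⟨p.right, ?_⟩
      change _ = (SemidirectProduct.inl p.left : AffGroup E G)⁻¹ * p
      rw [eq_inv_mul_iff_mul_eq, SemidirectProduct.inl_left_mul_inr_right]
  right_inv a := by
    change Multiplicative.toAdd (SemidirectProduct.left
      (SemidirectProduct.inl (Multiplicative.ofAdd a) : AffGroup E G)) = a
    simp

/-! ### Derivatives of functions of `(x, t)` -/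

variable {E}

/-- `D_x F` for an `L`-valued function `F(x, t)`. -/
def dx (F : ℝ → ℝ → GroupLieAlgebra 𝓘(ℝ, E) G) (x t : ℝ) : GroupLieAlgebra 𝓘(ℝ, E) G :=
  deriv (F := E) (fun s => F s t) x

/-- `D_t F` for an `L`-valued function `F(x, t)`. -/
def dt (F : ℝ → ℝ → GroupLieAlgebra 𝓘(ℝ, E) G) (x t : ℝ) : GroupLieAlgebra 𝓘(ℝ, E) G :=
  deriv (F := E) (fun s => F x s) t

/-- `D_x F` for an `(L ⋊ L)`-valued function. -/
def dxAff (F : ℝ → ℝ → GroupLieAlgebra 𝓘(ℝ, E) G × GroupLieAlgebra 𝓘(ℝ, E) G) (x t : ℝ) :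
    GroupLieAlgebra 𝓘(ℝ, E) G × GroupLieAlgebra 𝓘(ℝ, E) G :=
  (dx (fun x t => (F x t).1) x t, dx (fun x t => (F x t).2) x t)

/-- `D_t F` for an `(L ⋊ L)`-valued function. -/
def dtAff (F : ℝ → ℝ → GroupLieAlgebra 𝓘(ℝ, E) G × GroupLieAlgebra 𝓘(ℝ, E) G) (x t : ℝ) :
    GroupLieAlgebra 𝓘(ℝ, E) G × GroupLieAlgebra 𝓘(ℝ, E) G :=
  (dt (fun x t => (F x t).1) x t, dt (fun x t => (F x t).2) x t)

/-- Smoothness of an `L`-valued function of `(x, t)`. -/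
def SmoothLie (F : ℝ → ℝ → GroupLieAlgebra 𝓘(ℝ, E) G) : Prop :=
  ContDiff ℝ ∞ (F := E) (fun p : ℝ × ℝ => F p.1 p.2)

variable (E) in
/-- Smoothness of a `G`-valued function of `(x, t)`. -/
def SmoothGroup (ψ : ℝ → ℝ → G) : Prop :=
  ContMDiff 𝓘(ℝ, ℝ × ℝ) 𝓘(ℝ, E) ∞ (fun p : ℝ × ℝ => ψ p.1 p.2)

variable (E) in
/-- `ψ⁻¹ D_x ψ`, the velocity at `s = x` of the curve `s ↦ ψ(x, t)⁻¹ ψ(s, t)` through `1`. -/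
def logDx (ψ : ℝ → ℝ → G) (x t : ℝ) : GroupLieAlgebra 𝓘(ℝ, E) G :=
  mfderiv 𝓘(ℝ, ℝ) 𝓘(ℝ, E) (fun s : ℝ => (ψ x t)⁻¹ * ψ s t) x (1 : ℝ)

variable (E) in
/-- `ψ⁻¹ D_t ψ`, the velocity at `s = t` of the curve `s ↦ ψ(x, t)⁻¹ ψ(x, s)` through `1`. -/
def logDt (ψ : ℝ → ℝ → G) (x t : ℝ) : GroupLieAlgebra 𝓘(ℝ, E) G :=
  mfderiv 𝓘(ℝ, ℝ) 𝓘(ℝ, E) (fun s : ℝ => (ψ x t)⁻¹ * ψ x s) t (1 : ℝ)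

/-! ### Curve flows, coframes and connections -/

/-- A smooth flow `γ(x, t)` of curves in the affine space. -/
def SmoothFlow (γ : ℝ → ℝ → Aff E G) : Prop := SmoothLie (fun x t => Aff.chart E G (γ x t))

/-- The tangent vector `γ_x`. -/
def tangentX (γ : ℝ → ℝ → Aff E G) : ℝ → ℝ → GroupLieAlgebra 𝓘(ℝ, E) G :=
  dx (fun x t => Aff.chart E G (γ x t))

/-- The flow vector `γ_t`. -/
def tangentT (γ : ℝ → ℝ → Aff E G) : ℝ → ℝ → GroupLieAlgebra 𝓘(ℝ, E) G :=
  dt (fun x t => Aff.chart E G (γ x t))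

/-- The linear coframe attached to the group element `g`: `X ↦ (0, Ad(g⁻¹) X)`. -/
def coframe (g : G) (X : GroupLieAlgebra 𝓘(ℝ, E) G) :
    GroupLieAlgebra 𝓘(ℝ, E) G × GroupLieAlgebra 𝓘(ℝ, E) G := (0, Ad E g⁻¹ X)

variable (E) in
/-- The linear connection `(ψ⁻¹ dψ, 0)` contracted with the tangent vector of the flow. -/
def connX (ψ : ℝ → ℝ → G) (x t : ℝ) : GroupLieAlgebra 𝓘(ℝ, E) G × GroupLieAlgebra 𝓘(ℝ, E) G :=
  (logDx E ψ x t, 0)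

variable (E) in
/-- The linear connection `(ψ⁻¹ dψ, 0)` contracted with the flow vector. -/
def connT (ψ : ℝ → ℝ → G) (x t : ℝ) : GroupLieAlgebra 𝓘(ℝ, E) G × GroupLieAlgebra 𝓘(ℝ, E) G :=
  (logDt E ψ x t, 0)

variable [CompleteSpace E]

/-- The Riemannian metric of the affine space. -/
def metric (X Y : GroupLieAlgebra 𝓘(ℝ, E) G) : ℝ := affInner (0, X) (0, Y)

/-- The Maurer-Cartan (torsion and curvature) equations
`D_x e_t - D_t e_x + [ω_x, e_t] - [ω_t, e_x] = 0` and `D_x ω_t - D_t ω_x + [ω_x, ω_t] = 0`. -/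
def StructureEqs
    (ex et wx wt : ℝ → ℝ → GroupLieAlgebra 𝓘(ℝ, E) G × GroupLieAlgebra 𝓘(ℝ, E) G) : Prop :=
  (∀ x t, dxAff et x t - dtAff ex x t + affBracket (wx x t) (et x t)
    - affBracket (wt x t) (ex x t) = 0) ∧
  (∀ x t, dxAff wt x t - dtAff wx x t + affBracket (wx x t) (wt x t) = 0)

/-- `ψ` is a `G`-parallel framing of the flow `γ` with `e⌟γ_x = χ^{-1/2} (0, A)`: a smooth
`G`-valued function along the flow, whose coframe takes the tangent vector to the constant
`e_x = χ^{-1/2} (0, A)` and whose connection `ω⌟γ_x` lies in the perp space of the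
centralizer of `e_x` in `h_aff`. -/
structure IsGParallelFraming (S : HermitianSymmetric (GroupLieAlgebra 𝓘(ℝ, E) G))
    (γ : ℝ → ℝ → Aff E G) (ψ : ℝ → ℝ → G) : Prop where
  smooth : SmoothGroup E ψ
  adapted : ∀ x t, coframe (ψ x t) (tangentX γ x t) = S.e
  parallel : ∀ x t, connX E ψ x t ∈ hAffPerp S.e

/-! ### The variables of a `G`-parallel framing -/

variable (E G) in
/-- The five functions `q, h_∥, h_⊥, w_∥, w_⊥` of `(x, t)`. -/
@[ext] structure FrameVars where
  q : ℝ → ℝ → GroupLieAlgebra 𝓘(ℝ, E) G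
  hpar : ℝ → ℝ → GroupLieAlgebra 𝓘(ℝ, E) G
  hperp : ℝ → ℝ → GroupLieAlgebra 𝓘(ℝ, E) G
  wpar : ℝ → ℝ → GroupLieAlgebra 𝓘(ℝ, E) G
  wperp : ℝ → ℝ → GroupLieAlgebra 𝓘(ℝ, E) G

namespace FrameVars

/-- `q, h_⊥, w_⊥` take values in `m`, and `h_∥, w_∥` take values in `h`. -/
structure Valued (S : HermitianSymmetric (GroupLieAlgebra 𝓘(ℝ, E) G)) (V : FrameVars E G) :
    Prop where
  q_mem : ∀ x t, V.q x t ∈ S.m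
  hpar_mem : ∀ x t, V.hpar x t ∈ S.h
  hperp_mem : ∀ x t, V.hperp x t ∈ S.m
  wpar_mem : ∀ x t, V.wpar x t ∈ S.h
  wperp_mem : ∀ x t, V.wperp x t ∈ S.m

structure Smooth (V : FrameVars E G) : Prop where
  q_smooth : SmoothLie V.q
  hpar_smooth : SmoothLie V.hpar
  hperp_smooth : SmoothLie V.hperp
  wpar_smooth : SmoothLie V.wpar
  wperp_smooth : SmoothLie V.wperp

/-- `ω⌟γ_x = (q, 0)`, `e⌟γ_t = (0, h_∥ + h_⊥)`, `ω⌟γ_t = (w_∥ + w_⊥, 0)`. -/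
structure Represents (V : FrameVars E G) (γ : ℝ → ℝ → Aff E G) (ψ : ℝ → ℝ → G) : Prop where
  connX_eq : ∀ x t, connX E ψ x t = (V.q x t, 0)
  coframeT_eq : ∀ x t, coframe (ψ x t) (tangentT γ x t) = (0, V.hpar x t + V.hperp x t)
  connT_eq : ∀ x t, connT E ψ x t = (V.wpar x t + V.wperp x t, 0)

/-- The four reduced frame structure equations. -/
structure FlowEqs (S : HermitianSymmetric (GroupLieAlgebra 𝓘(ℝ, E) G)) (V : FrameVars E G) :
    Prop where
  mpar : ∀ x t, dx V.hpar x t + ⁅V.q x t, V.hperp x t⁆ = 0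
  mperp : ∀ x t, dx V.hperp x t + ⁅V.q x t, V.hpar x t⁆ + (√S.chi)⁻¹ • ⁅S.A, V.wperp x t⁆ = 0
  hpar : ∀ x t, dx V.wpar x t + ⁅V.q x t, V.wperp x t⁆ = 0
  hperp : ∀ x t, dx V.wperp x t - dt V.q x t + ⁅V.q x t, V.wpar x t⁆ = 0

/-- The action of a constant group element by `Ad k` on all five functions. -/
def act (k : G) (V : FrameVars E G) : FrameVars E G where
  q x t := Ad E k (V.q x t)
  hpar x t := Ad E k (V.hpar x t)
  hperp x t := Ad E k (V.hperp x t)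
  wpar x t := Ad E k (V.wpar x t)
  wperp x t := Ad E k (V.wperp x t)

end FrameVars

end Group

end AffHermitian

end

open scoped Topology

noncomputable section

namespace AffHermitian

section

/-! ### Algebra of a Hermitian symmetric Lie algebra -/

variable {L : Type*} [LieRing L] [LieAlgebra ℝ L]

/-! Algebra. Since `ad A` kills `h` and squares to `-1` on `m`, `-ad(A)²` is the projection onto `m`
along `h`; its trace gives `χ = dim m`. Invariance of the Killing form `K` makes `h` and `m`
orthogonal, and nondegeneracy then identifies the perp space of the parallel condition with `m`.

Existence of the framing. Put `e₂ = χ^{-1/2} A` and `T = γ_x`, a smooth map into the adjoint orbit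
of `e₂`. Every point of the orbit satisfies the cubic identity `(ad T)³ = -χ⁻¹ ad T`. Linearizing it
(`mem_m_of_linearized`) puts `Ad(k⁻¹) T_x` in `m` whenever `T = Ad(k) e₂`, hence `(ad T)² T_x = -χ⁻¹
T_x`. Therefore a solution of `θ⁻¹ θ_x = -χ [T, T_x]` keeps `Ad(θ) T` constant in `x`, and `ψ = θ⁻¹`
has `ψ⁻¹ ψ_x = χ [e₂, Ad(θ) T_x] ∈ m`. A preliminary transport along `t` on the axis `x = 0`
supplies smooth initial values (`exists_parallel_frame`), so no local sections of the orbit map are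
needed.

Analysis. Solving `θ⁻¹ θ_x = C` smoothly in `(x, t)` is done in the chart at `1`, by the implicit
function theorem for an integral equation on continuous functions (`exists_local_solution`).
Solutions are unique up to left translation, which glues the local ones to a global one
(`exists_smoothGroup_logDeriv_eq`).

Calculus on `G`. The derivative of `Ad` at `1` is the bracket (`adE_apply`), so `(Ad f)' = Ad f ∘
ad(f⁻¹ f')`. As the Killing form is nondegenerate, `ad` is injective. Identities for logarithmic
derivatives may therefore be checked after applying `ad`, as ordinary calculus of operator valued
functions: this gives the product rule (`logDeriv_mul`) and the curvature equation (`maurerCartan`).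

The remaining assertions follow. The torsion equation is the symmetry of `γ_{xt}`, and the four flow
equations are the `h` and `m` components of the two structure equations. A change of framing by `g`
preserves adaptedness exactly when `g` is `H`-valued; then `g⁻¹ g_x` lies in `h`, the parallel
condition puts it in `m`, and so it vanishes (`isGParallelFraming_mul_iff`). Periodicity is this
statement applied to the framing shifted by the period. -/

theorem eq_zero_of_forall_killingForm [LieAlgebra.IsKilling ℝ L] {a : L}
    (h : ∀ b, killingForm ℝ L a b = 0) : a = 0 := by
  have ha : a ∈ LinearMap.ker (killingForm ℝ L) := LinearMap.ext h
  rwa [LieAlgebra.IsKilling.ker_killingForm_eq_bot, Submodule.mem_bot] at ha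

theorem eq_zero_of_forall_lie [LieAlgebra.IsKilling ℝ L] {a : L}
    (h : ∀ b : L, ⁅a, b⁆ = 0) : a = 0 := by
  refine eq_zero_of_forall_killingForm fun b => ?_
  have : LieAlgebra.ad ℝ L a = 0 := LinearMap.ext h
  rw [killingForm_apply_apply, this, LinearMap.zero_comp, map_zero]

namespace HermitianSymmetric

variable (S : HermitianSymmetric L)

theorem lie_A_of_mem_h {a : L} (ha : a ∈ S.h) : ⁅S.A, a⁆ = 0 := (S.centralizer_A a).1 ha

theorem A_mem_h : S.A ∈ S.h := (S.centralizer_A _).2 (lie_self _)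

theorem lie_A_mem_m {a : L} (ha : a ∈ S.m) : ⁅S.A, a⁆ ∈ S.m := S.lie_h_m _ S.A_mem_h _ ha

theorem lie_m_h {a b : L} (ha : a ∈ S.m) (hb : b ∈ S.h) : ⁅a, b⁆ ∈ S.m := by
  rw [← lie_skew]
  exact S.m.neg_mem (S.lie_h_m _ hb _ ha)

theorem eq_zero_of_mem {a : L} (ha : a ∈ S.h) (hb : a ∈ S.m) : a = 0 :=
  Submodule.disjoint_def.1 S.isCompl.disjoint a ha hb

theorem exists_add (a : L) : ∃ b ∈ S.h, ∃ c ∈ S.m, b + c = a :=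
  Submodule.mem_sup.1 (S.isCompl.sup_eq_top ▸ Submodule.mem_top)

/-- Components along `h` and `m` are determined by the sum. -/
theorem add_eq_add_iff {a b c d : L} (ha : a ∈ S.h) (hb : b ∈ S.m) (hc : c ∈ S.h) (hd : d ∈ S.m) :
    a + b = c + d ↔ a = c ∧ b = d := by
  refine ⟨fun h => ?_, fun h => by rw [h.1, h.2]⟩
  have h1 : a - c = d - b := by
    rw [sub_eq_sub_iff_add_eq_add, h, add_comm]
  have h2 : a - c = 0 := S.eq_zero_of_mem (S.h.sub_mem ha hc) (h1 ▸ S.m.sub_mem hd hb)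
  exact ⟨sub_eq_zero.1 h2, (sub_eq_zero.1 (h1 ▸ h2)).symm⟩

theorem add_eq_zero_iff {a b : L} (ha : a ∈ S.h) (hb : b ∈ S.m) : a + b = 0 ↔ a = 0 ∧ b = 0 := by
  simpa using S.add_eq_add_iff ha hb S.h.zero_mem S.m.zero_mem

/-- The projection onto `m` along `h`. -/
def projM : L →ₗ[ℝ] L := S.m.subtype ∘ₗ Submodule.projectionOnto S.m S.h.toSubmodule
  S.isCompl.symm

/-- The projection onto `h` along `m`. -/
def projH : L →ₗ[ℝ] L := LinearMap.id - S.projM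

theorem projM_mem (a : L) : S.projM a ∈ S.m := Subtype.mem _

theorem projM_of_mem_m {a : L} (ha : a ∈ S.m) : S.projM a = a := by
  have := Submodule.projectionOnto_apply_left S.isCompl.symm ⟨a, ha⟩
  simp [projM, this]

theorem projM_of_mem_h {a : L} (ha : a ∈ S.h) : S.projM a = 0 := by
  have := Submodule.projectionOnto_apply_right S.isCompl.symm ⟨a, ha⟩
  simp only [projM, LinearMap.comp_apply, this, map_zero]

theorem projH_add_projM (a : L) : S.projH a + S.projM a = a := by simp [projH]

theorem projH_mem (a : L) : S.projH a ∈ S.h := by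
  obtain ⟨b, hb, c, hc, rfl⟩ := S.exists_add a
  simpa [projH, S.projM_of_mem_h hb, S.projM_of_mem_m hc] using hb

theorem projH_of_mem_h {a : L} (ha : a ∈ S.h) : S.projH a = a := by
  simp [projH, S.projM_of_mem_h ha]

theorem projH_of_mem_m {a : L} (ha : a ∈ S.m) : S.projH a = 0 := by
  simp [projH, S.projM_of_mem_m ha]

theorem lie_A_lie_A (a : L) : ⁅S.A, ⁅S.A, a⁆⁆ = -S.projM a := by
  obtain ⟨b, hb, c, hc, rfl⟩ := S.exists_add a
  simp [S.projM_of_mem_h hb, S.projM_of_mem_m hc, S.lie_A_of_mem_h hb, S.ad_A_sq c hc]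

/-- Unlike `ad(A)² = -1`, this identity holds on all of `L` and does not mention `m`, so it can be
carried along the whole adjoint orbit. -/
theorem A_lie_triple (a : L) : ⁅S.A, ⁅S.A, ⁅S.A, a⁆⁆⁆ = -⁅S.A, a⁆ := by
  obtain ⟨b, hb, c, hc, rfl⟩ := S.exists_add a
  simp only [lie_add, S.lie_A_of_mem_h hb, zero_add]
  rw [S.ad_A_sq c hc, lie_neg]

/-- Write `b = -[A, [A, b]]`; invariance of the form moves the outer `A` onto `a`, which commutes
with `A`. -/
theorem killingForm_h_m {a b : L} (ha : a ∈ S.h) (hb : b ∈ S.m) : killingForm ℝ L a b = 0 := by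
  have h1 : b = -⁅S.A, ⁅S.A, b⁆⁆ := by rw [S.ad_A_sq b hb, neg_neg]
  rw [h1, map_neg, killingForm, ← LieModule.traceForm_apply_lie_apply, ← lie_skew,
    S.lie_A_of_mem_h ha]
  simp

/-- The second slot of `χ^{-1/2} (0, A)`. -/
def e₂ : L := (√S.chi)⁻¹ • S.A

theorem e_eq : S.e = (0, S.e₂) := by simp [e, e₂]

theorem lie_e₂_of_mem_h {a : L} (ha : a ∈ S.h) : ⁅S.e₂, a⁆ = 0 := by
  simp [e₂, S.lie_A_of_mem_h ha]

theorem lie_e₂_mem_m {a : L} (ha : a ∈ S.m) : ⁅S.e₂, a⁆ ∈ S.m := by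
  rw [e₂, smul_lie]
  exact S.m.smul_mem _ (S.lie_A_mem_m ha)

/-! ### The normalization `χ`, the parallel condition and the linearized orbit equation -/

section Finite

variable [FiniteDimensional ℝ L]

/-- `ad(A)²` is minus a projection onto `m`, and the trace of a projection is the dimension of its
range. -/
theorem chi_eq_finrank : S.chi = Module.finrank ℝ S.m := by
  have h1 : LinearMap.IsProj S.m S.projM := ⟨S.projM_mem, fun a ha => S.projM_of_mem_m ha⟩
  have h2 : LieAlgebra.ad ℝ L S.A ∘ₗ LieAlgebra.ad ℝ L S.A = -S.projM := by
    ext a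
    simpa using S.lie_A_lie_A a
  rw [chi, affInner, ← h1.trace]
  simp only [killingForm_apply_apply, h2, map_neg, map_zero, neg_zero]
  ring

theorem chi_pos : 0 < S.chi := by
  have : Nontrivial S.m := Submodule.nontrivial_iff_ne_bot.2 S.m_ne_bot
  rw [chi_eq_finrank]
  exact_mod_cast Module.finrank_pos

theorem inv_sqrt_chi_pos : 0 < (√S.chi)⁻¹ := inv_pos.2 (Real.sqrt_pos.2 S.chi_pos)

theorem inv_sqrt_chi_sq : (√S.chi)⁻¹ * (√S.chi)⁻¹ = S.chi⁻¹ := by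
  rw [← mul_inv, Real.mul_self_sqrt S.chi_pos.le]

theorem mem_h_iff_lie_e₂ (a : L) : a ∈ S.h ↔ ⁅S.e₂, a⁆ = 0 := by
  rw [e₂, smul_lie, smul_eq_zero_iff_right S.inv_sqrt_chi_pos.ne', S.centralizer_A]

theorem lie_e₂_lie_e₂ {a : L} (ha : a ∈ S.m) : ⁅S.e₂, ⁅S.e₂, a⁆⁆ = -(S.chi⁻¹ • a) := by
  simp only [e₂, smul_lie, lie_smul, smul_smul, S.ad_A_sq a ha, S.inv_sqrt_chi_sq, smul_neg]

theorem e₂_lie_triple (a : L) : ⁅S.e₂, ⁅S.e₂, ⁅S.e₂, a⁆⁆⁆ = -(S.chi⁻¹ • ⁅S.e₂, a⁆) := by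
  simp only [e₂, smul_lie, lie_smul, S.A_lie_triple, smul_neg, smul_smul, ← S.inv_sqrt_chi_sq]

theorem affInner_e : affInner S.e S.e = 1 := by
  have h : affInner S.e S.e = ((√S.chi)⁻¹ * (√S.chi)⁻¹) * S.chi := by
    simp only [e, affInner, chi, Prod.smul_fst, Prod.smul_snd, map_smul, LinearMap.smul_apply,
      smul_eq_mul]
    ring
  rw [h, S.inv_sqrt_chi_sq, inv_mul_cancel₀ S.chi_pos.ne']

theorem mem_hAffPar_iff (u : L × L) : u ∈ hAffPar S.e ↔ u.2 = 0 ∧ u.1 ∈ S.h := by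
  rw [S.mem_h_iff_lie_e₂, hAffPar, Set.mem_ofPred_eq]
  refine and_congr_right fun h => ?_
  simp [affBracket, S.e_eq, Prod.ext_iff]

variable [LieAlgebra.IsKilling ℝ L]

/-- The orthogonal complement of the centralizer of `χ^{-1/2} (0, A)` in `h_aff` is `m`. -/
theorem mem_hAffPerp_iff (u : L × L) : u ∈ hAffPerp S.e ↔ u.2 = 0 ∧ u.1 ∈ S.m := by
  rw [hAffPerp, Set.mem_ofPred_eq]
  refine and_congr_right fun h2 => ⟨fun h => ?_, fun h v hv => ?_⟩
  · obtain ⟨b, hb, c, hc, hbc⟩ := S.exists_add u.1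
    -- The `h`-component `b` is orthogonal to `h` by assumption and to `m` by `killingForm_h_m`, so
    -- nondegeneracy forces it to vanish.
    have hb0 : b = 0 := by
      refine eq_zero_of_forall_killingForm fun y => ?_
      obtain ⟨y1, hy1, y2, hy2, rfl⟩ := S.exists_add y
      have h3 := h (y1, 0) ((S.mem_hAffPar_iff _).2 ⟨rfl, hy1⟩)
      have h4 : killingForm ℝ L c y1 = 0 := by
        rw [LieModule.traceForm_comm]
        exact S.killingForm_h_m hy1 hc
      simp only [affInner, h2, ← hbc, map_add, LinearMap.add_apply, h4, map_zero] at h3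
      rw [map_add, S.killingForm_h_m hb hy2]
      linarith
    rw [← hbc, hb0, zero_add]
    exact hc
  · rw [S.mem_hAffPar_iff] at hv
    have h4 : killingForm ℝ L u.1 v.1 = 0 := by
      rw [LieModule.traceForm_comm]
      exact S.killingForm_h_m hv.2 h
    simp [affInner, h2, h4]

/-- A solution `v` of the linearization of `(ad T)³ = -χ⁻¹ ad T` at `T = χ^{-1/2} A` is in `m`. -/
theorem mem_m_of_linearized {v : L}
    (hv : ∀ x : L, ⁅v, ⁅S.e₂, ⁅S.e₂, x⁆⁆⁆ + ⁅S.e₂, ⁅v, ⁅S.e₂, x⁆⁆⁆ + ⁅S.e₂, ⁅S.e₂, ⁅v, x⁆⁆⁆ =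
      -(S.chi⁻¹ • ⁅v, x⁆)) : v ∈ S.m := by
  obtain ⟨b, hb, c, hc, rfl⟩ := S.exists_add v
  have hchi : S.chi⁻¹ ≠ 0 := inv_ne_zero S.chi_pos.ne'
  suffices hb0 : b = 0 by rw [hb0, zero_add]; exact hc
  -- The `h`-component `b` is shown to be central by testing the identity separately on `h` and on
  -- `m`.
  refine eq_zero_of_forall_lie fun x => ?_
  obtain ⟨y, hy, z, hz, rfl⟩ := S.exists_add x
  -- On `h` only `[e₂, [e₂, [c, y]]] = -χ⁻¹ [c, y]` survives on the left, which leaves `χ⁻¹ [b, y] =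
  -- 0`.
  have h1 : ⁅b, y⁆ = 0 := by
    have h := hv y
    have hbe : ⁅S.e₂, ⁅b, y⁆⁆ = 0 := S.lie_e₂_of_mem_h (S.h.lie_mem hb hy)
    rw [S.lie_e₂_of_mem_h hy, lie_zero, lie_zero, zero_add, lie_zero, zero_add, add_lie,
      lie_add, hbe, zero_add, S.lie_e₂_lie_e₂ (S.lie_m_h hc hy), smul_add, neg_add,
      right_eq_add, neg_eq_zero] at h
    exact (smul_eq_zero_iff_right hchi).1 h
  -- On `m` the first term cancels the right side, the brackets of `c` fall into `h` and are killed
  -- by `e₂`, and the two remaining terms are equal: `-2 χ⁻¹ [b, z] = 0`.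
  have h2 : ⁅b, z⁆ = 0 := by
    have h := hv z
    have hbz := S.lie_h_m b hb z hz
    have hc1 : ⁅S.e₂, ⁅c, ⁅S.e₂, z⁆⁆⁆ = 0 :=
      S.lie_e₂_of_mem_h (S.lie_m_m _ hc _ (S.lie_e₂_mem_m hz))
    have hc2 : ⁅S.e₂, ⁅c, z⁆⁆ = 0 := S.lie_e₂_of_mem_h (S.lie_m_m _ hc _ hz)
    have hb1 : ⁅b, ⁅S.e₂, z⁆⁆ = ⁅S.e₂, ⁅b, z⁆⁆ := by
      rw [leibniz_lie S.e₂ b z, S.lie_e₂_of_mem_h hb, zero_lie, zero_add]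
    rw [S.lie_e₂_lie_e₂ hz, lie_neg, lie_smul, add_assoc, add_eq_left, add_lie, add_lie, lie_add,
      lie_add, hc1, hc2, add_zero, add_zero, hb1, S.lie_e₂_lie_e₂ hbz, ← two_smul ℝ, smul_neg,
      neg_eq_zero, smul_smul] at h
    exact (smul_eq_zero_iff_right (mul_ne_zero two_ne_zero hchi)).1 h
  rw [lie_add, h1, h2, add_zero]

end Finite

end HermitianSymmetric

end

section

/-! ### Parametric derivatives of maps into a Lie group through the identity -/

variable {E : Type*} [NormedAddCommGroup E] [NormedSpace ℝ E]

theorem SmoothGroup.swap {G : Type*} [TopologicalSpace G] [ChartedSpace E G] {ψ : ℝ → ℝ → G}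
    (hψ : SmoothGroup E ψ) : SmoothGroup E (fun t x => ψ x t) :=
  hψ.comp (contDiff_snd.prodMk contDiff_fst).contMDiff

variable {G : Type*} [TopologicalSpace G] [ChartedSpace E G] [Group G] [LieGroup 𝓘(ℝ, E) ∞ G]

/-- Tangent coordinates insert a change of chart even when the two charts are only propositionally
equal; this removes it. -/
theorem coordChange_achart_self {F H M : Type*} [NormedAddCommGroup F] [NormedSpace ℝ F]
    [TopologicalSpace H] {I : ModelWithCorners ℝ F H} [TopologicalSpace M] [ChartedSpace H M]
    [IsManifold I 1 M] {i j : atlas H M} {x : M} (hij : i = j) (hi : x ∈ i.1.source) (v : F) :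
    (tangentBundleCore I M).coordChange i j x v = v := by
  subst hij
  exact (tangentBundleCore I M).coordChange_self i x hi v

/-- The derivatives of a smooth family of maps at points where they take the value `1` depend
smoothly on the parameter, without any change of coordinates. -/
theorem contMDiffAt_mfderiv_of_eq_one {F H M F' H' N : Type*}
    [NormedAddCommGroup F] [NormedSpace ℝ F] [TopologicalSpace H] {I : ModelWithCorners ℝ F H}
    [TopologicalSpace M] [ChartedSpace H M] [IsManifold I ∞ M]
    [NormedAddCommGroup F'] [NormedSpace ℝ F'] [TopologicalSpace H']
    {J : ModelWithCorners ℝ F' H'} [TopologicalSpace N] [ChartedSpace H' N] [IsManifold J ∞ N]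
    {f : N → M → G} {g : N → M} {x₀ : N}
    (hf : ContMDiffAt (J.prod I) 𝓘(ℝ, E) ∞ (Function.uncurry f) (x₀, g x₀))
    (hg : ContMDiffAt J I ∞ g x₀) (hfg : ∀ x, f x (g x) = 1)
    (hc : ∀ x, achart H (g x) = achart H (g x₀)) :
    ContMDiffAt J 𝓘(ℝ, F →L[ℝ] E) ∞
      (fun x => show F →L[ℝ] E from mfderiv I 𝓘(ℝ, E) (f x) (g x)) x₀ := by
  have : IsManifold I 1 M := IsManifold.of_le (n := ∞) (by simp)
  have : IsManifold J 1 N := IsManifold.of_le (n := ∞) (by simp)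
  have : IsManifold 𝓘(ℝ, E) 1 G := IsManifold.of_le (n := ∞) (by simp)
  have h := ContMDiffAt.mfderiv (m := ∞) (n := ∞) f g hf hg (by simp)
  -- The general theorem gives smoothness in tangent coordinates. Here the charts at `g x` and at `f
  -- x (g x) = 1` do not move, so these coordinates change nothing.
  refine h.congr_of_eventuallyEq (Filter.Eventually.of_forall fun x => ?_)
  have hx : g x ∈ (chartAt H (g x₀)).source := by
    have := mem_chart_source H (g x)
    have e : chartAt H (g x) = chartAt H (g x₀) := congrArg Subtype.val (hc x)
    rwa [e] at this
  have hy : f x (g x) ∈ (chartAt E (f x₀ (g x₀))).source := by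
    rw [hfg, hfg]
    exact mem_chart_source E 1
  refine Eq.trans ?_ (inTangentCoordinates_eq (I := I) (I' := 𝓘(ℝ, E)) g (fun x => f x (g x))
    (fun x => mfderiv I 𝓘(ℝ, E) (f x) (g x)) hx hy).symm
  refine ContinuousLinearMap.ext fun v => Eq.symm ?_
  refine (coordChange_achart_self ?_ ?_ _).trans (congrArg _ (coordChange_achart_self ?_ ?_ _))
  · rw [hfg, hfg]
  · exact mem_chart_source _ _
  · exact (hc x).symm
  · exact hx

variable (E) in
/-- The adjoint action, as a family of endomorphisms of the model space. -/
def AdE (g : G) : E →L[ℝ] E := Ad E g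

theorem contMDiff_AdE : ContMDiff 𝓘(ℝ, E) 𝓘(ℝ, E →L[ℝ] E) ∞ (AdE E : G → E →L[ℝ] E) := by
  intro g₀
  have : IsManifold 𝓘(ℝ, E) ∞ G := inferInstance
  refine contMDiffAt_mfderiv_of_eq_one (f := fun (g : G) (z : G) => g * z * g⁻¹)
    (g := fun _ => (1 : G)) ?_ contMDiffAt_const (fun x => by simp) (fun x => rfl)
  exact ((contMDiff_fst.mul contMDiff_snd).mul contMDiff_fst.inv).contMDiffAt

variable (E) in
/-- The velocity at `x` of the curve `s ↦ f(x)⁻¹ f(s)` through `1`. -/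
def logDeriv (f : ℝ → G) (x : ℝ) : E :=
  mfderiv 𝓘(ℝ, ℝ) 𝓘(ℝ, E) (fun s : ℝ => (f x)⁻¹ * f s) x (1 : ℝ)

theorem contDiff_logDeriv_fst {ψ : ℝ → ℝ → G} (hψ : SmoothGroup E ψ) :
    ContDiff ℝ ∞ (fun p : ℝ × ℝ => logDeriv E (fun s => ψ s p.2) p.1) := by
  rw [← contMDiff_iff_contDiff]
  intro p₀
  have h := contMDiffAt_mfderiv_of_eq_one (E := E) (I := 𝓘(ℝ, ℝ)) (J := 𝓘(ℝ, ℝ × ℝ))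
    (f := fun (p : ℝ × ℝ) (s : ℝ) => (ψ p.1 p.2)⁻¹ * ψ s p.2)
    (g := fun p : ℝ × ℝ => p.1) (x₀ := p₀) ?_ (contDiff_fst.contMDiff.contMDiffAt)
    (fun x => by simp) (fun x => rfl)
  · exact h.clm_apply contMDiffAt_const
  · have h1 : ContMDiff (𝓘(ℝ, ℝ × ℝ).prod 𝓘(ℝ, ℝ)) 𝓘(ℝ, ℝ × ℝ) ∞
        (fun q : (ℝ × ℝ) × ℝ => (q.2, q.1.2)) := by
      refine contMDiff_snd.prodMk_space ?_
      exact contDiff_snd.contMDiff.comp contMDiff_fst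
    exact ((hψ.comp contMDiff_fst).inv.mul (hψ.comp h1)).contMDiffAt

theorem contDiff_logDeriv_snd {ψ : ℝ → ℝ → G} (hψ : SmoothGroup E ψ) :
    ContDiff ℝ ∞ (fun p : ℝ × ℝ => logDeriv E (fun s => ψ p.1 s) p.2) :=
  (contDiff_logDeriv_fst hψ.swap).comp (contDiff_snd.prodMk contDiff_fst)

end

section

/-! ### The group law in the chart at the identity -/

variable {E : Type*} [NormedAddCommGroup E] [NormedSpace ℝ E]
  {G : Type*} [TopologicalSpace G] [ChartedSpace E G] [Group G]

variable (E G) in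
/-- The coordinates of `1` in the chart at `1`. -/
def chartOne : E := extChartAt 𝓘(ℝ, E) (1 : G) 1

variable (E G) in
/-- The product of the group, read in the chart at `1`. -/
def chartMul (p : E × E) : E :=
  extChartAt 𝓘(ℝ, E) (1 : G)
    ((extChartAt 𝓘(ℝ, E) (1 : G)).symm p.1 * (extChartAt 𝓘(ℝ, E) (1 : G)).symm p.2)

theorem extChartAt_symm_chartOne : (extChartAt 𝓘(ℝ, E) (1 : G)).symm (chartOne E G) = 1 :=
  extChartAt_to_inv 1

theorem target_mem_nhds_chartOne :
    (extChartAt 𝓘(ℝ, E) (1 : G)).target ∈ 𝓝 (chartOne E G) :=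
  extChartAt_target_mem_nhds 1

theorem mfderiv_one_eq_fderiv {W : Type*} [NormedAddCommGroup W] [NormedSpace ℝ W] {Φ : G → W}
    (hΦ : MDifferentiableAt 𝓘(ℝ, E) 𝓘(ℝ, W) Φ 1) (v : E) :
    @Eq W (mfderiv 𝓘(ℝ, E) 𝓘(ℝ, W) Φ 1 v)
      (fderiv ℝ (fun u => Φ ((extChartAt 𝓘(ℝ, E) (1 : G)).symm u)) (chartOne E G) v) := by
  rw [hΦ.mfderiv]
  simp only [writtenInExtChartAt, extChartAt_model_space_eq_id, PartialEquiv.refl_coe,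
    Function.id_comp, modelWithCornersSelf_coe, Set.range_id, fderivWithin_univ]
  rfl

theorem differentiableAt_of_mdifferentiableAt_one {W : Type*} [NormedAddCommGroup W]
    [NormedSpace ℝ W] {Φ : G → W} (hΦ : MDifferentiableAt 𝓘(ℝ, E) 𝓘(ℝ, W) Φ 1) :
    DifferentiableAt ℝ (fun u => Φ ((extChartAt 𝓘(ℝ, E) (1 : G)).symm u)) (chartOne E G) := by
  have h := hΦ.differentiableWithinAt_writtenInExtChartAt
  simpa only [writtenInExtChartAt, extChartAt_model_space_eq_id, PartialEquiv.refl_coe,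
    Function.id_comp, modelWithCornersSelf_coe, Set.range_id, differentiableWithinAt_univ] using! h

theorem chartMul_one_left :
    ∀ᶠ u in 𝓝 (chartOne E G), chartMul E G (chartOne E G, u) = u := by
  filter_upwards [target_mem_nhds_chartOne (E := E) (G := G)] with u hu
  rw [chartMul, extChartAt_symm_chartOne, one_mul, (extChartAt 𝓘(ℝ, E) (1 : G)).right_inv hu]

theorem chartMul_one_right :
    ∀ᶠ u in 𝓝 (chartOne E G), chartMul E G (u, chartOne E G) = u := by
  filter_upwards [target_mem_nhds_chartOne (E := E) (G := G)] with u hu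
  rw [chartMul, extChartAt_symm_chartOne, mul_one, (extChartAt 𝓘(ℝ, E) (1 : G)).right_inv hu]

variable [LieGroup 𝓘(ℝ, E) ∞ G]

theorem mfderiv_extChartAt_one (v : E) :
    @Eq E (mfderiv 𝓘(ℝ, E) 𝓘(ℝ, E) (extChartAt 𝓘(ℝ, E) (1 : G)) 1 v) v := by
  have : IsManifold 𝓘(ℝ, E) 1 G := IsManifold.of_le (n := ∞) (by simp)
  refine (mfderiv_one_eq_fderiv (mdifferentiableAt_extChartAt (mem_chart_source E 1)) v).trans ?_
  have h : (fun u => extChartAt 𝓘(ℝ, E) (1 : G) ((extChartAt 𝓘(ℝ, E) (1 : G)).symm u))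
      =ᶠ[𝓝 (chartOne E G)] id := by
    filter_upwards [target_mem_nhds_chartOne (E := E) (G := G)] with u hu
    exact (extChartAt 𝓘(ℝ, E) (1 : G)).right_inv hu
  rw [h.fderiv_eq, fderiv_id]
  rfl

/-- With the second factor equal to `1` the product stays in the chart domain for every `u` in the
target, not just near `1`. The cutoff in `exists_contDiff_eq_leftD` needs this range. -/
theorem contDiffAt_chartMul_of_mem {u : E} (hu : u ∈ (extChartAt 𝓘(ℝ, E) (1 : G)).target) :
    ContDiffAt ℝ ∞ (chartMul E G) (u, chartOne E G) := by
  have hs : ∀ v ∈ (extChartAt 𝓘(ℝ, E) (1 : G)).target,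
      ContMDiffAt 𝓘(ℝ, E) 𝓘(ℝ, E) ∞ (extChartAt 𝓘(ℝ, E) (1 : G)).symm v := fun v hv =>
    (contMDiffOn_extChartAt_symm (1 : G)).contMDiffAt ((isOpen_extChartAt_target 1).mem_nhds hv)
  have h1 : ContMDiffAt 𝓘(ℝ, E × E) 𝓘(ℝ, E) ∞ (fun p : E × E =>
      (extChartAt 𝓘(ℝ, E) (1 : G)).symm p.1 * (extChartAt 𝓘(ℝ, E) (1 : G)).symm p.2)
      (u, chartOne E G) :=
    (ContMDiffAt.comp (u, chartOne E G) (hs u hu) contDiff_fst.contMDiff.contMDiffAt).mul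
      (ContMDiffAt.comp (u, chartOne E G) (hs _ (mem_of_mem_nhds target_mem_nhds_chartOne))
        contDiff_snd.contMDiff.contMDiffAt)
  rw [← contMDiffAt_iff_contDiffAt]
  refine ContMDiffAt.comp (u, chartOne E G) ?_ h1
  simp only [extChartAt_symm_chartOne, mul_one]
  refine contMDiffAt_extChartAt' ?_
  have := (extChartAt 𝓘(ℝ, E) (1 : G)).map_target hu
  rwa [extChartAt_source] at this

theorem contDiffAt_chartMul :
    ContDiffAt ℝ ∞ (chartMul E G) (chartOne E G, chartOne E G) :=
  contDiffAt_chartMul_of_mem (mem_of_mem_nhds target_mem_nhds_chartOne)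

variable (E G) in
/-- The derivative at `1` of the left translation by the point with coordinate `u`, in the
chart. -/
def leftD (u : E) : E →L[ℝ] E :=
  (fderiv ℝ (chartMul E G) (u, chartOne E G)).comp (ContinuousLinearMap.inr ℝ E E)

variable (E G) in
/-- The derivative at `1` of the right translation by the point with coordinate `u`. -/
def rightD (u : E) : E →L[ℝ] E :=
  (fderiv ℝ (chartMul E G) (chartOne E G, u)).comp (ContinuousLinearMap.inl ℝ E E)

theorem contDiffAt_leftD_of_mem {u : E} (hu : u ∈ (extChartAt 𝓘(ℝ, E) (1 : G)).target) :
    ContDiffAt ℝ ∞ (leftD E G) u := by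
  have h : ContDiffAt ℝ ∞ (fun u => fderiv ℝ (chartMul E G) (u, chartOne E G)) u :=
    ContDiffAt.comp (f := fun u => (u, chartOne E G)) u
      ((contDiffAt_chartMul_of_mem hu).fderiv_right (m := ∞) (by simp))
      (contDiffAt_id.prodMk contDiffAt_const)
  exact h.clm_comp contDiffAt_const

theorem contDiffAt_leftD : ContDiffAt ℝ ∞ (leftD E G) (chartOne E G) :=
  contDiffAt_leftD_of_mem (mem_of_mem_nhds target_mem_nhds_chartOne)

theorem contDiffAt_rightD : ContDiffAt ℝ ∞ (rightD E G) (chartOne E G) := by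
  have h : ContDiffAt ℝ ∞ (fun u => fderiv ℝ (chartMul E G) (chartOne E G, u)) (chartOne E G) :=
    (contDiffAt_chartMul.fderiv_right (m := ∞) (by simp)).comp (chartOne E G)
      (contDiffAt_const.prodMk contDiffAt_id)
  exact h.clm_comp contDiffAt_const

theorem eventually_differentiableAt_chartMul :
    ∀ᶠ p in 𝓝 (chartOne E G, chartOne E G), DifferentiableAt ℝ (chartMul E G) p := by
  have h := (contDiffAt_chartMul (E := E) (G := G)).of_le (m := 1) (by simp)
  filter_upwards [h.eventually (by simp)] with p hp
  exact hp.differentiableAt (by simp)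

theorem eventually_leftD_eq : ∀ᶠ u in 𝓝 (chartOne E G),
    fderiv ℝ (fun w => chartMul E G (u, w)) (chartOne E G) = leftD E G u := by
  have h : Filter.Tendsto (fun u => (u, chartOne E G)) (𝓝 (chartOne E G))
      (𝓝 (chartOne E G, chartOne E G)) := by
    exact (continuous_id.prodMk continuous_const).tendsto _
  filter_upwards [h.eventually eventually_differentiableAt_chartMul] with u hu
  have h2 : HasFDerivAt (fun w : E => (u, w)) (ContinuousLinearMap.inr ℝ E E) (chartOne E G) :=
    hasFDerivAt_prodMk_right u _
  have h3 := (hu.hasFDerivAt.comp (chartOne E G) h2).fderiv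
  rw [leftD, ← h3]
  rfl

theorem eventually_rightD_eq : ∀ᶠ u in 𝓝 (chartOne E G),
    fderiv ℝ (fun w => chartMul E G (w, u)) (chartOne E G) = rightD E G u := by
  have h : Filter.Tendsto (fun u => (chartOne E G, u)) (𝓝 (chartOne E G))
      (𝓝 (chartOne E G, chartOne E G)) := by
    exact (continuous_const.prodMk continuous_id).tendsto _
  filter_upwards [h.eventually eventually_differentiableAt_chartMul] with u hu
  have h2 : HasFDerivAt (fun w : E => (w, u)) (ContinuousLinearMap.inl ℝ E E) (chartOne E G) :=
    hasFDerivAt_prodMk_left _ u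
  have h3 := (hu.hasFDerivAt.comp (chartOne E G) h2).fderiv
  rw [rightD, ← h3]
  rfl

theorem leftD_one : leftD E G (chartOne E G) = ContinuousLinearMap.id ℝ E := by
  ext v
  rw [← (eventually_leftD_eq).self_of_nhds]
  have h : (fun w => chartMul E G (chartOne E G, w)) =ᶠ[𝓝 (chartOne E G)] id := chartMul_one_left
  rw [h.fderiv_eq, fderiv_id]

theorem rightD_one : rightD E G (chartOne E G) = ContinuousLinearMap.id ℝ E := by
  ext v
  rw [← (eventually_rightD_eq).self_of_nhds]
  have h : (fun w => chartMul E G (w, chartOne E G)) =ᶠ[𝓝 (chartOne E G)] id := chartMul_one_right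
  rw [h.fderiv_eq, fderiv_id]

/-- Both sides are the mixed second derivative of the multiplication at `(1, 1)`, taken in opposite
orders. -/
theorem fderiv_rightD (v w : E) :
    fderiv ℝ (rightD E G) (chartOne E G) v w = fderiv ℝ (leftD E G) (chartOne E G) w v := by
  have hd : DifferentiableAt ℝ (fderiv ℝ (chartMul E G)) (chartOne E G, chartOne E G) :=
    (contDiffAt_chartMul.fderiv_right (m := 1) (by decide)).differentiableAt (by simp)
  have hl : HasFDerivAt (leftD E G) _ (chartOne E G) :=
    (HasFDerivAt.comp (f := fun u => (u, chartOne E G)) (chartOne E G) hd.hasFDerivAt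
      (hasFDerivAt_prodMk_left (chartOne E G) (chartOne E G))).clm_comp
        (hasFDerivAt_const (ContinuousLinearMap.inr ℝ E E) _)
  have hr : HasFDerivAt (rightD E G) _ (chartOne E G) :=
    (HasFDerivAt.comp (f := fun u => (chartOne E G, u)) (chartOne E G) hd.hasFDerivAt
      (hasFDerivAt_prodMk_right (chartOne E G) (chartOne E G))).clm_comp
        (hasFDerivAt_const (ContinuousLinearMap.inl ℝ E E) _)
  rw [hl.fderiv, hr.fderiv]
  have hs := (contDiffAt_chartMul (E := E) (G := G)).isSymmSndFDerivAt
    (by rw [minSmoothness_of_isRCLikeNormedField]; exact ENat.LEInfty.out)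
  simpa using hs.eq (0, v) (w, 0)

end

section

/-! ### The derivative of the adjoint action -/

variable {E : Type*} [NormedAddCommGroup E] [NormedSpace ℝ E]
  {G : Type*} [TopologicalSpace G] [ChartedSpace E G] [Group G]

/-- Points with coordinates near those of `1` are in the domain of the chart at `1`. -/
theorem eventually_symm_mem_source : ∀ᶠ u in 𝓝 (chartOne E G),
    (extChartAt 𝓘(ℝ, E) (1 : G)).symm u ∈ (chartAt E (1 : G)).source := by
  filter_upwards [target_mem_nhds_chartOne (E := E) (G := G)] with u hu
  rw [← extChartAt_source 𝓘(ℝ, E)]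
  exact (extChartAt 𝓘(ℝ, E) (1 : G)).map_target hu

theorem AdE_one : AdE E (1 : G) = ContinuousLinearMap.id ℝ E := Ad_one E

variable [LieGroup 𝓘(ℝ, E) ∞ G]

theorem mdifferentiable_mul_left (g : G) :
    MDifferentiable 𝓘(ℝ, E) 𝓘(ℝ, E) (fun z : G => g * z) :=
  (contMDiff_mul_left (n := ∞)).mdifferentiable (by simp)

theorem mdifferentiable_mul_right (g : G) :
    MDifferentiable 𝓘(ℝ, E) 𝓘(ℝ, E) (fun z : G => z * g) :=
  (contMDiff_mul_right (n := ∞)).mdifferentiable (by simp)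

/-- In the chart at `1`, left invariant vector fields are given by `leftD`. -/
theorem eventually_mpullbackWithin_mulInvariantVectorField (v : E) :
    ∀ᶠ u in 𝓝 (chartOne E G), @Eq E (VectorField.mpullbackWithin 𝓘(ℝ, E) 𝓘(ℝ, E)
      (extChartAt 𝓘(ℝ, E) (1 : G)).symm (mulInvariantVectorField (I := 𝓘(ℝ, E)) (G := G) v)
      (Set.range 𝓘(ℝ, E)) u) (leftD E G u v) := by
  have : IsManifold 𝓘(ℝ, E) 1 G := IsManifold.of_le (n := ∞) (by simp)
  filter_upwards [target_mem_nhds_chartOne (E := E) (G := G), eventually_leftD_eq (E := E) (G := G),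
    eventually_symm_mem_source (E := E) (G := G)] with u hu hl hs
  rw [← hl]
  have hinv := ContinuousLinearMap.inverse_eq
    (mfderivWithin_extChartAt_symm_comp_mfderiv_extChartAt hu)
    (mfderiv_extChartAt_comp_mfderivWithin_extChartAt_symm hu)
  refine (DFunLike.congr_fun hinv _).trans ?_
  clear hinv hl
  simp only [chartMul]
  generalize (extChartAt 𝓘(ℝ, E) (1 : G)).symm u = g at hs
  have hc : MDifferentiableAt 𝓘(ℝ, E) 𝓘(ℝ, E) (extChartAt 𝓘(ℝ, E) (1 : G)) (g * 1) := by
    rw [mul_one]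
    exact mdifferentiableAt_extChartAt hs
  have h1 := mfderiv_comp (I' := 𝓘(ℝ, E)) (1 : G) hc (mdifferentiable_mul_left g 1)
  have h2 := mfderiv_one_eq_fderiv (hc.comp (1 : G) (mdifferentiable_mul_left g 1)) v
  refine Eq.trans ?_ h2
  refine Eq.trans ?_ (DFunLike.congr_fun h1 v).symm
  change mfderiv 𝓘(ℝ, E) 𝓘(ℝ, E) (extChartAt 𝓘(ℝ, E) (1 : G)) g _
    = mfderiv 𝓘(ℝ, E) 𝓘(ℝ, E) (extChartAt 𝓘(ℝ, E) (1 : G)) (g * 1) _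
  rw [mul_one]
  rfl

/-- The Lie bracket, in terms of the group law in the chart at `1`. -/
theorem lie_eq_fderiv_leftD (v w : GroupLieAlgebra 𝓘(ℝ, E) G) :
    @Eq E (⁅v, w⁆ : GroupLieAlgebra 𝓘(ℝ, E) G)
      (fderiv ℝ (leftD E G) (chartOne E G) v w - fderiv ℝ (leftD E G) (chartOne E G) w v) := by
  have hd : DifferentiableAt ℝ (leftD E G) (chartOne E G) :=
    contDiffAt_leftD.differentiableAt (by simp)
  have hX : ∀ a : E, VectorField.mpullbackWithin 𝓘(ℝ, E) 𝓘(ℝ, E)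
      (extChartAt 𝓘(ℝ, E) (1 : G)).symm (mulInvariantVectorField (I := 𝓘(ℝ, E)) (G := G) a)
      (Set.range 𝓘(ℝ, E)) =ᶠ[𝓝 (chartOne E G)] (fun u => leftD E G u a : E → E) :=
    eventually_mpullbackWithin_mulInvariantVectorField
  have hX' : ∀ a b : E, fderiv ℝ (fun u => leftD E G u a) (chartOne E G) b
      = fderiv ℝ (leftD E G) (chartOne E G) b a := by
    intro a b
    have h := (hd.hasFDerivAt.clm_apply (hasFDerivAt_const a _)).fderiv
    rw [h]
    simp
  -- The bracket depends only on the germs of the two fields, so they may be replaced by `leftD`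
  -- near the base point.
  have key : ∀ (X Y : E → E) (s : Set E), s = Set.univ →
      X =ᶠ[𝓝 (chartOne E G)] (fun u => leftD E G u v : E → E) →
      Y =ᶠ[𝓝 (chartOne E G)] (fun u => leftD E G u w : E → E) →
      VectorField.lieBracketWithin ℝ X Y s (chartOne E G) =
        (fderiv ℝ (leftD E G) (chartOne E G) v w - fderiv ℝ (leftD E G) (chartOne E G) w v) := by
    rintro X Y s rfl hXv hYw
    rw [VectorField.lieBracketWithin_univ, VectorField.lieBracket_eq]
    dsimp only
    rw [hXv.fderiv_eq, hYw.fderiv_eq, hXv.eq_of_nhds, hYw.eq_of_nhds, leftD_one]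
    exact congrArg₂ (· - ·) (hX' w v) (hX' v w)
  have : IsManifold 𝓘(ℝ, E) 1 G := IsManifold.of_le (n := ∞) (by simp)
  have hc : (mfderiv 𝓘(ℝ, E) 𝓘(ℝ, E) (extChartAt 𝓘(ℝ, E) (1 : G)) 1).IsInvertible :=
    isInvertible_mfderiv_extChartAt (mem_extChartAt_source 1)
  -- The bracket computed in the chart is brought back by the inverse derivative of the chart at
  -- `1`, which is the identity.
  have hi : ∀ z : E, @Eq E ((mfderiv 𝓘(ℝ, E) 𝓘(ℝ, E) (extChartAt 𝓘(ℝ, E) (1 : G)) 1).inverse z) z :=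
    fun z => hc.inverse_apply_eq.2 (mfderiv_extChartAt_one z).symm
  refine Eq.trans (hi _) ?_
  exact key _ _ _ (by simp) (hX v) (hX w)

/-- Left translation by `g` is conjugation by `g` followed by right translation by `g`;
differentiate at `1`. -/
theorem rightD_AdE : ∀ᶠ u in 𝓝 (chartOne E G), ∀ w,
    rightD E G u (AdE E ((extChartAt 𝓘(ℝ, E) (1 : G)).symm u) w) = leftD E G u w := by
  have : IsManifold 𝓘(ℝ, E) 1 G := IsManifold.of_le (n := ∞) (by simp)
  filter_upwards [eventually_leftD_eq (E := E) (G := G), eventually_rightD_eq (E := E) (G := G),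
    eventually_symm_mem_source (E := E) (G := G)] with u hl hr hs w
  rw [← hl, ← hr]
  simp only [chartMul]
  generalize (extChartAt 𝓘(ℝ, E) (1 : G)).symm u = g at hs
  have hc : ∀ z : G, z = g → MDifferentiableAt 𝓘(ℝ, E) 𝓘(ℝ, E) (extChartAt 𝓘(ℝ, E) (1 : G)) z := by
    rintro z rfl
    exact mdifferentiableAt_extChartAt hs
  have hL := (hc (g * 1) (mul_one g)).comp (1 : G) (mdifferentiable_mul_left g 1)
  have hR := (hc (1 * g) (one_mul g)).comp (1 : G) (mdifferentiable_mul_right g 1)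
  have hR' : MDifferentiableAt 𝓘(ℝ, E) 𝓘(ℝ, E)
      (extChartAt 𝓘(ℝ, E) (1 : G) ∘ fun z => z * g) (g * 1 * g⁻¹) := by
    have h1 : g * 1 * g⁻¹ = 1 := by simp
    rw [h1]
    exact hR
  have h1 := mfderiv_comp (I' := 𝓘(ℝ, E)) (1 : G) hR' (mdifferentiable_conj E g 1)
  have h2 : (extChartAt 𝓘(ℝ, E) (1 : G) ∘ fun z => z * g) ∘ (fun z : G => g * z * g⁻¹) =
      extChartAt 𝓘(ℝ, E) (1 : G) ∘ fun z => g * z := by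
    ext z
    simp
  rw [h2] at h1
  refine Eq.trans ?_ (mfderiv_one_eq_fderiv hL w)
  refine Eq.trans ?_ (DFunLike.congr_fun h1 w).symm
  refine (mfderiv_one_eq_fderiv hR _).symm.trans ?_
  change mfderiv 𝓘(ℝ, E) 𝓘(ℝ, E) (extChartAt 𝓘(ℝ, E) (1 : G) ∘ fun z => z * g) 1 _
    = mfderiv 𝓘(ℝ, E) 𝓘(ℝ, E) (extChartAt 𝓘(ℝ, E) (1 : G) ∘ fun z => z * g) (g * 1 * g⁻¹) _
  have h3 : g * 1 * g⁻¹ = 1 := by simp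
  rw [h3]
  rfl

theorem AdE_mul (g k : G) : AdE E (g * k) = (AdE E g).comp (AdE E k) := Ad_mul E g k

variable (E G) in
/-- The derivative of the adjoint action at `1`, a continuous bilinear map. -/
def adE : E →L[ℝ] E →L[ℝ] E := mfderiv 𝓘(ℝ, E) 𝓘(ℝ, E →L[ℝ] E) (AdE E : G → E →L[ℝ] E) 1

/-- Differentiate `rightD u ∘ Ad u = leftD u` at `1`, where `rightD` and `Ad` are the identity, and
replace the derivative of `rightD` by that of `leftD` with swapped arguments. -/
theorem adE_eq_fderiv_leftD (v w : E) :
    adE E G v w = fderiv ℝ (leftD E G) (chartOne E G) v w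
      - fderiv ℝ (leftD E G) (chartOne E G) w v := by
  have hA : MDifferentiableAt 𝓘(ℝ, E) 𝓘(ℝ, E →L[ℝ] E) (AdE E : G → E →L[ℝ] E) 1 :=
    contMDiff_AdE.mdifferentiable (by simp) 1
  have hr : DifferentiableAt ℝ (rightD E G) (chartOne E G) :=
    contDiffAt_rightD.differentiableAt (by simp)
  have hA' := differentiableAt_of_mdifferentiableAt_one hA
  have h1 : (fun u => (rightD E G u).comp (AdE E ((extChartAt 𝓘(ℝ, E) (1 : G)).symm u)))
      =ᶠ[𝓝 (chartOne E G)] leftD E G := by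
    filter_upwards [rightD_AdE (E := E) (G := G)] with u hu
    ext w
    exact hu w
  have h2 := (hr.hasFDerivAt.clm_comp hA'.hasFDerivAt).fderiv
  rw [h1.fderiv_eq] at h2
  have h3 := congrArg (fun L : E →L[ℝ] E →L[ℝ] E => L v w) h2
  simp only [rightD_one, extChartAt_symm_chartOne, AdE_one] at h3
  change fderiv ℝ (leftD E G) (chartOne E G) v w =
    fderiv ℝ (fun u => AdE E ((extChartAt 𝓘(ℝ, E) (1 : G)).symm u)) (chartOne E G) v w
      + fderiv ℝ (rightD E G) (chartOne E G) v w at h3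
  rw [fderiv_rightD] at h3
  refine (congrArg (fun L : E →L[ℝ] E => L w) (mfderiv_one_eq_fderiv hA v)).trans ?_
  exact eq_sub_of_add_eq h3.symm

/-- The derivative of the adjoint action at `1` is the Lie bracket. -/
theorem adE_apply (v w : GroupLieAlgebra 𝓘(ℝ, E) G) :
    @Eq E (adE E G v w) (⁅v, w⁆ : GroupLieAlgebra 𝓘(ℝ, E) G) :=
  (adE_eq_fderiv_leftD (E := E) (G := G) v w).trans (lie_eq_fderiv_leftD v w).symm

end

section

/-! ### Logarithmic derivatives of curves in a Lie group -/

variable {E : Type*} [NormedAddCommGroup E] [NormedSpace ℝ E]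
  {G : Type*} [TopologicalSpace G] [ChartedSpace E G] [Group G]

theorem logDeriv_const_mul (f : ℝ → G) (g : G) (x : ℝ) :
    logDeriv E (fun s => g * f s) x = logDeriv E f x := by
  have h : ∀ F F' : ℝ → G, F = F' → @Eq E (mfderiv 𝓘(ℝ, ℝ) 𝓘(ℝ, E) F x (1 : ℝ))
      (mfderiv 𝓘(ℝ, ℝ) 𝓘(ℝ, E) F' x (1 : ℝ)) := by
    rintro F F' rfl
    rfl
  exact h _ _ (funext fun s => by group)

variable [LieGroup 𝓘(ℝ, E) ∞ G]

variable (E) in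
/-- The velocity of a curve in the group, in the fixed model space. -/
def velocity (a : ℝ → G) (x : ℝ) : E := mfderiv 𝓘(ℝ, ℝ) 𝓘(ℝ, E) a x (1 : ℝ)

/-- The derivative at `1` of a vector valued function on the group. -/
def mfderivOne {W : Type*} [NormedAddCommGroup W] [NormedSpace ℝ W] (Φ : G → W) : E →L[ℝ] W :=
  mfderiv 𝓘(ℝ, E) 𝓘(ℝ, W) Φ 1

omit [LieGroup 𝓘(ℝ, E) ∞ G] in
-- The chain rule for curves passing through `1`, where the velocity is an element of the fixed
-- space `E`; a general curve is first translated to `1`.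
theorem hasDerivAt_comp_of_eq_one {W : Type*} [NormedAddCommGroup W] [NormedSpace ℝ W]
    {Φ : G → W} {a : ℝ → G} {x : ℝ} (hΦ : MDifferentiableAt 𝓘(ℝ, E) 𝓘(ℝ, W) Φ 1)
    (ha : MDifferentiableAt 𝓘(ℝ, ℝ) 𝓘(ℝ, E) a x) (h1 : a x = 1) :
    HasDerivAt (fun s => Φ (a s)) (mfderivOne (E := E) Φ (velocity E a x)) x := by
  have hΦ' : MDifferentiableAt 𝓘(ℝ, E) 𝓘(ℝ, W) Φ (a x) := by rwa [h1]
  have h : HasFDerivAt (fun s => Φ (a s)) (show ℝ →L[ℝ] W from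
      (mfderiv 𝓘(ℝ, E) 𝓘(ℝ, W) Φ (a x)).comp (mfderiv 𝓘(ℝ, ℝ) 𝓘(ℝ, E) a x)) x :=
    (hΦ'.hasMFDerivAt.comp x ha.hasMFDerivAt).hasFDerivAt
  have h2 : ∀ g : G, g = 1 → ∀ v : E, @Eq W (mfderiv 𝓘(ℝ, E) 𝓘(ℝ, W) Φ g v)
      (mfderivOne (E := E) Φ v) := by
    rintro g rfl v
    rfl
  exact (h2 _ h1 (velocity E a x)) ▸ h.hasDerivAt

theorem mdifferentiableAt_AdE (g : G) :
    MDifferentiableAt 𝓘(ℝ, E) 𝓘(ℝ, E →L[ℝ] E) (AdE E : G → E →L[ℝ] E) g :=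
  contMDiff_AdE.mdifferentiable (by simp) g

theorem mdifferentiableAt_const_mul {f : ℝ → G} {x : ℝ}
    (hf : MDifferentiableAt 𝓘(ℝ, ℝ) 𝓘(ℝ, E) f x) (g : G) :
    MDifferentiableAt 𝓘(ℝ, ℝ) 𝓘(ℝ, E) (fun s => g * f s) x :=
  (mdifferentiable_mul_left g (f x)).comp x hf

/-- `(Ad f)' = Ad f ∘ ad (f⁻¹ f')`. -/
theorem hasDerivAt_AdE {f : ℝ → G} {x : ℝ} (hf : MDifferentiableAt 𝓘(ℝ, ℝ) 𝓘(ℝ, E) f x) :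
    HasDerivAt (fun s => AdE E (f s)) ((AdE E (f x)).comp (adE E G (logDeriv E f x))) x := by
  have h := hasDerivAt_comp_of_eq_one (mdifferentiableAt_AdE (E := E) (1 : G))
    (mdifferentiableAt_const_mul hf (f x)⁻¹) (inv_mul_cancel _)
  have h2 := (hasDerivAt_const x (AdE E (f x))).clm_comp h
  have h3 : (fun s => AdE E (f s)) = fun s => (AdE E (f x)).comp (AdE E ((f x)⁻¹ * f s)) := by
    ext1 s
    rw [← AdE_mul, mul_inv_cancel_left]
  rw [h3]
  convert h2 using 1
  rw [inv_mul_cancel]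
  simp
  rfl

theorem hasDerivAt_AdE_apply {f : ℝ → G} {F : ℝ → E} {x : ℝ} {F' : E}
    (hf : MDifferentiableAt 𝓘(ℝ, ℝ) 𝓘(ℝ, E) f x) (hF : HasDerivAt F F' x) :
    HasDerivAt (fun s => AdE E (f s) (F s))
      (AdE E (f x) (adE E G (logDeriv E f x) (F x) + F')) x := by
  simpa using (hasDerivAt_AdE hf).clm_apply hF

theorem AdE_inv_AdE (g : G) (v : E) : AdE E g⁻¹ (AdE E g v) = v := by
  rw [← ContinuousLinearMap.comp_apply, ← AdE_mul, inv_mul_cancel, AdE_one]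
  rfl

theorem AdE_AdE_inv (g : G) (v : E) : AdE E g (AdE E g⁻¹ v) = v := by
  rw [← ContinuousLinearMap.comp_apply, ← AdE_mul, mul_inv_cancel, AdE_one]
  rfl

/-- The adjoint action preserves the Lie bracket. -/
theorem AdE_adE (g : G) (v w : E) :
    AdE E g (adE E G v w) = adE E G (AdE E g v) (AdE E g w) := by
  have h1 : g * 1 * g⁻¹ = 1 := by simp
  have hd : MDifferentiableAt 𝓘(ℝ, E) 𝓘(ℝ, E →L[ℝ] E) (AdE E : G → E →L[ℝ] E) (g * 1 * g⁻¹) :=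
    mdifferentiableAt_AdE _
  have hl := hd.hasMFDerivAt.comp (1 : G) (mdifferentiable_conj E g 1).hasMFDerivAt
  -- `T` is conjugation of operators by `Ad g`. Both sides of `Ad(g z g⁻¹) = T (Ad z)` are
  -- differentiated at `z = 1`.
  let T : (E →L[ℝ] E) →L[ℝ] (E →L[ℝ] E) :=
    (ContinuousLinearMap.compL ℝ E E E (AdE E g)).comp
      ((ContinuousLinearMap.compL ℝ E E E).flip (AdE E g⁻¹))
  have hr := T.hasMFDerivAt.comp (1 : G) (mdifferentiableAt_AdE (E := E) (1 : G)).hasMFDerivAt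
  have he : (T ∘ (AdE E : G → E →L[ℝ] E)) = (AdE E ∘ fun z : G => g * z * g⁻¹) := by
    funext z
    simp [T, AdE_mul, ContinuousLinearMap.comp_assoc]
  rw [he] at hr
  have hu := DFunLike.congr_fun (hasMFDerivAt_unique hl hr) v
  have hu' : adE E G (AdE E g v) = T (adE E G v) := by
    refine Eq.trans ?_ hu
    change mfderiv 𝓘(ℝ, E) 𝓘(ℝ, E →L[ℝ] E) (AdE E : G → E →L[ℝ] E) 1 _ =
      mfderiv 𝓘(ℝ, E) 𝓘(ℝ, E →L[ℝ] E) (AdE E : G → E →L[ℝ] E) (g * 1 * g⁻¹) _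
    rw [h1]
    rfl
  rw [hu']
  simp [T, AdE_inv_AdE]

variable (E G) in
/-- Elements acting trivially in the adjoint representation vanish. -/
def TrivialCenter : Prop := ∀ a : E, adE E G a = 0 → a = 0

theorem mdifferentiableAt_mul_curve {f k : ℝ → G} {x : ℝ}
    (hf : MDifferentiableAt 𝓘(ℝ, ℝ) 𝓘(ℝ, E) f x) (hk : MDifferentiableAt 𝓘(ℝ, ℝ) 𝓘(ℝ, E) k x) :
    MDifferentiableAt 𝓘(ℝ, ℝ) 𝓘(ℝ, E) (fun s => f s * k s) x :=
  MDifferentiableAt.comp (I' := 𝓘(ℝ, E).prod 𝓘(ℝ, E)) (f := fun s => (f s, k s)) x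
    ((contMDiff_mul 𝓘(ℝ, E) ∞).mdifferentiable (by simp) _) (hf.prodMk hk)

theorem mdifferentiableAt_inv_curve {f : ℝ → G} {x : ℝ}
    (hf : MDifferentiableAt 𝓘(ℝ, ℝ) 𝓘(ℝ, E) f x) :
    MDifferentiableAt 𝓘(ℝ, ℝ) 𝓘(ℝ, E) (fun s => (f s)⁻¹) x :=
  ((contMDiff_inv 𝓘(ℝ, E) ∞).mdifferentiable (by simp) _).comp x hf

/-- Differentiating `Ad(f k) = Ad f ∘ Ad k` in two ways gives the identity after applying `ad`,
which is injective. -/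
theorem logDeriv_mul (hc : TrivialCenter E G) {f k : ℝ → G} {x : ℝ}
    (hf : MDifferentiableAt 𝓘(ℝ, ℝ) 𝓘(ℝ, E) f x) (hk : MDifferentiableAt 𝓘(ℝ, ℝ) 𝓘(ℝ, E) k x) :
    logDeriv E (fun s => f s * k s) x = AdE E (k x)⁻¹ (logDeriv E f x) + logDeriv E k x := by
  have h1 := hasDerivAt_AdE (mdifferentiableAt_mul_curve hf hk)
  have h2 := (hasDerivAt_AdE hf).clm_comp (hasDerivAt_AdE hk)
  simp only [← AdE_mul] at h2
  have h3 := h1.unique h2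
  rw [← sub_eq_zero]
  refine hc _ (ContinuousLinearMap.ext fun w => ?_)
  have h4 := congrArg (AdE E (f x * k x)⁻¹) (DFunLike.congr_fun h3 w)
  simp only [ContinuousLinearMap.comp_apply, add_apply, map_add, AdE_mul,
    mul_inv_rev, AdE_inv_AdE] at h4
  rw [AdE_adE, AdE_inv_AdE] at h4
  simp [h4]

theorem logDeriv_inv (hc : TrivialCenter E G) {f : ℝ → G} {x : ℝ}
    (hf : MDifferentiableAt 𝓘(ℝ, ℝ) 𝓘(ℝ, E) f x) :
    logDeriv E (fun s => (f s)⁻¹) x = -AdE E (f x) (logDeriv E f x) := by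
  have h := logDeriv_mul hc hf (mdifferentiableAt_inv_curve hf)
  simp only [mul_inv_cancel, inv_inv] at h
  have h0 : logDeriv E (fun _ : ℝ => (1 : G)) x = 0 := by
    simp only [logDeriv]
    exact DFunLike.congr_fun mfderiv_const (1 : ℝ)
  rw [h0] at h
  exact (neg_eq_of_add_eq_zero_right h.symm).symm

end

section

universe u v w

/-! ### Superposition operators on spaces of continuous functions -/

section Superposition

variable (K : Type u) [TopologicalSpace K] [CompactSpace K]

variable {K} in
/-- Pointwise application of a continuous family of linear maps to a continuous function. -/
def pointwiseApplyFun {X Y : Type*} [NormedAddCommGroup X] [NormedSpace ℝ X]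
    [NormedAddCommGroup Y] [NormedSpace ℝ Y] (A : C(K, X →L[ℝ] Y)) (u : C(K, X)) : C(K, Y) :=
  ⟨fun s => A s (u s), A.continuous.clm_apply u.continuous⟩

theorem norm_pointwiseApplyFun_le (X Y : Type*) [NormedAddCommGroup X] [NormedSpace ℝ X]
    [NormedAddCommGroup Y] [NormedSpace ℝ Y] (A : C(K, X →L[ℝ] Y)) (u : C(K, X)) :
    ‖pointwiseApplyFun A u‖ ≤ 1 * ‖A‖ * ‖u‖ := by
  rw [one_mul]
  refine (ContinuousMap.norm_le _ (by positivity)).2 fun s => ?_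
  exact (A s).le_of_opNorm_le_of_le (A.norm_coe_le_norm s) (u.norm_coe_le_norm s)

/-- Pointwise application as a continuous bilinear map. -/
def pointwiseApply (X Y : Type*) [NormedAddCommGroup X] [NormedSpace ℝ X] [NormedAddCommGroup Y]
    [NormedSpace ℝ Y] : C(K, X →L[ℝ] Y) →L[ℝ] C(K, X) →L[ℝ] C(K, Y) :=
  LinearMap.mkContinuous₂ (E := C(K, X →L[ℝ] Y)) (F := C(K, X)) (G := C(K, Y))
    (LinearMap.mk₂ ℝ pointwiseApplyFun
      (fun A B u => by ext s; simp [pointwiseApplyFun])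
      (fun c A u => by ext s; simp [pointwiseApplyFun])
      (fun A u v => by ext s; simp [pointwiseApplyFun])
      (fun c A u => by ext s; simp [pointwiseApplyFun])) 1 (norm_pointwiseApplyFun_le K X Y)

variable {K}

@[simp]
theorem pointwiseApply_apply {X Y : Type*} [NormedAddCommGroup X] [NormedSpace ℝ X]
    [NormedAddCommGroup Y] [NormedSpace ℝ Y] (A : C(K, X →L[ℝ] Y)) (u : C(K, X)) (s : K) :
    pointwiseApply K X Y A u s = A s (u s) := rfl

/-- `v ↦ f' ∘ v` is continuous for the sup norm, so the mean value estimate for `f` holds uniformly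
in `s`. -/
theorem hasFDerivAt_superposition {X Y : Type*} [NormedAddCommGroup X] [NormedSpace ℝ X]
    [NormedAddCommGroup Y] [NormedSpace ℝ Y] (f : C(X, Y)) (f' : C(X, X →L[ℝ] Y))
    (hf : ∀ x, HasFDerivAt f (f' x) x) (u : C(K, X)) :
    HasFDerivAt (fun v : C(K, X) => f.comp v) (pointwiseApply K X Y (f'.comp u)) u := by
  rw [hasFDerivAt_iff_isLittleO, Asymptotics.isLittleO_iff]
  intro ε hε
  have hc : ContinuousAt (fun v : C(K, X) => f'.comp v) u :=
    (ContinuousMap.continuous_postcomp f').continuousAt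
  obtain ⟨δ, hδ, hball⟩ :=
    (Metric.continuousAt_iff (α := C(K, X)) (β := C(K, X →L[ℝ] Y))).1 hc ε hε
  filter_upwards [Metric.ball_mem_nhds u hδ] with v hv
  refine (ContinuousMap.norm_le _ (by positivity)).2 fun s => ?_
  have hs : ‖v s - u s‖ ≤ ‖v - u‖ := (v - u).norm_coe_le_norm s
  have hvs : v s ∈ Metric.ball (u s) δ := by
    rw [mem_ball_iff_norm] at hv ⊢
    exact hs.trans_lt hv
  have hbound : ∀ y ∈ Metric.ball (u s) δ, ‖f' y - f' (u s)‖ ≤ ε := by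
    intro y hy
    -- Perturbing `u` by the constant `y - u s` extracts the pointwise bound at `y` from continuity
    -- in the sup norm.
    have hw : dist (u + ContinuousMap.const K (y - u s)) u < δ := by
      rw [dist_eq_norm, add_sub_cancel_left]
      refine (ContinuousMap.norm_lt_iff _ hδ).2 fun _ => ?_
      rwa [mem_ball_iff_norm] at hy
    have h1 := (ContinuousMap.dist_apply_le_dist s).trans (hball hw).le
    simpa only [ContinuousMap.comp_apply, ContinuousMap.add_apply,
      ContinuousMap.const_apply, add_sub_cancel, dist_eq_norm] using h1
  have hmv := (convex_ball (u s) δ).norm_image_sub_le_of_norm_hasFDerivWithin_le'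
    (fun y _ => (hf y).hasFDerivWithinAt) hbound (Metric.mem_ball_self hδ) hvs
  calc _ = ‖f (v s) - f (u s) - f' (u s) (v s - u s)‖ := by simp
    _ ≤ ε * ‖v s - u s‖ := hmv
    _ ≤ ε * ‖v - u‖ := by gcongr

/-- Superposition operators of smooth functions are smooth. -/
theorem contDiff_superposition {X : Type v} [NormedAddCommGroup X] [NormedSpace ℝ X] (n : ℕ) :
    ∀ {Y : Type max v w} [NormedAddCommGroup Y] [NormedSpace ℝ Y] (f : C(X, Y)), ContDiff ℝ n f →
      ContDiff ℝ n (fun v : C(K, X) => f.comp v) := by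
  induction n with
  | zero =>
    intro Y _ _ f hf
    exact contDiff_zero.2 (ContinuousMap.continuous_postcomp f)
  | succ n ih =>
    intro Y _ _ f hf
    obtain ⟨f', hf', hd⟩ := contDiff_succ_iff_hasFDerivAt.1 hf
    let F' : C(X, X →L[ℝ] Y) := ⟨f', hf'.continuous⟩
    refine contDiff_succ_iff_hasFDerivAt.2
      ⟨fun u => pointwiseApply K X Y (F'.comp u), ?_, hasFDerivAt_superposition f F' hd⟩
    -- The derivative is the superposition operator of `f'` followed by a bounded linear map. The
    -- target has become `X →L[ℝ] Y`, which is why `Y` ranges over `Type max v w`.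
    exact (pointwiseApply K X Y).contDiff.comp (ih F' hf')

end Superposition

end

section

open scoped unitInterval

/-! ### Smooth dependence of solutions on parameters -/

section LocalSolution

theorem continuous_comp_projIcc {E : Type*} [NormedAddCommGroup E] (u : C(I, E)) :
    Continuous fun τ : ℝ => u (Set.projIcc 0 1 zero_le_one τ) :=
  u.continuous.comp continuous_projIcc

variable {E : Type*} [NormedAddCommGroup E] [NormedSpace ℝ E]

/-- The primitive of a continuous function on the unit interval. -/
def primitiveFun (u : C(I, E)) : C(I, E) where
  toFun s := ∫ τ in (0 : ℝ)..s, u (Set.projIcc 0 1 zero_le_one τ)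
  continuous_toFun := (intervalIntegral.continuous_primitive
    (fun a b => (continuous_comp_projIcc u).intervalIntegrable a b) 0).comp continuous_subtype_val

variable (E) in
/-- The primitive as a continuous linear operator. -/
def primitive : C(I, E) →L[ℝ] C(I, E) :=
  LinearMap.mkContinuous (E := C(I, E)) (F := C(I, E))
    { toFun := primitiveFun
      map_add' := fun u v => by
        ext s
        exact intervalIntegral.integral_add ((continuous_comp_projIcc u).intervalIntegrable _ _)
          ((continuous_comp_projIcc v).intervalIntegrable _ _)
      map_smul' := fun c u => by
        ext s
        exact intervalIntegral.integral_smul c _ } 1 fun u => by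
    rw [one_mul]
    refine (ContinuousMap.norm_le _ (by positivity)).2 fun s => ?_
    have h := intervalIntegral.norm_integral_le_of_norm_le_const (a := 0) (b := (s : ℝ))
      (f := fun τ : ℝ => u (Set.projIcc 0 1 zero_le_one τ)) fun τ _ => u.norm_coe_le_norm _
    refine h.trans (mul_le_of_le_one_right (norm_nonneg _) ?_)
    rw [sub_zero, abs_of_nonneg s.2.1]
    exact s.2.2

/-- The function whose zeros are the solutions of a differential equation with parameters, scaled
to the unit interval. -/
def solutionDefect (f : C((ℝ × ℝ) × ℝ × E, E)) (o : E) (v : (ℝ × ℝ) × C(I, E)) : C(I, E) :=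
  v.2 - ContinuousMap.const I o
    - primitive E (f.comp ((ContinuousMap.const I v.1).prodMk
        ((ContinuousMap.mk (Subtype.val : I → ℝ)).prodMk v.2)))

theorem solutionDefect_eq_zero_iff (f : C((ℝ × ℝ) × ℝ × E, E)) (o : E) (p : ℝ × ℝ) (u : C(I, E)) :
    solutionDefect f o (p, u) = 0 ↔ ∀ s : I, u s = o + ∫ τ in (0 : ℝ)..s,
      f (p, (Set.projIcc 0 1 zero_le_one τ : I), u (Set.projIcc 0 1 zero_le_one τ)) := by
  rw [ContinuousMap.ext_iff]
  refine forall_congr' fun s => ?_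
  simp only [solutionDefect, ContinuousMap.sub_apply, ContinuousMap.zero_apply, sub_sub,
    sub_eq_zero]
  rfl

theorem contDiff_solutionDefect (f : C((ℝ × ℝ) × ℝ × E, E)) (hf : ContDiff ℝ ∞ f) (o : E) (n : ℕ) :
    ContDiff ℝ n (solutionDefect f o) := by
  let L₁ : (ℝ × ℝ) →L[ℝ] C(I, (ℝ × ℝ) × ℝ × E) :=
    (ContinuousLinearMap.const ℝ I).comp (ContinuousLinearMap.inl ℝ (ℝ × ℝ) (ℝ × E))
  let L₂ : C(I, E) →L[ℝ] C(I, (ℝ × ℝ) × ℝ × E) :=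
    ContinuousLinearMap.compLeftContinuous ℝ I ((ContinuousLinearMap.inr ℝ (ℝ × ℝ) (ℝ × E)).comp
      (ContinuousLinearMap.inr ℝ ℝ E))
  let c₀ : C(I, (ℝ × ℝ) × ℝ × E) :=
    (ContinuousMap.const I 0).prodMk ((ContinuousMap.mk (Subtype.val : I → ℝ)).prodMk
      (ContinuousMap.const I 0))
  -- The argument `(p, s, u s)` of `f` depends on `(p, u)` in an affine way, so only the
  -- superposition operator is nonlinear.
  have hJ : ∀ v : (ℝ × ℝ) × C(I, E), (ContinuousMap.const I v.1).prodMk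
      ((ContinuousMap.mk (Subtype.val : I → ℝ)).prodMk v.2) = L₁ v.1 + L₂ v.2 + c₀ := by
    intro v
    ext s <;> simp [L₁, L₂, c₀]
  have h1 : ContDiff ℝ n fun v : (ℝ × ℝ) × C(I, E) => L₁ v.1 + L₂ v.2 + c₀ :=
    ((L₁.contDiff.comp contDiff_fst).add (L₂.contDiff.comp contDiff_snd)).add contDiff_const
  have h2 := (contDiff_superposition (K := I) n f (contDiff_infty.1 hf n)).comp h1
  have h3 : solutionDefect f o = fun v => v.2 - ContinuousMap.const I o
      - primitive E (f.comp (L₁ v.1 + L₂ v.2 + c₀)) := by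
    funext v
    rw [solutionDefect, hJ]
  rw [h3]
  exact (contDiff_snd.sub contDiff_const).sub ((primitive E).contDiff.comp h2)

end LocalSolution

end

/-! ### Local solutions of ordinary differential equations by the implicit function theorem -/

section

section LocalSolution

open scoped unitInterval

variable {E : Type*} [NormedAddCommGroup E] [NormedSpace ℝ E]

/-- The right hand side of a differential equation, scaled to the unit interval. -/
def scaledRhs (F : E → E →L[ℝ] E) (B : ℝ × ℝ → E) (b : ℝ) (z : (ℝ × ℝ) × ℝ × E) : E :=
  F z.2.2 ((z.1.1 - b) • B (b + z.2.1 * (z.1.1 - b), z.1.2))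

theorem contDiff_scaledRhs {F : E → E →L[ℝ] E} (hF : ContDiff ℝ ∞ F) {B : ℝ × ℝ → E}
    (hB : ContDiff ℝ ∞ B) (b : ℝ) : ContDiff ℝ ∞ (scaledRhs F B b) := by
  unfold scaledRhs
  have h1 : ContDiff ℝ ∞ fun z : (ℝ × ℝ) × ℝ × E => F z.2.2 :=
    hF.comp (contDiff_snd.comp contDiff_snd)
  have h2 : ContDiff ℝ ∞ fun z : (ℝ × ℝ) × ℝ × E => (b + z.2.1 * (z.1.1 - b), z.1.2) := by
    fun_prop
  have h3 : ContDiff ℝ ∞ fun z : (ℝ × ℝ) × ℝ × E => z.1.1 - b := by fun_prop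
  exact h1.clm_apply (h3.smul (hB.comp h2))

/-- Rescaling a solution of the scaled integral equation. -/
theorem solution_rescale {F : E → E →L[ℝ] E} (hF : ContDiff ℝ ∞ F) {B : ℝ × ℝ → E}
    (hB : ContDiff ℝ ∞ B) (b : ℝ) (o : E) {p : ℝ × ℝ} {u : C(I, E)}
    (h : solutionDefect ⟨scaledRhs F B b, (contDiff_scaledRhs hF hB b).continuous⟩ o (p, u) = 0)
    (s : I) :
    solutionDefect ⟨scaledRhs F B b, (contDiff_scaledRhs hF hB b).continuous⟩ o
      ((b + s * (p.1 - b), p.2), u.comp ⟨fun r : I => s * r, continuous_const.mul continuous_id⟩)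
        = 0 := by
  rw [solutionDefect_eq_zero_iff] at h ⊢
  intro r
  have h1 := h (s * r)
  simp only [ContinuousMap.comp_apply, ContinuousMap.coe_mk] at h1 ⊢
  rw [h1, add_right_inj]
  -- Restricting `u` to `[0, s]` and stretching back to `[0, 1]` is the substitution `τ ↦ s τ`; the
  -- factor `s` is absorbed by the shorter interval from `b` to `b + s (x - b)`.
  have h2 := intervalIntegral.smul_integral_comp_mul_left (a := 0) (b := (r : ℝ))
    (fun τ : ℝ => scaledRhs F B b (p, (Set.projIcc 0 1 zero_le_one τ : I),
      u (Set.projIcc 0 1 zero_le_one τ))) (s : ℝ)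
  rw [mul_zero] at h2
  change ∫ τ in (0 : ℝ)..(s * r : ℝ), scaledRhs F B b (p, (Set.projIcc 0 1 zero_le_one τ : I),
      u (Set.projIcc 0 1 zero_le_one τ)) = _
  rw [← h2, ← intervalIntegral.integral_smul]
  refine intervalIntegral.integral_congr fun τ hτ => ?_
  rw [Set.uIcc_of_le r.2.1] at hτ
  have hτ1 : τ ∈ Set.Icc (0 : ℝ) 1 := ⟨hτ.1, hτ.2.trans r.2.2⟩
  have hτ2 : (s : ℝ) * τ ∈ Set.Icc (0 : ℝ) 1 :=
    ⟨mul_nonneg s.2.1 hτ1.1, mul_le_one₀ s.2.2 hτ1.1 hτ1.2⟩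
  have e1 : Set.projIcc (0 : ℝ) 1 zero_le_one ((s : ℝ) * τ) =
      s * Set.projIcc (0 : ℝ) 1 zero_le_one τ := by
    rw [Set.projIcc_of_mem _ hτ1, Set.projIcc_of_mem _ hτ2]
    rfl
  have e2 : ((Set.projIcc (0 : ℝ) 1 zero_le_one τ : I) : ℝ) = τ := by
    rw [Set.projIcc_of_mem _ hτ1]
  rw [e1]
  simp only [scaledRhs, Set.Icc.coe_mul, e2]
  rw [← map_smul, smul_smul]
  congr 2
  · ring
  · congr 2
    ring

/-- Substituting `y = b + s (x - b)` moves the equation `φ_x = F(φ) B` to the fixed interval `s ∈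
[0, 1]`, with `(x, t)` as parameters; `φ(x, t)` is the value of the solution at `s = 1`. The
implicit function theorem on `C(I, E)` gives smooth dependence, for one finite order `n` at a time.
-/
theorem exists_local_solution [CompleteSpace E] {F : E → E →L[ℝ] E} (hF : ContDiff ℝ ∞ F)
    {B : ℝ × ℝ → E} (hB : ContDiff ℝ ∞ B) (o : E) (b t₀ : ℝ) {n : ℕ} (hn : n ≠ 0) :
    ∃ φ : ℝ × ℝ → E, φ (b, t₀) = o ∧ ∀ᶠ p in 𝓝 (b, t₀), ContDiffAt ℝ n φ p ∧
      HasDerivAt (fun x => φ (x, p.2)) (F (φ p) (B p)) p.1 := by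
  set f : C((ℝ × ℝ) × ℝ × E, E) := ⟨scaledRhs F B b, (contDiff_scaledRhs hF hB b).continuous⟩
    with hf
  set u₀ : C(I, E) := ContinuousMap.const I o with hu₀
  set v₀ : (ℝ × ℝ) × C(I, E) := ((b, t₀), u₀) with hv₀
  have hΨ : ContDiff ℝ n (solutionDefect f o) :=
    contDiff_solutionDefect f (contDiff_scaledRhs hF hB b) o n
  have hn' : (n : WithTop ℕ∞) ≠ 0 := by exact_mod_cast hn
  -- At `x = b` the factor `x - b` kills the right hand side, so the partial derivative of the
  -- defect in `u` is the identity.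
  have hΨb : ∀ u : C(I, E), solutionDefect f o ((b, t₀), u) = u - u₀ := by
    intro u
    have : ∀ s : I, f ((b, t₀), (s : ℝ), u s) = 0 := fun s => by simp [hf, scaledRhs]
    have h0 : f.comp ((ContinuousMap.const I (b, t₀)).prodMk
        ((ContinuousMap.mk (Subtype.val : I → ℝ)).prodMk u)) = 0 := ContinuousMap.ext this
    simp only [solutionDefect, h0, map_zero, sub_zero, hu₀]
  have hΨ0 : solutionDefect f o v₀ = 0 := by rw [hv₀, hΨb, sub_self]
  have hinv : (fderiv ℝ (solutionDefect f o) v₀ ∘L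
      ContinuousLinearMap.inr ℝ (ℝ × ℝ) C(I, E)).IsInvertible := by
    have h1 : HasFDerivAt (solutionDefect f o) (fderiv ℝ (solutionDefect f o) v₀)
        (((b, t₀), u₀) : (ℝ × ℝ) × C(I, E)) :=
      (hΨ.contDiffAt.differentiableAt hn').hasFDerivAt
    have h2 := h1.comp u₀ (hasFDerivAt_prodMk_right ((b, t₀) : ℝ × ℝ) u₀)
    have h3 : (solutionDefect f o ∘ fun u : C(I, E) => ((b, t₀), u)) = fun u => u - u₀ :=
      funext hΨb
    rw [h3] at h2
    rw [h2.unique ((hasFDerivAt_id u₀).sub_const u₀)]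
    exact ⟨ContinuousLinearEquiv.refl ℝ _, rfl⟩
  have hcd : ContDiffAt ℝ n (solutionDefect f o) v₀ := hΨ.contDiffAt
  set u := hcd.implicitFunction hn' hinv with hu
  have hu_self : u (b, t₀) = u₀ := hcd.implicitFunction_apply_self hn' hinv
  have hu_smooth : ContDiffAt ℝ n u (b, t₀) := hcd.contDiffAt_implicitFunction hn' hinv
  have hu_sol : ∀ᶠ p in 𝓝 (b, t₀), solutionDefect f o (p, u p) = 0 := by
    filter_upwards [hcd.eventually_apply_implicitFunction hn' hinv] with p hp
    rw [← hΨ0]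
    exact hp
  have hu_uniq : ∀ᶠ v in 𝓝 v₀, solutionDefect f o v = 0 → u v.1 = v.2 := by
    filter_upwards [hcd.eventually_apply_eq_iff_implicitFunction hn' hinv] with v hv h0
    exact hv.1 (h0.trans hΨ0.symm)
  have hu_cont : ∀ᶠ p in 𝓝 (b, t₀), ContDiffAt ℝ n u p := hu_smooth.eventually (by simp)
  obtain ⟨r₁, hr₁, h1⟩ := Metric.eventually_nhds_iff.1 hu_uniq
  have hu_near : ∀ᶠ p in 𝓝 (b, t₀), dist (u p) u₀ < r₁ := by
    have h := hu_smooth.continuousAt.tendsto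
    rw [hu_self] at h
    exact h (Metric.ball_mem_nhds _ hr₁)
  obtain ⟨r₂, hr₂, h2⟩ := Metric.eventually_nhds_iff.1 (hu_sol.and (hu_cont.and hu_near))
  -- The rescaled `u p` solves the equation with endpoint `b + s (x - b)`; local uniqueness
  -- identifies it with the implicit solution there. So interior values of `u p` are endpoint values
  -- for other parameters.
  have hscale : ∀ p : ℝ × ℝ, dist p (b, t₀) < min r₁ r₂ → ∀ s : I,
      u (b + s * (p.1 - b), p.2) 1 = u p s := by
    intro p hp s
    obtain ⟨hsol, -, hnear⟩ := h2 (hp.trans_le (min_le_right _ _))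
    have hd : dist ((b + (s : ℝ) * (p.1 - b), p.2) : ℝ × ℝ) (b, t₀) ≤ dist p (b, t₀) := by
      rw [Prod.dist_eq, Prod.dist_eq]
      refine max_le_max ?_ le_rfl
      rw [Real.dist_eq, Real.dist_eq, add_sub_cancel_left, abs_mul, abs_of_nonneg s.2.1]
      exact mul_le_of_le_one_left (abs_nonneg _) s.2.2
    have h3 := h1 (y := ((b + (s : ℝ) * (p.1 - b), p.2),
      (u p).comp ⟨fun r : I => s * r, continuous_const.mul continuous_id⟩)) (by
        rw [hv₀, Prod.dist_eq]
        refine max_lt (hd.trans_lt (hp.trans_le (min_le_left _ _))) ?_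
        refine lt_of_le_of_lt ?_ hnear
        refine (ContinuousMap.dist_le dist_nonneg).2 fun r => ?_
        exact ContinuousMap.dist_apply_le_dist (f := u p) (g := u₀) (s * r))
      (solution_rescale hF hB b o hsol s)
    rw [h3]
    exact congrArg (u p) (mul_one s)
  -- By `hscale`, the integral equation in `s` becomes one in `x` for the endpoint values alone.
  have hint : ∀ p : ℝ × ℝ, dist p (b, t₀) < min r₁ r₂ →
      u p 1 = o + ∫ y in b..p.1, F (u (y, p.2) 1) (B (y, p.2)) := by
    intro p hp
    rw [(solutionDefect_eq_zero_iff f o p (u p)).1 (h2 (hp.trans_le (min_le_right _ _))).1 1,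
      add_right_inj]
    have h3 := intervalIntegral.smul_integral_comp_add_mul (a := 0) (b := 1)
      (fun y => F (u (y, p.2) 1) (B (y, p.2))) (p.1 - b) b
    rw [mul_zero, mul_one, add_zero, add_sub_cancel] at h3
    rw [← h3, ← intervalIntegral.integral_smul]
    refine intervalIntegral.integral_congr fun τ hτ => ?_
    rw [Set.Icc.coe_one, Set.uIcc_of_le zero_le_one] at hτ
    have e1 := hscale p hp (Set.projIcc 0 1 zero_le_one τ)
    have e2 : ((Set.projIcc (0 : ℝ) 1 zero_le_one τ : I) : ℝ) = τ := by
      rw [Set.projIcc_of_mem _ hτ]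
    rw [e2] at e1
    change scaledRhs F B b (p, _, _) = _
    simp only [scaledRhs, e2, ← e1, mul_comm _ τ, map_smul]
  refine ⟨fun p => u p 1, congrArg (fun v : C(I, E) => v 1) hu_self, ?_⟩
  have hball : Metric.ball ((b, t₀) : ℝ × ℝ) (min r₁ r₂) ∈ 𝓝 (b, t₀) :=
    Metric.ball_mem_nhds _ (lt_min hr₁ hr₂)
  have hsm : ∀ p : ℝ × ℝ, dist p (b, t₀) < min r₁ r₂ → ContDiffAt ℝ n (fun p => u p 1) p :=
    fun p hp => (ContinuousMap.evalCLM ℝ (1 : I) : C(I, E) →L[ℝ] E).contDiff.contDiffAt.comp p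
      (h2 (hp.trans_le (min_le_right _ _))).2.1
  filter_upwards [hball] with p hp
  refine ⟨hsm p hp, ?_⟩
  obtain ⟨x, t⟩ := p
  rw [Metric.mem_ball, Prod.dist_eq, max_lt_iff] at hp
  have hcont : ContinuousOn (fun y => F (u (y, t) 1) (B (y, t)))
      (Metric.ball b (min r₁ r₂)) := by
    intro y hy
    refine ContinuousAt.continuousWithinAt ?_
    have h3 : ContinuousAt (fun y : ℝ => u (y, t) 1) y :=
      ContinuousAt.comp (f := fun y : ℝ => ((y, t) : ℝ × ℝ))
        (hsm (y, t) (by rw [Prod.dist_eq]; exact max_lt hy hp.2)).continuousAt (by fun_prop)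
    exact (hF.continuous.continuousAt.comp h3).clm_apply
      (hB.continuous.comp (by fun_prop : Continuous fun y : ℝ => (y, t))).continuousAt
  have hx : Metric.ball b (min r₁ r₂) ∈ 𝓝 x := Metric.isOpen_ball.mem_nhds hp.1
  have h4 := intervalIntegral.integral_hasDerivAt_right
    ((hcont.mono ((convex_ball b _).ordConnected.uIcc_subset
      (Metric.mem_ball_self (lt_min hr₁ hr₂)) hp.1)).intervalIntegrable)
    (hcont.stronglyMeasurableAtFilter Metric.isOpen_ball x hp.1) (hcont.continuousAt hx)
  refine (h4.const_add o).congr_of_eventuallyEq ?_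
  filter_upwards [hx] with y hy
  exact hint (y, t) (by rw [Prod.dist_eq]; exact max_lt hy hp.2)

end LocalSolution

end

section

/-! ### The equation `θ⁻¹ θ' = C` on the group, locally -/

variable {E : Type*} [NormedAddCommGroup E] [NormedSpace ℝ E]
  {G : Type*} [TopologicalSpace G] [ChartedSpace E G] [Group G] [LieGroup 𝓘(ℝ, E) ∞ G]

variable (E G) in
/-- A globally smooth family of operators that agrees with `leftD` near the identity. -/
theorem exists_contDiff_eq_leftD [FiniteDimensional ℝ E] : ∃ F : E → E →L[ℝ] E, ContDiff ℝ ∞ F ∧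
    ∀ᶠ u in 𝓝 (chartOne E G), F u = leftD E G u := by
  obtain ⟨r, hr, hb⟩ := Metric.nhds_basis_closedBall.mem_iff.1
    (target_mem_nhds_chartOne (E := E) (G := G))
  let f : ContDiffBump (chartOne E G) := ⟨r / 2, r, half_pos hr, half_lt_self hr⟩
  refine ⟨fun u => f u • leftD E G u, contDiff_iff_contDiffAt.2 fun u => ?_, ?_⟩
  · by_cases hu : u ∈ Metric.closedBall (chartOne E G) r
    · exact f.contDiffAt.smul (contDiffAt_leftD_of_mem (hb hu))
    · refine contDiffAt_const (c := (0 : E →L[ℝ] E)) |>.congr_of_eventuallyEq ?_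
      filter_upwards [Metric.isClosed_closedBall.isOpen_compl.mem_nhds hu] with v hv
      have : f v = 0 := f.zero_of_le_dist (not_le.1 fun h => hv (Metric.mem_closedBall.2 h)).le
      rw [this, zero_smul]
  · filter_upwards [f.eventuallyEq_one] with u hu
    rw [hu, Pi.one_apply, one_smul]

variable (E G) in
-- An operator at distance less than `1` from the identity has no kernel, and `leftD` is continuous
-- with the identity as its value at the base point.
theorem eventually_leftD_injective :
    ∀ᶠ u in 𝓝 (chartOne E G), Function.Injective (leftD E G u) := by
  have h := (contDiffAt_leftD (E := E) (G := G)).continuousAt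
  rw [ContinuousAt, leftD_one] at h
  filter_upwards [h (Metric.ball_mem_nhds _ one_pos)] with u hu
  rw [injective_iff_map_eq_zero]
  intro v hv
  by_contra hne
  have h1 := (leftD E G u - ContinuousLinearMap.id ℝ E).le_opNorm v
  rw [sub_apply, hv, zero_sub, norm_neg, ContinuousLinearMap.id_apply, ← dist_eq_norm] at h1
  have h2 : dist (leftD E G u) (ContinuousLinearMap.id ℝ E) < 1 := hu
  nlinarith [norm_pos_iff.2 hne]

/-- Read in the chart, the velocity of a curve is `leftD` applied to its logarithmic derivative;
injectivity of `leftD` then recovers `w`. -/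
theorem logDeriv_chart_symm : ∀ᶠ v in 𝓝 (chartOne E G), ∀ (u : ℝ → E) (x : ℝ) (w : E), u x = v →
    HasDerivAt u (leftD E G v w) x →
    MDifferentiableAt 𝓘(ℝ, ℝ) 𝓘(ℝ, E) (fun s => (extChartAt 𝓘(ℝ, E) (1 : G)).symm (u s)) x ∧
    logDeriv E (fun s => (extChartAt 𝓘(ℝ, E) (1 : G)).symm (u s)) x = w := by
  have : IsManifold 𝓘(ℝ, E) 1 G := IsManifold.of_le (n := ∞) (by simp)
  filter_upwards [target_mem_nhds_chartOne (E := E) (G := G), eventually_leftD_injective E G,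
    eventually_leftD_eq (E := E) (G := G)] with v hv hinj heq u x w hu hd
  subst hu
  set c := extChartAt 𝓘(ℝ, E) (1 : G)
  have hsymm : MDifferentiableAt 𝓘(ℝ, E) 𝓘(ℝ, E) c.symm (u x) :=
    ((contMDiffOn_extChartAt_symm (1 : G)).contMDiffAt
      ((isOpen_extChartAt_target 1).mem_nhds hv)).mdifferentiableAt one_ne_zero
  have hm : MDifferentiableAt 𝓘(ℝ, ℝ) 𝓘(ℝ, E) (fun s => c.symm (u s)) x :=
    MDifferentiableAt.comp x hsymm hd.differentiableAt.mdifferentiableAt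
  refine ⟨hm, ?_⟩
  have hsrc : c.symm (u x) ∈ (chartAt E (1 : G)).source := by
    have := c.map_target hv
    rwa [extChartAt_source] at this
  have hΦ : MDifferentiableAt 𝓘(ℝ, E) 𝓘(ℝ, E) (fun g => c (c.symm (u x) * g)) 1 := by
    refine MDifferentiableAt.comp (1 : G) ?_ (mdifferentiable_mul_left _ _)
    rw [mul_one]
    exact mdifferentiableAt_extChartAt hsrc
  have h1 := hasDerivAt_comp_of_eq_one hΦ (mdifferentiableAt_const_mul hm (c.symm (u x))⁻¹)
    (inv_mul_cancel _)
  have h2 : (fun s => c (c.symm (u x) * ((c.symm (u x))⁻¹ * c.symm (u s)))) =ᶠ[𝓝 x] u := by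
    filter_upwards [hd.continuousAt.preimage_mem_nhds ((isOpen_extChartAt_target 1).mem_nhds hv)]
      with s hs
    rw [mul_inv_cancel_left]
    exact c.right_inv hs
  have h3 := (h1.congr_of_eventuallyEq h2.symm).unique hd
  refine hinj (Eq.trans ?_ h3)
  refine Eq.symm ((mfderiv_one_eq_fderiv hΦ _).trans ?_)
  exact DFunLike.congr_fun heq _

/-- Local solutions of `θ⁻¹ θ_x = C`, with arbitrary finite smoothness in `(x, t)`. -/
theorem exists_local_group_solution [FiniteDimensional ℝ E] {C : ℝ × ℝ → E}
    (hC : ContDiff ℝ ∞ C) (b t₀ : ℝ) {n : ℕ} (hn : n ≠ 0) :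
    ∃ φ : ℝ × ℝ → G, ∀ᶠ p in 𝓝 (b, t₀), ContMDiffAt 𝓘(ℝ, ℝ × ℝ) 𝓘(ℝ, E) n φ p ∧
      MDifferentiableAt 𝓘(ℝ, ℝ) 𝓘(ℝ, E) (fun x => φ (x, p.2)) p.1 ∧
      logDeriv E (fun x => φ (x, p.2)) p.1 = C p := by
  have : IsManifold 𝓘(ℝ, E) n G := IsManifold.of_le (n := ∞) (by exact_mod_cast le_top)
  obtain ⟨F, hF, hFl⟩ := exists_contDiff_eq_leftD E G
  have : CompleteSpace E := FiniteDimensional.complete ℝ E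
  obtain ⟨u, hu0, hu⟩ := exists_local_solution hF hC (chartOne E G) b t₀ hn
  have hcont : Filter.Tendsto u (𝓝 (b, t₀)) (𝓝 (chartOne E G)) := by
    have h := hu.self_of_nhds.1.continuousAt.tendsto
    rwa [hu0] at h
  refine ⟨fun p => (extChartAt 𝓘(ℝ, E) (1 : G)).symm (u p), ?_⟩
  filter_upwards [hu, hcont.eventually hFl, hcont.eventually logDeriv_chart_symm,
    hcont.eventually target_mem_nhds_chartOne] with p hp hpF hpl hpt
  rw [hpF] at hp
  refine ⟨?_, hpl (fun x => u (x, p.2)) p.1 (C p) rfl hp.2⟩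
  exact ContMDiffAt.comp p ((contMDiffOn_extChartAt_symm (1 : G)).contMDiffAt
    ((isOpen_extChartAt_target 1).mem_nhds hpt)) hp.1.contMDiffAt

end

section

/-! ### Global solutions of `θ⁻¹ θ' = C` -/

variable {E : Type*} [NormedAddCommGroup E] [NormedSpace ℝ E]
  {G : Type*} [TopologicalSpace G] [ChartedSpace E G] [Group G]

theorem logDeriv_congr {f k : ℝ → G} {x : ℝ} (h : f =ᶠ[𝓝 x] k) :
    logDeriv E f x = logDeriv E k x := by
  have h1 : (fun s : ℝ => (f x)⁻¹ * f s) =ᶠ[𝓝 x] fun s => (k x)⁻¹ * k s := by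
    filter_upwards [h] with s hs
    rw [hs, h.self_of_nhds]
  exact DFunLike.congr_fun h1.mfderiv_eq (1 : ℝ)

/-- The curve `f` is differentiable on `J` with logarithmic derivative `C`. -/
def HasLogDerivOn (f : ℝ → G) (C : ℝ → E) (J : Set ℝ) : Prop :=
  ∀ x ∈ J, MDifferentiableAt 𝓘(ℝ, ℝ) 𝓘(ℝ, E) f x ∧ logDeriv E f x = C x

theorem HasLogDerivOn.mono {f : ℝ → G} {C : ℝ → E} {J J' : Set ℝ} (hf : HasLogDerivOn f C J)
    (h : J' ⊆ J) : HasLogDerivOn f C J' := fun x hx => hf x (h hx)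

theorem HasLogDerivOn.congr {f k : ℝ → G} {C : ℝ → E} {J : Set ℝ} (hf : HasLogDerivOn f C J)
    (hJ : IsOpen J) (h : Set.EqOn k f J) : HasLogDerivOn k C J := by
  intro x hx
  have hx' : k =ᶠ[𝓝 x] f := h.eventuallyEq_of_mem (hJ.mem_nhds hx)
  exact ⟨hx'.mdifferentiableAt_iff.2 (hf x hx).1, (logDeriv_congr hx').trans (hf x hx).2⟩

variable [LieGroup 𝓘(ℝ, E) ∞ G]

theorem HasLogDerivOn.const_mul {f : ℝ → G} {C : ℝ → E} {J : Set ℝ} (hf : HasLogDerivOn f C J)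
    (g : G) : HasLogDerivOn (fun s => g * f s) C J := fun x hx =>
  ⟨mdifferentiableAt_const_mul (hf x hx).1 g, (logDeriv_const_mul f g x).trans (hf x hx).2⟩

theorem hasDerivAt_comp_of_logDeriv_eq_zero {W : Type*} [NormedAddCommGroup W] [NormedSpace ℝ W]
    {Φ : G → W} {f : ℝ → G} {x : ℝ} (hΦ : MDifferentiableAt 𝓘(ℝ, E) 𝓘(ℝ, W) Φ (f x))
    (hf : MDifferentiableAt 𝓘(ℝ, ℝ) 𝓘(ℝ, E) f x) (h : logDeriv E f x = 0) :
    HasDerivAt (fun s => Φ (f s)) 0 x := by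
  have hΦ' : MDifferentiableAt 𝓘(ℝ, E) 𝓘(ℝ, W) (fun g => Φ (f x * g)) 1 := by
    refine MDifferentiableAt.comp (1 : G) ?_ (mdifferentiable_mul_left (f x) 1)
    rwa [mul_one]
  have h1 := hasDerivAt_comp_of_eq_one hΦ' (mdifferentiableAt_const_mul hf (f x)⁻¹)
    (inv_mul_cancel _)
  have h2 : velocity E (fun s => (f x)⁻¹ * f s) x = 0 := h
  rw [h2, map_zero] at h1
  simpa only [mul_inv_cancel_left] using h1

/-- A curve with vanishing logarithmic derivative is constant. -/
theorem HasLogDerivOn.eq_of_zero {f : ℝ → G} {J : Set ℝ} (hJ : IsOpen J) (hJ' : IsPreconnected J)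
    (hf : HasLogDerivOn f (fun _ => (0 : E)) J) {x y : ℝ} (hx : x ∈ J) (hy : y ∈ J) :
    f x = f y := by
  have : IsManifold 𝓘(ℝ, E) 1 G := IsManifold.of_le (n := ∞) (by simp)
  refine hJ'.induction₂ (fun x y => f x = f y) (fun x hx => ?_) (fun x y z _ _ _ => Eq.trans)
    (fun x y _ _ => Eq.symm) hx hy
  refine nhdsWithin_le_nhds ?_
  have hs : (extChartAt 𝓘(ℝ, E) (f x)).source ∈ 𝓝 (f x) := extChartAt_source_mem_nhds (f x)
  have h1 : ∀ᶠ s in 𝓝 x, s ∈ J ∧ f s ∈ (extChartAt 𝓘(ℝ, E) (f x)).source :=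
    (hJ.eventually_mem hx).and ((hf x hx).1.continuousAt hs)
  obtain ⟨r, hr, hb⟩ := Metric.eventually_nhds_iff_ball.1 h1
  have hd : ∀ s ∈ Metric.ball x r,
      HasDerivAt (fun s => extChartAt 𝓘(ℝ, E) (f x) (f s)) 0 s := fun s hs' => by
    have h2 := (hb s hs').2
    rw [extChartAt_source] at h2
    exact hasDerivAt_comp_of_logDeriv_eq_zero (mdifferentiableAt_extChartAt h2)
      (hf s (hb s hs').1).1 (hf s (hb s hs').1).2
  filter_upwards [Metric.ball_mem_nhds x hr] with y hy
  have hx0 := Metric.mem_ball_self (x := x) hr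
  refine (extChartAt 𝓘(ℝ, E) (f x)).injOn (hb x hx0).2 (hb y hy).2 ?_
  exact Metric.isOpen_ball.is_const_of_deriv_eq_zero (convex_ball x r).isPreconnected
    (f := fun s => extChartAt 𝓘(ℝ, E) (f x) (f s))
    (fun s hs' => (hd s hs').differentiableAt.differentiableWithinAt)
    (fun s hs' => (hd s hs').deriv) hx0 hy

/-- A logarithmic derivative determines a curve up to left translation. -/
theorem HasLogDerivOn.mul_inv_eq (hc : TrivialCenter E G) {f k : ℝ → G} {C : ℝ → E} {J : Set ℝ}
    (hJ : IsOpen J) (hJ' : IsPreconnected J) (hf : HasLogDerivOn f C J) (hk : HasLogDerivOn k C J)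
    {x y : ℝ} (hx : x ∈ J) (hy : y ∈ J) : f x * (k x)⁻¹ = f y * (k y)⁻¹ := by
  refine HasLogDerivOn.eq_of_zero (E := E) (f := fun s => f s * (k s)⁻¹) hJ hJ' (fun s hs => ?_)
    hx hy
  have hi := mdifferentiableAt_inv_curve (hk s hs).1
  refine ⟨mdifferentiableAt_mul_curve (hf s hs).1 hi, ?_⟩
  rw [logDeriv_mul hc (hf s hs).1 hi, logDeriv_inv hc (hk s hs).1, (hf s hs).2, (hk s hs).2,
    inv_inv, add_neg_cancel]

theorem HasLogDerivOn.eqOn (hc : TrivialCenter E G) {f k : ℝ → G} {C : ℝ → E} {J : Set ℝ}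
    (hJ : IsOpen J) (hJ' : IsPreconnected J) (hf : HasLogDerivOn f C J) (hk : HasLogDerivOn k C J)
    {x : ℝ} (hx : x ∈ J) (h : f x = k x) : Set.EqOn f k J := by
  intro y hy
  have h1 := HasLogDerivOn.mul_inv_eq hc hJ hJ' hf hk hx hy
  rw [h, mul_inv_cancel] at h1
  exact (mul_inv_eq_one.1 h1.symm)

/-- Global existence of curves with a prescribed logarithmic derivative. -/
theorem exists_hasLogDerivOn_univ (hc : TrivialCenter E G) {C : ℝ → E}
    (hloc : ∀ b : ℝ, ∃ f : ℝ → G, ∃ J : Set ℝ, IsOpen J ∧ IsPreconnected J ∧ b ∈ J ∧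
      HasLogDerivOn f C J) :
    ∃ f : ℝ → G, f 0 = 1 ∧ HasLogDerivOn f C Set.univ := by
  have hint : ∀ {J J' : Set ℝ}, IsPreconnected J → IsPreconnected J' → IsPreconnected (J ∩ J') :=
    fun h h' => (h.ordConnected.inter h'.ordConnected).isPreconnected
  have key : ∀ x y : ℝ, ∃ f : ℝ → G, ∃ J : Set ℝ, IsOpen J ∧ IsPreconnected J ∧ x ∈ J ∧ y ∈ J ∧
      HasLogDerivOn f C J := by
    intro x y
    -- Having a solution on a common open interval is a symmetric relation that holds locally;
    -- transitivity is the gluing of two solutions.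
    refine isPreconnected_univ.induction₂ (fun x y : ℝ => ∃ f : ℝ → G, ∃ J : Set ℝ, IsOpen J ∧
      IsPreconnected J ∧ x ∈ J ∧ y ∈ J ∧ HasLogDerivOn f C J) (fun x _ => ?_)
      (fun x y z _ _ _ h1 h2 => ?_) (fun x y _ _ h => ?_) (Set.mem_univ x) (Set.mem_univ y)
    · obtain ⟨f, J, hJ, hJ', hx, hf⟩ := hloc x
      exact nhdsWithin_le_nhds ((hJ.eventually_mem hx).mono fun y hy => ⟨f, J, hJ, hJ', hx, hy, hf⟩)
    · obtain ⟨f, J, hJ, hJ', hx, hy, hf⟩ := h1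
      obtain ⟨k, J₁, hJ₁, hJ₁', hy₁, hz, hk⟩ := h2
      classical
      -- The second solution is translated to agree with the first at `y`, hence on the overlap.
      have hk' := hk.const_mul (f y * (k y)⁻¹)
      have he : Set.EqOn f (fun s => f y * (k y)⁻¹ * k s) (J ∩ J₁) :=
        HasLogDerivOn.eqOn hc (hJ.inter hJ₁) (hint hJ' hJ₁') (hf.mono Set.inter_subset_left)
          (hk'.mono Set.inter_subset_right) ⟨hy, hy₁⟩ (by group)
      let F : ℝ → G := fun s => if s ∈ J then f s else f y * (k y)⁻¹ * k s
      have hF : HasLogDerivOn F C J := hf.congr hJ fun s hs => if_pos hs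
      have hF₁ : HasLogDerivOn F C J₁ := hk'.congr hJ₁ fun s hs => by
        by_cases hsJ : s ∈ J
        · exact (if_pos hsJ).trans (he ⟨hsJ, hs⟩)
        · exact if_neg hsJ
      exact ⟨F, J ∪ J₁, hJ.union hJ₁, hJ'.union y hy hy₁ hJ₁', Or.inl hx, Or.inr hz,
        fun s hs => hs.elim (hF s) (hF₁ s)⟩
    · obtain ⟨f, J, hJ, hJ', hx, hy, hf⟩ := h
      exact ⟨f, J, hJ, hJ', hy, hx, hf⟩
  choose f J hJ hJ' h0 hx hf using key 0
  -- `f x` solves on an interval containing `0` and `x`. After normalization at `0` all these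
  -- choices agree on overlaps, so the diagonal value is again a solution.
  refine ⟨fun x => (f x 0)⁻¹ * f x x, inv_mul_cancel _, fun x _ => ?_⟩
  refine ((hf x).const_mul (f x 0)⁻¹).congr (hJ x) (fun y hy => ?_) x (hx x)
  exact HasLogDerivOn.eqOn hc ((hJ y).inter (hJ x)) (hint (hJ' y) (hJ' x))
    (((hf y).const_mul _).mono Set.inter_subset_left)
    (((hf x).const_mul _).mono Set.inter_subset_right) ⟨h0 y, h0 x⟩
    (by rw [inv_mul_cancel, inv_mul_cancel]) ⟨hx y, hy⟩

/-- Solutions of `θ⁻¹ θ_x = C` with smooth initial values at `x = 0` exist and are smooth. -/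
theorem exists_smoothGroup_logDeriv_eq [FiniteDimensional ℝ E] (hc : TrivialCenter E G)
    {C : ℝ × ℝ → E} (hC : ContDiff ℝ ∞ C) {θ₀ : ℝ → G}
    (hθ₀ : ContMDiff 𝓘(ℝ, ℝ) 𝓘(ℝ, E) ∞ θ₀) :
    ∃ θ : ℝ → ℝ → G, SmoothGroup E θ ∧ (∀ t, θ 0 t = θ₀ t) ∧
      ∀ x t, logDeriv E (fun s => θ s t) x = C (x, t) := by
  have hball : ∀ (b t₀ : ℝ) {n : ℕ}, n ≠ 0 → ∃ φ : ℝ × ℝ → G, ∃ r > 0,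
      ∀ x ∈ Metric.ball b r, ∀ t ∈ Metric.ball t₀ r,
        ContMDiffAt 𝓘(ℝ, ℝ × ℝ) 𝓘(ℝ, E) n φ (x, t) ∧
        MDifferentiableAt 𝓘(ℝ, ℝ) 𝓘(ℝ, E) (fun x => φ (x, t)) x ∧
        logDeriv E (fun x => φ (x, t)) x = C (x, t) := by
    intro b t₀ n hn
    obtain ⟨φ, hφ⟩ := exists_local_group_solution (G := G) hC b t₀ hn
    obtain ⟨r, hr, hb⟩ := Metric.eventually_nhds_iff_ball.1 hφ
    refine ⟨φ, r, hr, fun x hx t ht => hb (x, t) ?_⟩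
    rw [← ball_prod_same]
    exact ⟨hx, ht⟩
  have hex : ∀ t, ∃ f : ℝ → G, f 0 = 1 ∧ HasLogDerivOn f (fun x => C (x, t)) Set.univ := by
    refine fun t => exists_hasLogDerivOn_univ hc fun b => ?_
    obtain ⟨φ, r, hr, hφ⟩ := hball b t one_ne_zero
    exact ⟨fun x => φ (x, t), Metric.ball b r, Metric.isOpen_ball, (convex_ball b r).isPreconnected,
      Metric.mem_ball_self hr, fun x hx => (hφ x hx t (Metric.mem_ball_self hr)).2⟩
  choose f hf0 hf using hex
  let θ : ℝ → ℝ → G := fun x t => θ₀ t * f t x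
  have hθ : ∀ t, HasLogDerivOn (fun x => θ x t) (fun x => C (x, t)) Set.univ :=
    fun t => (hf t).const_mul _
  have hθ0 : ∀ t, θ 0 t = θ₀ t := fun t => by simp only [θ, hf0, mul_one]
  refine ⟨θ, ?_, hθ0, fun x t => (hθ t x (Set.mem_univ x)).2⟩
  -- `θ` is built separately for each `t`. Near any point it differs from a jointly `C^n` local
  -- solution by a left factor depending only on `t`, so only regularity in `t` remains to be
  -- propagated.
  have hrep : ∀ (b t₀ : ℝ) {n : ℕ}, n ≠ 0 → ∃ φ : ℝ × ℝ → G, ∃ r > 0,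
      (∀ x ∈ Metric.ball b r, ∀ t ∈ Metric.ball t₀ r,
        ContMDiffAt 𝓘(ℝ, ℝ × ℝ) 𝓘(ℝ, E) n φ (x, t)) ∧
      ∀ x ∈ Metric.ball b r, ∀ y ∈ Metric.ball b r, ∀ t ∈ Metric.ball t₀ r,
        θ x t = θ y t * (φ (y, t))⁻¹ * φ (x, t) := by
    intro b t₀ n hn
    obtain ⟨φ, r, hr, hφ⟩ := hball b t₀ hn
    refine ⟨φ, r, hr, fun x hx t ht => (hφ x hx t ht).1, fun x hx y hy t ht => ?_⟩
    rw [← HasLogDerivOn.mul_inv_eq hc Metric.isOpen_ball (convex_ball b r).isPreconnected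
      ((hθ t).mono (Set.subset_univ _)) (fun x hx => (hφ x hx t ht).2) hx hy, inv_mul_cancel_right]
  have hnat : ∀ n : ℕ, n ≠ 0 → ContMDiff 𝓘(ℝ, ℝ × ℝ) 𝓘(ℝ, E) n (fun p : ℝ × ℝ => θ p.1 p.2) := by
    intro n hn
    have : LieGroup 𝓘(ℝ, E) n G := LieGroup.of_le (n := ∞) (by exact_mod_cast le_top)
    have hline : ∀ (φ : ℝ × ℝ → G) (x t : ℝ), ContMDiffAt 𝓘(ℝ, ℝ × ℝ) 𝓘(ℝ, E) n φ (x, t) →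
        ContMDiffAt 𝓘(ℝ, ℝ) 𝓘(ℝ, E) n (fun s => φ (x, s)) t := fun φ x t h =>
      ContMDiffAt.comp (f := fun s : ℝ => ((x, s) : ℝ × ℝ)) t h
        (contDiff_const.prodMk contDiff_id).contMDiff.contMDiffAt
    -- Regularity in `t` at one `x` is equivalent to that at nearby `x`, hence to that at `x = 0`,
    -- where `θ = θ₀`.
    have hstep : ∀ t₀ x : ℝ, ContMDiffAt 𝓘(ℝ, ℝ) 𝓘(ℝ, E) n (fun t => θ x t) t₀ := by
      intro t₀ x
      refine (isPreconnected_univ.induction₂ (fun x y : ℝ =>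
        ContMDiffAt 𝓘(ℝ, ℝ) 𝓘(ℝ, E) n (fun t => θ x t) t₀ ↔
        ContMDiffAt 𝓘(ℝ, ℝ) 𝓘(ℝ, E) n (fun t => θ y t) t₀) (fun b _ => ?_)
        (fun x y z _ _ _ => Iff.trans) (fun x y _ _ => Iff.symm) (Set.mem_univ x)
        (Set.mem_univ 0)).2 ?_
      · obtain ⟨φ, r, hr, hφ, he⟩ := hrep b t₀ hn
        have imp : ∀ x ∈ Metric.ball b r, ∀ y ∈ Metric.ball b r,
            ContMDiffAt 𝓘(ℝ, ℝ) 𝓘(ℝ, E) n (fun t => θ y t) t₀ →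
            ContMDiffAt 𝓘(ℝ, ℝ) 𝓘(ℝ, E) n (fun t => θ x t) t₀ := by
          intro x hx y hy h
          have h0 := Metric.mem_ball_self (x := t₀) hr
          refine ((h.mul (hline φ y t₀ (hφ y hy t₀ h0)).inv).mul
            (hline φ x t₀ (hφ x hx t₀ h0))).congr_of_eventuallyEq ?_
          filter_upwards [Metric.ball_mem_nhds t₀ hr] with t ht
          exact he x hx y hy t ht
        refine nhdsWithin_le_nhds ?_
        filter_upwards [Metric.ball_mem_nhds b hr] with y hy
        exact ⟨imp y hy b (Metric.mem_ball_self hr), imp b (Metric.mem_ball_self hr) y hy⟩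
      · simp only [hθ0]
        exact (hθ₀ t₀).of_le (by exact_mod_cast le_top)
    rintro ⟨x, t₀⟩
    obtain ⟨φ, r, hr, hφ, he⟩ := hrep x t₀ hn
    have hx0 := Metric.mem_ball_self (x := x) hr
    have ht0 := Metric.mem_ball_self (x := t₀) hr
    have hsnd : ∀ F : ℝ → G, ContMDiffAt 𝓘(ℝ, ℝ) 𝓘(ℝ, E) n F t₀ →
        ContMDiffAt 𝓘(ℝ, ℝ × ℝ) 𝓘(ℝ, E) n (fun p : ℝ × ℝ => F p.2) (x, t₀) := fun F h =>
      ContMDiffAt.comp (f := fun p : ℝ × ℝ => p.2) (x, t₀) h contDiff_snd.contMDiff.contMDiffAt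
    refine (((hsnd _ (hstep t₀ x)).mul (hsnd _ (hline φ x t₀ (hφ x hx0 t₀ ht0))).inv).mul
      (hφ x hx0 t₀ ht0)).congr_of_eventuallyEq ?_
    filter_upwards [prod_mem_nhds (Metric.ball_mem_nhds x hr) (Metric.ball_mem_nhds t₀ hr)]
      with p hp
    exact he p.1 hp.1 x hx0 p.2 hp.2
  -- The local neighbourhoods may shrink with `n`, but `θ` does not depend on `n`. The shift to `n +
  -- 1` avoids the excluded order `0`.
  refine contMDiff_infty.2 fun n => (hnat (n + 1) n.succ_ne_zero).of_le ?_
  exact_mod_cast n.le_succ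

end

section

/-! ### Existence of parallel framings -/

variable {E : Type*} [NormedAddCommGroup E] [NormedSpace ℝ E]
  {G : Type*} [TopologicalSpace G] [ChartedSpace E G] [Group G] [LieGroup 𝓘(ℝ, E) ∞ G]

instance finiteDimensional_groupLieAlgebra [FiniteDimensional ℝ E] :
    FiniteDimensional ℝ (GroupLieAlgebra 𝓘(ℝ, E) G) :=
  inferInstanceAs (FiniteDimensional ℝ E)

/-- The map `adE`, with values in the Lie algebra. -/
def lieE (v w : GroupLieAlgebra 𝓘(ℝ, E) G) : GroupLieAlgebra 𝓘(ℝ, E) G := adE E G v w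

theorem lie_eq_lieE (v w : GroupLieAlgebra 𝓘(ℝ, E) G) : ⁅v, w⁆ = lieE v w :=
  (adE_apply v w).symm

theorem mdifferentiable_of_smoothGroup_fst {G : Type*} [TopologicalSpace G] [ChartedSpace E G]
    {ψ : ℝ → ℝ → G} (hψ : SmoothGroup E ψ) (t : ℝ) :
    MDifferentiable 𝓘(ℝ, ℝ) 𝓘(ℝ, E) (fun x => ψ x t) :=
  (ContMDiff.comp (f := fun x : ℝ => ((x, t) : ℝ × ℝ)) hψ
    (contDiff_id.prodMk contDiff_const).contMDiff).mdifferentiable (by simp)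

/-- Partial derivatives of smooth functions. -/
theorem contDiff_deriv_fst {F : ℝ × ℝ → E} (hF : ContDiff ℝ ∞ F) :
    ContDiff ℝ ∞ fun p : ℝ × ℝ => deriv (fun s => F (s, p.2)) p.1 := by
  have h : (fun p : ℝ × ℝ => deriv (fun s => F (s, p.2)) p.1) = fun p => fderiv ℝ F p (1, 0) := by
    funext p
    have h1 : HasDerivAt (fun s : ℝ => ((s, p.2) : ℝ × ℝ)) (1, 0) p.1 :=
      (hasDerivAt_id _).prodMk (hasDerivAt_const _ _)
    exact ((hF.differentiable (by simp) p).hasFDerivAt.comp_hasDerivAt p.1 h1).deriv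
  rw [h]
  exact (hF.fderiv_right (m := ∞) (by simp)).clm_apply contDiff_const

theorem hasDerivAt_fst {F : ℝ × ℝ → E} (hF : ContDiff ℝ ∞ F) (x t : ℝ) :
    HasDerivAt (fun s => F (s, t)) (deriv (fun s => F (s, t)) x) x :=
  DifferentiableAt.hasDerivAt ((hF.comp (contDiff_id.prodMk contDiff_const)).differentiable
    (by simp) x)

variable [CompleteSpace E]

theorem adE_skew (v w : E) : adE E G v w = -adE E G w v := by
  have h : ∀ a b : GroupLieAlgebra 𝓘(ℝ, E) G, -⁅b, a⁆ = ⁅a, b⁆ := lie_skew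
  simp only [lie_eq_lieE] at h
  exact (h v w).symm

section

variable (S : HermitianSymmetric (GroupLieAlgebra 𝓘(ℝ, E) G))

/-- The element `χ^{-1/2} A`, in the model space. -/
def HermitianSymmetric.eE : E := S.e₂

theorem adE_eE_mem {x : E} (hx : x ∈ S.m) : adE E G S.eE x ∈ S.m := by
  have h : ∀ a ∈ S.m, ⁅S.e₂, a⁆ ∈ S.m := fun a => S.lie_e₂_mem_m
  simp only [lie_eq_lieE] at h
  exact h x hx

end

variable (E G) in
theorem trivialCenter_of_isKilling [LieAlgebra.IsKilling ℝ (GroupLieAlgebra 𝓘(ℝ, E) G)] :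
    TrivialCenter E G := by
  have h : ∀ a : GroupLieAlgebra 𝓘(ℝ, E) G, (∀ b : GroupLieAlgebra 𝓘(ℝ, E) G, ⁅a, b⁆ = 0) → a = 0 :=
    fun a => eq_zero_of_forall_lie
  simp only [lie_eq_lieE] at h
  exact fun a ha => h a fun b => DFunLike.congr_fun ha b

variable [FiniteDimensional ℝ E]

variable (S : HermitianSymmetric (GroupLieAlgebra 𝓘(ℝ, E) G))

theorem adE_eE_triple (x : E) :
    adE E G S.eE (adE E G S.eE (adE E G S.eE x)) = -(S.chi⁻¹ • adE E G S.eE x) := by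
  have h := S.e₂_lie_triple
  simp only [lie_eq_lieE] at h
  exact h x

theorem adE_eE_eE {x : E} (hx : x ∈ S.m) :
    adE E G S.eE (adE E G S.eE x) = -(S.chi⁻¹ • x) := by
  have h : ∀ a ∈ S.m, ⁅S.e₂, ⁅S.e₂, a⁆⁆ = -(S.chi⁻¹ • a) := fun a => S.lie_e₂_lie_e₂
  simp only [lie_eq_lieE] at h
  exact h x hx

variable [LieAlgebra.IsKilling ℝ (GroupLieAlgebra 𝓘(ℝ, E) G)]

theorem mem_m_of_linearized_adE {v : E} (hv : ∀ x : E,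
    adE E G v (adE E G S.eE (adE E G S.eE x)) + adE E G S.eE (adE E G v (adE E G S.eE x)) +
      adE E G S.eE (adE E G S.eE (adE E G v x)) = -(S.chi⁻¹ • adE E G v x)) : v ∈ S.m := by
  have h := fun v : GroupLieAlgebra 𝓘(ℝ, E) G => S.mem_m_of_linearized (v := v)
  simp only [lie_eq_lieE] at h
  exact h v hv

/-- The derivative of a curve in the adjoint orbit of `χ^{-1/2} A`. -/
theorem AdE_inv_deriv_mem_m {T : ℝ → E} {T' : E} {x : ℝ} (hT : HasDerivAt T T' x)
    (horb : ∀ s, ∃ k : G, T s = AdE E k S.eE) {k : G} (hk : T x = AdE E k S.eE) :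
    AdE E k⁻¹ T' ∈ S.m := by
  -- The cubic identity is invariant under `Ad k`, so it holds along the whole orbit.
  have htriple : ∀ s w, adE E G (T s) (adE E G (T s) (adE E G (T s) w)) =
      -(S.chi⁻¹ • adE E G (T s) w) := by
    intro s w
    obtain ⟨k, hk⟩ := horb s
    obtain ⟨y, rfl⟩ : ∃ y, w = AdE E k y := ⟨AdE E k⁻¹ w, (AdE_AdE_inv k w).symm⟩
    rw [hk, ← AdE_adE, ← AdE_adE, ← AdE_adE, adE_eE_triple, map_neg, map_smul]
  refine mem_m_of_linearized_adE S fun y => ?_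
  have hA : HasDerivAt (fun s => adE E G (T s)) (adE E G T') x :=
    (adE E G).hasFDerivAt.comp_hasDerivAt x hT
  have h1 := hA.clm_apply (hasDerivAt_const x (AdE E k y))
  have h2 := hA.clm_apply (hA.clm_apply h1)
  have h3 : (fun s => adE E G (T s) (adE E G (T s) (adE E G (T s) (AdE E k y)))) =
      fun s => -(S.chi⁻¹ • adE E G (T s) (AdE E k y)) := funext fun s => htriple s _
  rw [h3] at h2
  have h4 := ((h1.const_smul S.chi⁻¹).neg).unique h2
  simp only [map_zero, add_zero, hk] at h4
  -- Transporting the differentiated identity back by `Ad k⁻¹` gives its linearization at `e₂`.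
  have h5 := congrArg (AdE E k⁻¹) h4
  simp only [map_add, map_neg, map_smul, AdE_adE, AdE_inv_AdE] at h5
  rw [h5, add_assoc]

theorem adE_adE_deriv {T : ℝ → E} {T' : E} {x : ℝ} (hT : HasDerivAt T T' x)
    (horb : ∀ s, ∃ k : G, T s = AdE E k S.eE) :
    adE E G (T x) (adE E G (T x) T') = -(S.chi⁻¹ • T') := by
  obtain ⟨k, hk⟩ := horb x
  have h := adE_eE_eE S (AdE_inv_deriv_mem_m S hT horb hk)
  have h2 := congrArg (AdE E k) h
  rwa [AdE_adE, AdE_adE, ← hk, map_neg, map_smul, AdE_AdE_inv] at h2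

/-- A curve with logarithmic derivative `-χ [T, T']` transports `T` to a constant. -/
theorem AdE_apply_eq_of_logDeriv {T T' : ℝ → E} (hT : ∀ x, HasDerivAt T (T' x) x)
    (horb : ∀ s, ∃ k : G, T s = AdE E k S.eE) {θ : ℝ → G}
    (hθ : MDifferentiable 𝓘(ℝ, ℝ) 𝓘(ℝ, E) θ)
    (hθ' : ∀ x, logDeriv E θ x = -(S.chi • adE E G (T x) (T' x))) (x y : ℝ) :
    AdE E (θ x) (T x) = AdE E (θ y) (T y) := by
  have hd : ∀ x, HasDerivAt (fun s => AdE E (θ s) (T s)) 0 x := by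
    intro x
    have h := hasDerivAt_AdE_apply (hθ x) (hT x)
    -- `[-χ [T, T'], T] = χ [T, [T, T']] = -T'`.
    have h0 : adE E G (logDeriv E θ x) (T x) + T' x = 0 := by
      rw [hθ', map_neg, map_smul, neg_apply, smul_apply, adE_skew (adE E G (T x) (T' x)),
        adE_adE_deriv S (hT x) horb, neg_neg, smul_smul, mul_inv_cancel₀ S.chi_pos.ne', one_smul,
        neg_add_cancel]
    rwa [h0, map_zero] at h
  exact is_const_of_deriv_eq_zero (fun x => (hd x).differentiableAt) (fun x => (hd x).deriv) x y

/-- Transport along `t` on the axis `x = 0` provides smooth initial values that bring `T(0, t)` to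
`e₂`; transport along `x` then does so everywhere, and `ψ` is the inverse of the transport. -/
theorem exists_parallel_frame {T : ℝ × ℝ → E} (hT : ContDiff ℝ ∞ T)
    (horb : ∀ p, ∃ k : G, T p = AdE E k S.eE) :
    ∃ ψ : ℝ → ℝ → G, SmoothGroup E ψ ∧ (∀ x t, AdE E (ψ x t)⁻¹ (T (x, t)) = S.eE) ∧
      ∀ x t, logDeriv E (fun s => ψ s t) x ∈ S.m := by
  have hc := trivialCenter_of_isKilling E G
  have hC : ∀ {F : ℝ × ℝ → E}, ContDiff ℝ ∞ F → ContDiff ℝ ∞ fun p : ℝ × ℝ =>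
      -(S.chi • adE E G (F p) (deriv (fun s => F (s, p.2)) p.1)) := fun hF =>
    ((((adE E G).contDiff.comp hF).clm_apply (contDiff_deriv_fst hF)).const_smul S.chi).neg
  obtain ⟨k₀, hk₀⟩ := horb (0, 0)
  -- On the axis the time plays the role of the first variable; the second variable is a dummy.
  have hT₀ : ContDiff ℝ ∞ fun p : ℝ × ℝ => T (0, p.1) :=
    hT.comp (contDiff_const.prodMk contDiff_fst)
  obtain ⟨η, hη, hη0, hη'⟩ := exists_smoothGroup_logDeriv_eq hc (hC hT₀) (θ₀ := fun _ => k₀⁻¹)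
    contMDiff_const
  have hη1 : ContMDiff 𝓘(ℝ, ℝ) 𝓘(ℝ, E) ∞ (fun t => η t 0) :=
    ContMDiff.comp (f := fun x : ℝ => ((x, 0) : ℝ × ℝ)) hη
      (contDiff_id.prodMk contDiff_const).contMDiff
  obtain ⟨θ, hθ, hθ0, hθ'⟩ := exists_smoothGroup_logDeriv_eq hc (hC hT) hη1
  have hinit : ∀ t, AdE E (θ 0 t) (T (0, t)) = S.eE := by
    intro t
    rw [hθ0, AdE_apply_eq_of_logDeriv S (T := fun t => T (0, t)) (hasDerivAt_fst hT₀ · 0)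
      (fun s => horb _) (mdifferentiable_of_smoothGroup_fst hη 0) (hη' · 0) t 0, hη0, hk₀,
      AdE_inv_AdE]
  have hall : ∀ x t, AdE E (θ x t) (T (x, t)) = S.eE := by
    intro x t
    rw [← hinit t]
    exact AdE_apply_eq_of_logDeriv S (T := fun x => T (x, t)) (hasDerivAt_fst hT · t)
      (fun s => horb _) (mdifferentiable_of_smoothGroup_fst hθ t) (hθ' · t) x 0
  refine ⟨fun x t => (θ x t)⁻¹, ContMDiff.inv hθ, fun x t => by rw [inv_inv, hall], fun x t => ?_⟩
  -- The logarithmic derivative of `θ⁻¹` is `χ [e₂, Ad(θ) T_x]`, with `Ad(θ) T_x` in `m`.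
  rw [logDeriv_inv hc (mdifferentiable_of_smoothGroup_fst hθ t x), hθ', map_neg, neg_neg, map_smul,
    AdE_adE, hall]
  refine S.m.smul_mem _ (adE_eE_mem S ?_)
  have h := AdE_inv_deriv_mem_m S (T := fun x => T (x, t)) (hasDerivAt_fst hT x t)
    (fun s => horb _) (k := (θ x t)⁻¹) (by rw [← hall x t, AdE_inv_AdE])
  rwa [inv_inv] at h

end

section

/-! ### The adjoint action and derivatives in the Lie algebra -/

variable {E : Type*} [NormedAddCommGroup E] [NormedSpace ℝ E]
  {G : Type*} [TopologicalSpace G] [ChartedSpace E G] [Group G]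

theorem dx_add {F K : ℝ → ℝ → GroupLieAlgebra 𝓘(ℝ, E) G} (hF : SmoothLie F) (hK : SmoothLie K)
    (x t : ℝ) : dx (fun x t => F x t + K x t) x t = dx F x t + dx K x t :=
  ((hasDerivAt_fst hF x t).add (hasDerivAt_fst hK x t)).deriv

theorem dx_const (v : GroupLieAlgebra 𝓘(ℝ, E) G) (x t : ℝ) : dx (fun _ _ => v) x t = 0 :=
  deriv_const (F := E) x v

theorem dt_const (v : GroupLieAlgebra 𝓘(ℝ, E) G) (x t : ℝ) : dt (fun _ _ => v) x t = 0 :=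
  deriv_const (F := E) t v

theorem SmoothLie.swap {F : ℝ → ℝ → GroupLieAlgebra 𝓘(ℝ, E) G} (hF : SmoothLie F) :
    SmoothLie (fun t x => F x t) :=
  (show ContDiff ℝ ∞ (F := E) (fun p : ℝ × ℝ => F p.1 p.2) from hF).comp
    (contDiff_snd.prodMk contDiff_fst)

theorem dx_Ad (k : G) {F : ℝ → ℝ → GroupLieAlgebra 𝓘(ℝ, E) G} (hF : SmoothLie F) (x t : ℝ) :
    dx (fun x t => Ad E k (F x t)) x t = Ad E k (dx F x t) :=
  ((AdE E k).hasFDerivAt.comp_hasDerivAt x (hasDerivAt_fst hF x t)).deriv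

theorem dt_Ad (k : G) {F : ℝ → ℝ → GroupLieAlgebra 𝓘(ℝ, E) G} (hF : SmoothLie F) (x t : ℝ) :
    dt (fun x t => Ad E k (F x t)) x t = Ad E k (dt F x t) :=
  dx_Ad k hF.swap t x

theorem SmoothLie.Ad {F : ℝ → ℝ → GroupLieAlgebra 𝓘(ℝ, E) G} (hF : SmoothLie F) (k : G) :
    SmoothLie (fun x t => Ad E k (F x t)) :=
  (AdE E k).contDiff.comp hF

theorem deriv_mem_of_forall_mem [FiniteDimensional ℝ E] {p : Submodule ℝ E} {f : ℝ → E}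
    (h : ∀ s, f s ∈ p) (x : ℝ) : deriv f x ∈ p := by
  have h1 := range_deriv_subset_closure_span_image f (t := Set.univ) dense_univ
    (Set.mem_range_self x)
  have h2 : Submodule.span ℝ (f '' Set.univ) ≤ p :=
    Submodule.span_le.2 (by rintro _ ⟨s, -, rfl⟩; exact h s)
  have h3 := closure_mono (SetLike.coe_subset_coe.2 h2) h1
  rwa [p.closed_of_finiteDimensional.closure_eq] at h3

theorem dx_mem [FiniteDimensional ℝ E] {p : Submodule ℝ (GroupLieAlgebra 𝓘(ℝ, E) G)}
    {F : ℝ → ℝ → GroupLieAlgebra 𝓘(ℝ, E) G} (h : ∀ x t, F x t ∈ p) (x t : ℝ) : dx F x t ∈ p :=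
  deriv_mem_of_forall_mem (E := E) (p := p) (f := fun s => F s t) (fun s => h s t) x

theorem dt_mem [FiniteDimensional ℝ E] {p : Submodule ℝ (GroupLieAlgebra 𝓘(ℝ, E) G)}
    {F : ℝ → ℝ → GroupLieAlgebra 𝓘(ℝ, E) G} (h : ∀ x t, F x t ∈ p) (x t : ℝ) : dt F x t ∈ p :=
  deriv_mem_of_forall_mem (E := E) (p := p) (f := fun s => F x s) (fun s => h x s) t

theorem FrameVars.Smooth.act {V : FrameVars E G} (hV : V.Smooth) (k : G) : (V.act k).Smooth :=
  ⟨hV.q_smooth.Ad k, hV.hpar_smooth.Ad k, hV.hperp_smooth.Ad k, hV.wpar_smooth.Ad k,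
    hV.wperp_smooth.Ad k⟩

variable [LieGroup 𝓘(ℝ, E) ∞ G]

theorem Ad_inv_Ad (g : G) (v : GroupLieAlgebra 𝓘(ℝ, E) G) : Ad E g⁻¹ (Ad E g v) = v :=
  AdE_inv_AdE (E := E) g v

theorem Ad_Ad_inv (g : G) (v : GroupLieAlgebra 𝓘(ℝ, E) G) : Ad E g (Ad E g⁻¹ v) = v :=
  AdE_AdE_inv (E := E) g v

theorem Ad_lie (g : G) (v w : GroupLieAlgebra 𝓘(ℝ, E) G) :
    Ad E g ⁅v, w⁆ = ⁅Ad E g v, Ad E g w⁆ := by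
  rw [lie_eq_lieE, lie_eq_lieE]
  exact AdE_adE (E := E) g v w

theorem mem_stabilizer_iff {k : G} {A : GroupLieAlgebra 𝓘(ℝ, E) G} :
    k ∈ stabilizer E A ↔ Ad E k A = A := Iff.rfl

variable [CompleteSpace E]

/-- The adjoint action by Lie algebra automorphisms. -/
def AdLieEquiv (g : G) : GroupLieAlgebra 𝓘(ℝ, E) G ≃ₗ⁅ℝ⁆ GroupLieAlgebra 𝓘(ℝ, E) G where
  toFun := Ad E g
  map_add' := map_add _
  map_smul' := map_smul _
  map_lie' := Ad_lie g _ _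
  invFun := Ad E g⁻¹
  left_inv := Ad_inv_Ad g
  right_inv := Ad_Ad_inv g

theorem affInner_coframe (g : G) (X Y : GroupLieAlgebra 𝓘(ℝ, E) G) :
    affInner (coframe g X) (coframe g Y) = metric X Y := by
  have h := LieAlgebra.killingForm_of_equiv_apply (R := ℝ) (AdLieEquiv (E := E) g⁻¹) X Y
  simp only [affInner, metric, coframe]
  rw [← h]
  rfl

theorem Ad_eq_zero_iff {k : G} {a : GroupLieAlgebra 𝓘(ℝ, E) G} : Ad E k a = 0 ↔ a = 0 :=
  (AdLieEquiv (E := E) k).toLinearEquiv.map_eq_zero_iff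

section Stabilizer

variable (S : HermitianSymmetric (GroupLieAlgebra 𝓘(ℝ, E) G))

theorem Ad_mem_h {k : G} (hk : k ∈ stabilizer E S.A) {a : GroupLieAlgebra 𝓘(ℝ, E) G}
    (ha : a ∈ S.h) : Ad E k a ∈ S.h := by
  rw [S.centralizer_A] at ha ⊢
  have h := Ad_lie k S.A a
  rwa [ha, map_zero, mem_stabilizer_iff.1 hk, eq_comm] at h

/-- `Ad k` commutes with `ad A`, so it preserves the subspace where `ad(A)² = -1`. -/
theorem Ad_mem_m {k : G} (hk : k ∈ stabilizer E S.A) {a : GroupLieAlgebra 𝓘(ℝ, E) G}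
    (ha : a ∈ S.m) : Ad E k a ∈ S.m := by
  have h := congrArg (Ad E k) (S.ad_A_sq a ha)
  rw [Ad_lie, Ad_lie, mem_stabilizer_iff.1 hk, S.lie_A_lie_A, map_neg, neg_inj] at h
  rw [← h]
  exact S.projM_mem _

theorem FrameVars.Valued.act {V : FrameVars E G} (hV : V.Valued S) {k : G}
    (hk : k ∈ stabilizer E S.A) : (V.act k).Valued S :=
  ⟨fun x t => Ad_mem_m S hk (hV.q_mem x t), fun x t => Ad_mem_h S hk (hV.hpar_mem x t),
    fun x t => Ad_mem_m S hk (hV.hperp_mem x t), fun x t => Ad_mem_h S hk (hV.wpar_mem x t),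
    fun x t => Ad_mem_m S hk (hV.wperp_mem x t)⟩

theorem flowEqs_act_iff {V : FrameVars E G} (hs : V.Smooth) {k : G}
    (hk : k ∈ stabilizer E S.A) : V.FlowEqs S ↔ (V.act k).FlowEqs S := by
  have hA := mem_stabilizer_iff.1 hk
  have h1 : ∀ x t, dx (V.act k).hpar x t + ⁅(V.act k).q x t, (V.act k).hperp x t⁆ =
      Ad E k (dx V.hpar x t + ⁅V.q x t, V.hperp x t⁆) := fun x t => by
    simp only [FrameVars.act, dx_Ad k hs.hpar_smooth, map_add, Ad_lie]
  have h2 : ∀ x t, dx (V.act k).hperp x t + ⁅(V.act k).q x t, (V.act k).hpar x t⁆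
      + (√S.chi)⁻¹ • ⁅S.A, (V.act k).wperp x t⁆ =
      Ad E k (dx V.hperp x t + ⁅V.q x t, V.hpar x t⁆ + (√S.chi)⁻¹ • ⁅S.A, V.wperp x t⁆) :=
    fun x t => by
      simp only [FrameVars.act, dx_Ad k hs.hperp_smooth, map_add, map_smul, Ad_lie, hA]
  have h3 : ∀ x t, dx (V.act k).wpar x t + ⁅(V.act k).q x t, (V.act k).wperp x t⁆ =
      Ad E k (dx V.wpar x t + ⁅V.q x t, V.wperp x t⁆) := fun x t => by
    simp only [FrameVars.act, dx_Ad k hs.wpar_smooth, map_add, Ad_lie]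
  have h4 : ∀ x t, dx (V.act k).wperp x t - dt (V.act k).q x t
      + ⁅(V.act k).q x t, (V.act k).wpar x t⁆ =
      Ad E k (dx V.wperp x t - dt V.q x t + ⁅V.q x t, V.wpar x t⁆) := fun x t => by
    simp only [FrameVars.act, dx_Ad k hs.wperp_smooth, dt_Ad k hs.q_smooth, map_add, map_sub,
      Ad_lie]
  refine ⟨fun ⟨a, b, c, d⟩ => ⟨fun x t => ?_, fun x t => ?_, fun x t => ?_, fun x t => ?_⟩,
    fun ⟨a, b, c, d⟩ => ⟨fun x t => ?_, fun x t => ?_, fun x t => ?_, fun x t => ?_⟩⟩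
  · rw [h1, a, map_zero]
  · rw [h2, b, map_zero]
  · rw [h3, c, map_zero]
  · rw [h4, d, map_zero]
  · exact Ad_eq_zero_iff.1 ((h1 x t).symm.trans (a x t))
  · exact Ad_eq_zero_iff.1 ((h2 x t).symm.trans (b x t))
  · exact Ad_eq_zero_iff.1 ((h3 x t).symm.trans (c x t))
  · exact Ad_eq_zero_iff.1 ((h4 x t).symm.trans (d x t))

end Stabilizer

variable [FiniteDimensional ℝ E] (S : HermitianSymmetric (GroupLieAlgebra 𝓘(ℝ, E) G))

/-- The structure equations split into the four flow equations. -/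
theorem structureEqs_iff_flowEqs {V : FrameVars E G} (hV : V.Valued S) (hs : V.Smooth) :
    StructureEqs (fun _ _ => S.e) (fun x t => (0, V.hpar x t + V.hperp x t))
      (fun x t => (V.q x t, 0)) (fun x t => (V.wpar x t + V.wperp x t, 0)) ↔ V.FlowEqs S := by
  have h1 : ∀ x t, dxAff (fun x t => (0, V.hpar x t + V.hperp x t)) x t
      - dtAff (fun _ _ => S.e) x t
      + affBracket (V.q x t, 0) (0, V.hpar x t + V.hperp x t)
      - affBracket (V.wpar x t + V.wperp x t, 0) S.e =
      (0, (dx V.hpar x t + ⁅V.q x t, V.hperp x t⁆) +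
        (dx V.hperp x t + ⁅V.q x t, V.hpar x t⁆ + (√S.chi)⁻¹ • ⁅S.A, V.wperp x t⁆)) := by
    intro x t
    have h2 : ⁅V.wpar x t, S.e₂⁆ = 0 := by
      rw [← lie_skew, S.lie_e₂_of_mem_h (hV.wpar_mem x t), neg_zero]
    have h3 : ⁅V.wperp x t, S.e₂⁆ = -((√S.chi)⁻¹ • ⁅S.A, V.wperp x t⁆) := by
      rw [← lie_skew, HermitianSymmetric.e₂, smul_lie]
    simp only [dxAff, dtAff, affBracket, S.e_eq, dx_const, dt_const,
      dx_add hs.hpar_smooth hs.hperp_smooth, lie_zero, lie_add, add_lie, h2, h3,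
      Prod.mk_sub_mk, Prod.mk_add_mk, sub_zero, add_zero, zero_add, Prod.mk.injEq, true_and]
    abel
  have h2 : ∀ x t, dxAff (fun x t => (V.wpar x t + V.wperp x t, 0)) x t
      - dtAff (fun x t => (V.q x t, 0)) x t
      + affBracket (V.q x t, 0) (V.wpar x t + V.wperp x t, 0) =
      ((dx V.wpar x t + ⁅V.q x t, V.wperp x t⁆) +
        (dx V.wperp x t - dt V.q x t + ⁅V.q x t, V.wpar x t⁆), 0) := by
    intro x t
    simp only [dxAff, dtAff, affBracket, dx_const, dt_const,
      dx_add hs.wpar_smooth hs.wperp_smooth, lie_zero, zero_lie, lie_add,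
      Prod.mk_sub_mk, Prod.mk_add_mk, sub_zero, add_zero, Prod.mk.injEq, and_true]
    abel
  -- Each flow expression lies wholly in `h` or in `m`, so a vanishing sum splits into two
  -- equations.
  have m1 : ∀ x t, dx V.hpar x t + ⁅V.q x t, V.hperp x t⁆ ∈ S.h := fun x t =>
    S.h.add_mem (dx_mem (p := S.h.toSubmodule) hV.hpar_mem x t)
      (S.lie_m_m _ (hV.q_mem x t) _ (hV.hperp_mem x t))
  have m2 : ∀ x t, dx V.hperp x t + ⁅V.q x t, V.hpar x t⁆ + (√S.chi)⁻¹ • ⁅S.A, V.wperp x t⁆ ∈ S.m :=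
    fun x t => S.m.add_mem (S.m.add_mem (dx_mem hV.hperp_mem x t)
      (S.lie_m_h (hV.q_mem x t) (hV.hpar_mem x t)))
      (S.m.smul_mem _ (S.lie_A_mem_m (hV.wperp_mem x t)))
  have m3 : ∀ x t, dx V.wpar x t + ⁅V.q x t, V.wperp x t⁆ ∈ S.h := fun x t =>
    S.h.add_mem (dx_mem (p := S.h.toSubmodule) hV.wpar_mem x t)
      (S.lie_m_m _ (hV.q_mem x t) _ (hV.wperp_mem x t))
  have m4 : ∀ x t, dx V.wperp x t - dt V.q x t + ⁅V.q x t, V.wpar x t⁆ ∈ S.m :=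
    fun x t => S.m.add_mem (S.m.sub_mem (dx_mem hV.wperp_mem x t) (dt_mem hV.q_mem x t))
      (S.lie_m_h (hV.q_mem x t) (hV.wpar_mem x t))
  simp only [StructureEqs, h1, h2, Prod.mk_eq_zero, true_and, and_true]
  constructor
  · rintro ⟨ha, hb⟩
    exact ⟨fun x t => ((S.add_eq_zero_iff (m1 x t) (m2 x t)).1 (ha x t)).1,
      fun x t => ((S.add_eq_zero_iff (m1 x t) (m2 x t)).1 (ha x t)).2,
      fun x t => ((S.add_eq_zero_iff (m3 x t) (m4 x t)).1 (hb x t)).1,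
      fun x t => ((S.add_eq_zero_iff (m3 x t) (m4 x t)).1 (hb x t)).2⟩
  · rintro ⟨ha, hb, hc, hd⟩
    exact ⟨fun x t => by rw [ha, hb, add_zero], fun x t => by rw [hc, hd, add_zero]⟩

end

section

/-! ### The structure equations of a framing -/

theorem deriv_line {W : Type*} [NormedAddCommGroup W] [NormedSpace ℝ W] {F : ℝ × ℝ → W}
    (hF : ContDiff ℝ ∞ F) (p v : ℝ × ℝ) {c : ℝ → ℝ × ℝ} {x : ℝ} (hc : HasDerivAt c v x)
    (hp : c x = p) : HasDerivAt (fun s => F (c s)) (fderiv ℝ F p v) x := by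
  subst hp
  exact (hF.differentiable (by simp) (c x)).hasFDerivAt.comp_hasDerivAt x hc

theorem deriv_deriv_comm {W : Type*} [NormedAddCommGroup W] [NormedSpace ℝ W] {F : ℝ × ℝ → W}
    (hF : ContDiff ℝ ∞ F) (x t : ℝ) :
    deriv (fun s => deriv (fun r => F (s, r)) t) x =
      deriv (fun r => deriv (fun s => F (s, r)) x) t := by
  have hx : ∀ x t : ℝ, HasDerivAt (fun s : ℝ => ((s, t) : ℝ × ℝ)) (1, 0) x := fun x t =>
    (hasDerivAt_id _).prodMk (hasDerivAt_const _ _)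
  have ht : ∀ x t : ℝ, HasDerivAt (fun s : ℝ => ((x, s) : ℝ × ℝ)) (0, 1) t := fun x t =>
    (hasDerivAt_const _ _).prodMk (hasDerivAt_id _)
  have h1 : ∀ x t, deriv (fun s => F (s, t)) x = fderiv ℝ F (x, t) (1, 0) := fun x t =>
    (deriv_line hF (x, t) _ (hx x t) rfl).deriv
  have h2 : ∀ x t, deriv (fun s => F (x, s)) t = fderiv ℝ F (x, t) (0, 1) := fun x t =>
    (deriv_line hF (x, t) _ (ht x t) rfl).deriv
  simp only [h1, h2]
  have hF2 := hF.fderiv_right (m := ∞) (by simp)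
  have key : ∀ (v w : ℝ × ℝ) {c : ℝ → ℝ × ℝ} {r : ℝ}, HasDerivAt c v r → c r = (x, t) →
      deriv (fun s => fderiv ℝ F (c s) w) r = fderiv ℝ (fderiv ℝ F) (x, t) v w := by
    intro v w c r hc hr
    have h := (deriv_line hF2 (x, t) v hc hr).clm_apply (hasDerivAt_const r w)
    rw [map_zero, add_zero] at h
    exact h.deriv
  rw [key _ _ (hx x t) rfl, key _ _ (ht x t) rfl]
  have hsymm : IsSymmSndFDerivAt ℝ F (x, t) := hF.contDiffAt.isSymmSndFDerivAt (by
    rw [minSmoothness_of_isRCLikeNormedField]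
    exact ENat.LEInfty.out)
  exact hsymm.eq _ _

theorem hasDerivAt_snd {E : Type*} [NormedAddCommGroup E] [NormedSpace ℝ E] {F : ℝ × ℝ → E}
    (hF : ContDiff ℝ ∞ F) (x t : ℝ) :
    HasDerivAt (fun s => F (x, s)) (deriv (fun s => F (x, s)) t) t :=
  DifferentiableAt.hasDerivAt ((hF.comp (contDiff_const.prodMk contDiff_id)).differentiable
    (by simp) t)

variable {E : Type*} [NormedAddCommGroup E] [NormedSpace ℝ E]
  {G : Type*} [TopologicalSpace G] [ChartedSpace E G] [Group G] [LieGroup 𝓘(ℝ, E) ∞ G]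

theorem contDiff_AdE_comp {ψ : ℝ → ℝ → G} (hψ : SmoothGroup E ψ) :
    ContDiff ℝ ∞ fun p : ℝ × ℝ => AdE E (ψ p.1 p.2) :=
  contMDiff_iff_contDiff.1 (contMDiff_AdE.comp hψ)

theorem hasDerivAt_AdE_inv_apply (hc : TrivialCenter E G) {f : ℝ → G} {F : ℝ → E} {x : ℝ} {F' : E}
    (hf : MDifferentiableAt 𝓘(ℝ, ℝ) 𝓘(ℝ, E) f x) (hF : HasDerivAt F F' x) :
    HasDerivAt (fun s => AdE E (f s)⁻¹ (F s))
      (AdE E (f x)⁻¹ F' - adE E G (logDeriv E f x) (AdE E (f x)⁻¹ (F x))) x := by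
  have h := hasDerivAt_AdE_apply (mdifferentiableAt_inv_curve hf) hF
  rw [logDeriv_inv hc hf] at h
  convert h using 1
  rw [map_add, AdE_adE, map_neg, AdE_inv_AdE, map_neg, neg_apply, add_comm, sub_eq_add_neg]

variable [CompleteSpace E]

theorem adE_adE_apply (u v w : E) :
    adE E G (adE E G u v) w = adE E G u (adE E G v w) - adE E G v (adE E G u w) := by
  have h : ∀ a b c : GroupLieAlgebra 𝓘(ℝ, E) G, ⁅⁅a, b⁆, c⁆ = ⁅a, ⁅b, c⁆⁆ - ⁅b, ⁅a, c⁆⁆ := lie_lie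
  simp only [lie_eq_lieE] at h
  exact h u v w

/-- Equality of the mixed partial derivatives of `Ad ψ` says that `ad` of the left side vanishes;
`ad` is injective. -/
theorem maurerCartan (hc : TrivialCenter E G) {ψ : ℝ → ℝ → G} (hψ : SmoothGroup E ψ) (x t : ℝ) :
    deriv (fun s => logDeriv E (fun r => ψ s r) t) x
      - deriv (fun s => logDeriv E (fun r => ψ r s) x) t
      + adE E G (logDeriv E (fun s => ψ s t) x) (logDeriv E (fun s => ψ x s) t) = 0 := by
  have mx := fun t => mdifferentiable_of_smoothGroup_fst hψ t
  have mt := fun x => mdifferentiable_of_smoothGroup_fst hψ.swap x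
  have h := deriv_deriv_comm (contDiff_AdE_comp hψ) x t
  simp only [fun s => (hasDerivAt_AdE (mt s t)).deriv,
    fun s => (hasDerivAt_AdE (mx s x)).deriv] at h
  have h1 := (hasDerivAt_AdE (mx t x)).clm_comp ((adE E G).hasFDerivAt.comp_hasDerivAt x
    (hasDerivAt_fst (contDiff_logDeriv_snd hψ) x t))
  have h2 := (hasDerivAt_AdE (mt x t)).clm_comp ((adE E G).hasFDerivAt.comp_hasDerivAt t
    (hasDerivAt_snd (contDiff_logDeriv_fst hψ) x t))
  have h3 := h1.deriv.symm.trans (h.trans h2.deriv)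
  refine hc _ (ContinuousLinearMap.ext fun w => ?_)
  have h4 := congrArg (AdE E (ψ x t)⁻¹) (DFunLike.congr_fun h3 w)
  simp only [ContinuousLinearMap.comp_apply, add_apply, map_add, AdE_inv_AdE] at h4
  simp only [map_add, map_sub, add_apply, sub_apply, adE_adE_apply, zero_apply]
  rw [← sub_eq_zero] at h4
  rw [← h4]
  abel

/-- The torsion equation is the product rule for `Ad(ψ⁻¹) γ_t` and `Ad(ψ⁻¹) γ_x` together with
`γ_{tx} = γ_{xt}`; the curvature equation is `maurerCartan`. -/
theorem structureEqs_of_framing (hc : TrivialCenter E G) {γ : ℝ → ℝ → Aff E G}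
    (hγ : SmoothFlow γ) {ψ : ℝ → ℝ → G} (hψ : SmoothGroup E ψ) :
    StructureEqs (fun x t => coframe (ψ x t) (tangentX γ x t))
      (fun x t => coframe (ψ x t) (tangentT γ x t)) (connX E ψ) (connT E ψ) := by
  let Γ : ℝ × ℝ → E := fun p => Aff.chart E G (γ p.1 p.2)
  let X : ℝ × ℝ → E := fun p => deriv (fun s => Γ (s, p.2)) p.1
  let T : ℝ × ℝ → E := fun p => deriv (fun s => Γ (p.1, s)) p.2
  have hΓ : ContDiff ℝ ∞ Γ := hγ
  have hX : ContDiff ℝ ∞ X := contDiff_deriv_fst hΓ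
  have hT : ContDiff ℝ ∞ T :=
    (contDiff_deriv_fst (hΓ.comp (contDiff_snd.prodMk contDiff_fst))).comp
      (contDiff_snd.prodMk contDiff_fst)
  constructor
  · intro x t
    have h1 := (hasDerivAt_AdE_inv_apply hc (mdifferentiable_of_smoothGroup_fst hψ t x)
      (hasDerivAt_fst hT x t)).deriv
    have h2 := (hasDerivAt_AdE_inv_apply hc (mdifferentiable_of_smoothGroup_fst hψ.swap x t)
      (hasDerivAt_snd hX x t)).deriv
    have h3 : deriv (fun s => T (s, t)) x = deriv (fun s => X (x, s)) t := deriv_deriv_comm hΓ x t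
    refine Prod.ext ?_ ?_
    · simp [dxAff, dtAff, affBracket, coframe, connX, connT, dx_const, dt_const]
    · simp only [dxAff, dtAff, affBracket, coframe, connX, connT, Prod.snd_sub, Prod.snd_add,
        lie_zero, add_zero, Prod.snd_zero, lie_eq_lieE]
      have h4 : deriv (fun s => AdE E (ψ s t)⁻¹ (T (s, t))) x
          - deriv (fun s => AdE E (ψ x s)⁻¹ (X (x, s))) t
          + adE E G (logDeriv E (fun s => ψ s t) x) (AdE E (ψ x t)⁻¹ (T (x, t)))
          - adE E G (logDeriv E (fun s => ψ x s) t) (AdE E (ψ x t)⁻¹ (X (x, t))) = 0 := by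
        rw [h1, h2, h3]
        abel
      exact h4
  · intro x t
    refine Prod.ext ?_ ?_
    · simp only [dxAff, dtAff, affBracket, connX, connT, Prod.fst_sub, Prod.fst_add, lie_eq_lieE]
      exact maurerCartan hc hψ x t
    · simp [dxAff, dtAff, affBracket, connX, connT, dx_const, dt_const]

end

section

/-! ### Parallel framings, their variables and their equivalence group -/

variable {E : Type*} [NormedAddCommGroup E] [NormedSpace ℝ E]
  {G : Type*} [TopologicalSpace G] [ChartedSpace E G] [Group G] [LieGroup 𝓘(ℝ, E) ∞ G]

theorem FrameVars.Represents.act (hc : TrivialCenter E G) {γ : ℝ → ℝ → Aff E G} {ψ : ℝ → ℝ → G}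
    (hψ : SmoothGroup E ψ) {V : FrameVars E G} (hV : V.Represents γ ψ) (k : G) :
    (V.act k⁻¹).Represents γ (fun x t => ψ x t * k) := by
  have hk : ∀ r : ℝ, logDeriv E (fun _ : ℝ => k) r = 0 := by
    intro r
    simp only [logDeriv]
    exact DFunLike.congr_fun mfderiv_const (1 : ℝ)
  have hmul : ∀ {f : ℝ → G} {r : ℝ}, MDifferentiableAt 𝓘(ℝ, ℝ) 𝓘(ℝ, E) f r →
      logDeriv E (fun s => f s * k) r = AdE E k⁻¹ (logDeriv E f r) := by
    intro f r hf
    rw [logDeriv_mul hc hf mdifferentiableAt_const, hk, add_zero]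
  constructor
  · intro x t
    have h1 : logDx E ψ x t = V.q x t := congrArg Prod.fst (hV.connX_eq x t)
    have h2 := hmul (mdifferentiable_of_smoothGroup_fst hψ t x)
    exact Prod.ext (h2.trans (congrArg (AdE E k⁻¹) h1)) rfl
  · intro x t
    have h1 : Ad E (ψ x t)⁻¹ (tangentT γ x t) = V.hpar x t + V.hperp x t :=
      congrArg Prod.snd (hV.coframeT_eq x t)
    simp only [coframe, FrameVars.act, mul_inv_rev, Ad_mul, ← map_add, ← h1]
    rfl
  · intro x t
    have h1 : logDt E ψ x t = V.wpar x t + V.wperp x t := congrArg Prod.fst (hV.connT_eq x t)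
    have h2 := hmul (mdifferentiable_of_smoothGroup_fst hψ.swap x t)
    simp only [FrameVars.act, ← map_add]
    exact Prod.ext (h2.trans (congrArg (AdE E k⁻¹) h1)) rfl

variable [CompleteSpace E] [FiniteDimensional ℝ E]
  (S : HermitianSymmetric (GroupLieAlgebra 𝓘(ℝ, E) G))

theorem metric_tangentX {γ : ℝ → ℝ → Aff E G} {x t : ℝ}
    (h : ∃ g : G, coframe g (tangentX γ x t) = S.e) :
    metric (tangentX γ x t) (tangentX γ x t) = 1 := by
  obtain ⟨g, hg⟩ := h
  rw [← affInner_coframe g, hg, S.affInner_e]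

omit [FiniteDimensional ℝ E] in
theorem coframe_eq_e_iff (g : G) (X : GroupLieAlgebra 𝓘(ℝ, E) G) :
    coframe g X = S.e ↔ Ad E g⁻¹ X = S.e₂ := by
  rw [S.e_eq, coframe, Prod.mk.injEq]
  exact and_iff_right rfl

theorem mem_stabilizer_iff_e₂ {k : G} : k ∈ stabilizer E S.A ↔ Ad E k S.e₂ = S.e₂ := by
  rw [mem_stabilizer_iff, HermitianSymmetric.e₂, map_smul]
  exact (smul_right_injective _ S.inv_sqrt_chi_pos.ne').eq_iff.symm

theorem SmoothLie.projM {F : ℝ → ℝ → GroupLieAlgebra 𝓘(ℝ, E) G} (hF : SmoothLie F) :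
    SmoothLie (fun x t => S.projM (F x t)) :=
  (LinearMap.toContinuousLinearMap (show E →ₗ[ℝ] E from S.projM)).contDiff.comp hF

theorem SmoothLie.projH {F : ℝ → ℝ → GroupLieAlgebra 𝓘(ℝ, E) G} (hF : SmoothLie F) :
    SmoothLie (fun x t => S.projH (F x t)) :=
  (LinearMap.toContinuousLinearMap (show E →ₗ[ℝ] E from S.projH)).contDiff.comp hF

omit [FiniteDimensional ℝ E] in
/-- The logarithmic derivative of an `H`-valued curve lies in `h`. -/
theorem logDeriv_mem_h {f : ℝ → G} {x : ℝ}
    (hf : MDifferentiableAt 𝓘(ℝ, ℝ) 𝓘(ℝ, E) f x) (hk : ∀ s, f s ∈ stabilizer E S.A) :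
    logDeriv E f x ∈ S.h := by
  have h1 : ∀ a : E, (∀ s, AdE E (f s) a = a) → adE E G a (logDeriv E f x) = 0 := by
    intro a ha
    have h2 := hasDerivAt_AdE_apply hf (hasDerivAt_const x a)
    simp only [ha] at h2
    have h3 := congrArg (AdE E (f x)⁻¹) (h2.unique (hasDerivAt_const x a))
    rw [AdE_inv_AdE, add_zero, map_zero, adE_skew, neg_eq_zero] at h3
    exact h3
  have h4 : ∀ a, lieE S.A a = 0 → a ∈ S.h := fun a ha =>
    (S.centralizer_A a).2 ((lie_eq_lieE _ _).trans ha)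
  exact h4 _ (h1 S.A hk)

/-- The variables of a framing. -/
def frameVars (γ : ℝ → ℝ → Aff E G) (ψ : ℝ → ℝ → G) : FrameVars E G where
  q := logDx E ψ
  hpar x t := S.projH (Ad E (ψ x t)⁻¹ (tangentT γ x t))
  hperp x t := S.projM (Ad E (ψ x t)⁻¹ (tangentT γ x t))
  wpar x t := S.projH (logDt E ψ x t)
  wperp x t := S.projM (logDt E ψ x t)

variable {γ : ℝ → ℝ → Aff E G} {ψ : ℝ → ℝ → G}

omit [FiniteDimensional ℝ E] in
theorem represents_frameVars : (frameVars S γ ψ).Represents γ ψ where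
  connX_eq _ _ := rfl
  coframeT_eq x t := by simp only [frameVars, S.projH_add_projM, coframe]
  connT_eq x t := by simp only [frameVars, S.projH_add_projM, connT]

omit [FiniteDimensional ℝ E] in
theorem eq_frameVars {V : FrameVars E G} (hV : V.Valued S) (hr : V.Represents γ ψ) :
    V = frameVars S γ ψ := by
  have h : ∀ {a b c}, a ∈ S.h → b ∈ S.m → c = a + b → a = S.projH c ∧ b = S.projM c := by
    intro a b c ha hb hab
    rw [hab, map_add, map_add, S.projH_of_mem_h ha, S.projH_of_mem_m hb, S.projM_of_mem_h ha,
      S.projM_of_mem_m hb, add_zero, zero_add]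
    exact ⟨rfl, rfl⟩
  have h1 := fun x t => h (hV.hpar_mem x t) (hV.hperp_mem x t)
    (congrArg Prod.snd (hr.coframeT_eq x t))
  have h2 := fun x t => h (hV.wpar_mem x t) (hV.wperp_mem x t) (congrArg Prod.fst (hr.connT_eq x t))
  refine FrameVars.ext ?_ ?_ ?_ ?_ ?_
  · exact funext₂ fun x t => (congrArg Prod.fst (hr.connX_eq x t)).symm
  · exact funext₂ fun x t => (h1 x t).1
  · exact funext₂ fun x t => (h1 x t).2
  · exact funext₂ fun x t => (h2 x t).1
  · exact funext₂ fun x t => (h2 x t).2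

theorem smooth_frameVars (hγ : SmoothFlow γ) (hψ : SmoothGroup E ψ) :
    (frameVars S γ ψ).Smooth := by
  have hT : SmoothLie (fun x t => Ad E (ψ x t)⁻¹ (tangentT γ x t)) := by
    have h1 : ContDiff ℝ ∞ fun p : ℝ × ℝ => AdE E (ψ p.1 p.2)⁻¹ :=
      contDiff_AdE_comp (ψ := fun x t => (ψ x t)⁻¹) (ContMDiff.inv hψ)
    exact h1.clm_apply ((contDiff_deriv_fst (SmoothLie.swap hγ)).comp
      (contDiff_snd.prodMk contDiff_fst))
  have hW : SmoothLie (logDt E ψ) := contDiff_logDeriv_snd hψ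
  exact ⟨contDiff_logDeriv_fst hψ, hT.projH S, hT.projM S, hW.projH S, hW.projM S⟩

variable [LieAlgebra.IsKilling ℝ (GroupLieAlgebra 𝓘(ℝ, E) G)]

theorem connX_mem_iff (x t : ℝ) : connX E ψ x t ∈ hAffPerp S.e ↔ logDx E ψ x t ∈ S.m := by
  rw [S.mem_hAffPerp_iff]
  exact and_iff_right rfl

theorem valued_frameVars (h : IsGParallelFraming S γ ψ) : (frameVars S γ ψ).Valued S :=
  ⟨fun x t => (connX_mem_iff S x t).1 (h.parallel x t), fun _ _ => S.projH_mem _,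
    fun _ _ => S.projM_mem _, fun _ _ => S.projH_mem _, fun _ _ => S.projM_mem _⟩

theorem exists_isGParallelFraming (hγ : SmoothFlow γ)
    (h : ∀ x t, ∃ g : G, coframe g (tangentX γ x t) = S.e) :
    ∃ ψ : ℝ → ℝ → G, IsGParallelFraming S γ ψ := by
  obtain ⟨ψ, h1, h2, h3⟩ := exists_parallel_frame S (T := fun p => tangentX γ p.1 p.2)
    (contDiff_deriv_fst hγ) fun p => by
      obtain ⟨g, hg⟩ := h p.1 p.2
      rw [coframe_eq_e_iff] at hg
      refine ⟨g, ?_⟩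
      have h4 := congrArg (Ad E g) hg
      rw [Ad_Ad_inv] at h4
      exact h4
  exact ⟨ψ, h1, fun x t => (coframe_eq_e_iff S _ _).2 (h2 x t),
    fun x t => (connX_mem_iff S x t).2 (h3 x t)⟩

theorem flowEqs_frameVars (hγ : SmoothFlow γ) (h : IsGParallelFraming S γ ψ) :
    (frameVars S γ ψ).FlowEqs S := by
  rw [← structureEqs_iff_flowEqs S (valued_frameVars S h) (smooth_frameVars S hγ h.smooth)]
  have h1 := structureEqs_of_framing (trivialCenter_of_isKilling E G) hγ h.smooth
  simp only [h.adapted, (represents_frameVars S).coframeT_eq] at h1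
  have h2 : connX E ψ = fun x t => ((frameVars S γ ψ).q x t, 0) := rfl
  have h3 : connT E ψ = fun x t => ((frameVars S γ ψ).wpar x t + (frameVars S γ ψ).wperp x t, 0) :=
    funext₂ (represents_frameVars S (γ := γ)).connT_eq
  rwa [h2, h3] at h1

/-- The equivalence group of parallel framings. -/
theorem isGParallelFraming_mul_iff (h : IsGParallelFraming S γ ψ) {g : ℝ → ℝ → G}
    (hg : SmoothGroup E g) : IsGParallelFraming S γ (fun x t => ψ x t * g x t) ↔
      (∀ x t, g x t ∈ stabilizer E S.A) ∧ ∀ x x' t, g x t = g x' t := by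
  have hc := trivialCenter_of_isKilling E G
  have had := fun x t => (coframe_eq_e_iff S _ _).1 (h.adapted x t)
  have hadapt : ∀ x t, coframe (ψ x t * g x t) (tangentX γ x t) = S.e ↔
      g x t ∈ stabilizer E S.A := by
    intro x t
    rw [coframe_eq_e_iff, mul_inv_rev, Ad_mul, ContinuousLinearMap.comp_apply, had,
      ← mem_stabilizer_iff_e₂, inv_mem_iff]
  have hgx := fun t => mdifferentiable_of_smoothGroup_fst hg t
  have hlog : ∀ x t, logDx E (fun x t => ψ x t * g x t) x t =
      Ad E (g x t)⁻¹ (logDx E ψ x t) + logDx E g x t := fun x t =>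
    logDeriv_mul hc (mdifferentiable_of_smoothGroup_fst h.smooth t x) (hgx t x)
  have hq : ∀ x t, logDx E ψ x t ∈ S.m := fun x t => (connX_mem_iff S x t).1 (h.parallel x t)
  constructor
  · intro h'
    have hst : ∀ x t, g x t ∈ stabilizer E S.A := fun x t => (hadapt x t).1 (h'.adapted x t)
    refine ⟨hst, fun x x' t => ?_⟩
    refine HasLogDerivOn.eq_of_zero (E := E) (f := fun x => g x t) isOpen_univ isPreconnected_univ
      (fun x _ => ⟨hgx t x, ?_⟩) (Set.mem_univ x) (Set.mem_univ x')
    -- The new connection is `Ad(g⁻¹) q + g⁻¹ g_x`. Its first term is in `m`, so `g⁻¹ g_x` lies in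
    -- `m`, and it lies in `h` because `g` is `H`-valued.
    have h1 := (connX_mem_iff S x t).1 (h'.parallel x t)
    rw [hlog, S.m.add_mem_iff_right (Ad_mem_m S (inv_mem (hst x t)) (hq x t))] at h1
    exact S.eq_zero_of_mem (logDeriv_mem_h S (hgx t x) fun s => hst s t) h1
  · rintro ⟨hst, hconst⟩
    refine ⟨ContMDiff.mul h.smooth hg, fun x t => (hadapt x t).2 (hst x t), fun x t => ?_⟩
    have h0 : logDx E g x t = 0 := by
      have h1 : (fun s : ℝ => (g x t)⁻¹ * g s t) = fun _ => 1 := by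
        funext s
        rw [hconst s x t, inv_mul_cancel]
      have h2 : ∀ F : ℝ → G, F = (fun _ => 1) →
          @Eq E (mfderiv 𝓘(ℝ, ℝ) 𝓘(ℝ, E) F x (1 : ℝ)) 0 := by
        rintro F rfl
        exact DFunLike.congr_fun mfderiv_const (1 : ℝ)
      exact h2 _ h1
    rw [connX_mem_iff, hlog, h0, add_zero]
    exact Ad_mem_m S (inv_mem (hst x t)) (hq x t)

theorem isGParallelFraming_mul_const_iff (h : IsGParallelFraming S γ ψ) (k : G) :
    IsGParallelFraming S γ (fun x t => ψ x t * k) ↔ k ∈ stabilizer E S.A := by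
  rw [isGParallelFraming_mul_iff S h (g := fun _ _ => k) contMDiff_const]
  exact ⟨fun h1 => h1.1 0 0, fun h1 => ⟨fun _ _ => h1, fun _ _ _ => rfl⟩⟩

omit [FiniteDimensional ℝ E] [CompleteSpace E]
  [LieAlgebra.IsKilling ℝ (GroupLieAlgebra 𝓘(ℝ, E) G)] in
theorem logDeriv_comp_add_const {f : ℝ → G} (l x : ℝ)
    (hf : MDifferentiable 𝓘(ℝ, ℝ) 𝓘(ℝ, E) f) :
    logDeriv E (fun s => f (s + l)) x = logDeriv E f (x + l) := by
  have h1 : HasMFDerivAt 𝓘(ℝ, ℝ) 𝓘(ℝ, ℝ) (fun s : ℝ => s + l) x (ContinuousLinearMap.id ℝ ℝ) :=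
    ((hasFDerivAt_id x).add_const l).hasMFDerivAt
  have h2 := (mdifferentiableAt_const_mul (hf (x + l)) (f (x + l))⁻¹).hasMFDerivAt.comp x h1
  exact DFunLike.congr_fun h2.mfderiv (1 : ℝ)

/-- Framings of periodic flows are periodic up to the equivalence group. -/
theorem exists_period (h : IsGParallelFraming S γ ψ) {l : ℝ}
    (hl : ∀ x t, γ (x + l) t = γ x t) (t : ℝ) :
    ∃ k ∈ stabilizer E S.A, ∀ x, ψ (x + l) t = ψ x t * k := by
  have hshift : SmoothGroup E (fun x t => ψ (x + l) t) :=
    ContMDiff.comp (f := fun p : ℝ × ℝ => (p.1 + l, p.2)) h.smooth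
      ((contDiff_fst.add contDiff_const).prodMk contDiff_snd).contMDiff
  -- The shifted framing is parallel for the same flow. Written as `ψ g` with `g = ψ⁻¹ ψ(x + l, t)`,
  -- it falls under the equivalence group statement, and `k` is the value of `g`, independent of
  -- `x`.
  have hpar : IsGParallelFraming S γ (fun x t => ψ x t * ((ψ x t)⁻¹ * ψ (x + l) t)) := by
    simp only [mul_inv_cancel_left]
    refine ⟨hshift, fun x t => ?_, fun x t => ?_⟩
    · rw [← h.adapted (x + l) t]
      congr 1
      have h1 := deriv_comp_add_const (F := E) (fun s => Aff.chart E G (γ s t)) l x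
      simp only [hl] at h1
      exact h1
    · rw [connX_mem_iff]
      have h1 : logDx E (fun x t => ψ (x + l) t) x t = logDx E ψ (x + l) t :=
        logDeriv_comp_add_const l x (mdifferentiable_of_smoothGroup_fst h.smooth t)
      rw [h1]
      exact (connX_mem_iff S _ t).1 (h.parallel (x + l) t)
  rw [isGParallelFraming_mul_iff S h (g := fun x t => (ψ x t)⁻¹ * ψ (x + l) t)
    (ContMDiff.mul (ContMDiff.inv h.smooth) hshift)] at hpar
  refine ⟨_, hpar.1 0 t, fun x => ?_⟩
  rw [← hpar.2 x 0 t, mul_inv_cancel_left]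

end

end AffHermitian

end

/-! ### Assembly of the theorem -/

theorem mainTheorem12
    {E : Type*} [NormedAddCommGroup E] [NormedSpace ℝ E] [FiniteDimensional ℝ E] [CompleteSpace E]
    {G : Type*} [TopologicalSpace G] [T2Space G] [CompactSpace G] [ChartedSpace E G] [Group G]
    [LieGroup 𝓘(ℝ, E) ∞ G] [LieAlgebra.IsSemisimple ℝ (GroupLieAlgebra 𝓘(ℝ, E) G)]
    (S : AffHermitian.HermitianSymmetric (GroupLieAlgebra 𝓘(ℝ, E) G)) :
    -- the normalization factor, and invariance of the metric: every coframe is an isometry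
    S.chi = Module.finrank ℝ S.m ∧
    (∀ (g : G) (X Y : GroupLieAlgebra 𝓘(ℝ, E) G),
      AffHermitian.affInner (AffHermitian.coframe g X) (AffHermitian.coframe g Y) =
        AffHermitian.metric X Y) ∧
    -- the curve flows of the class determined by `χ^{-1/2} (0, A)`
    (∀ γ : ℝ → ℝ → AffHermitian.Aff E G, AffHermitian.SmoothFlow γ →
      (∀ x t, ∃ g : G, AffHermitian.coframe g (AffHermitian.tangentX γ x t) = S.e) →
      -- they are non-stretching, with `x` the arclength
      (∀ x t, AffHermitian.metric (AffHermitian.tangentX γ x t) (AffHermitian.tangentX γ x t) = 1) ∧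
      -- they have a `G`-parallel framing
      (∃ ψ : ℝ → ℝ → G, AffHermitian.IsGParallelFraming S γ ψ) ∧
      (∀ ψ : ℝ → ℝ → G, AffHermitian.IsGParallelFraming S γ ψ →
        -- the variables of the framing, and its structure equations
        (∃! V : AffHermitian.FrameVars E G, V.Valued S ∧ V.Represents γ ψ) ∧
        AffHermitian.StructureEqs
          (fun x t => AffHermitian.coframe (ψ x t) (AffHermitian.tangentX γ x t))
          (fun x t => AffHermitian.coframe (ψ x t) (AffHermitian.tangentT γ x t))
          (AffHermitian.connX E ψ) (AffHermitian.connT E ψ) ∧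
        (∀ V : AffHermitian.FrameVars E G, V.Valued S → V.Represents γ ψ →
          V.Smooth ∧ V.FlowEqs S) ∧
        -- the equivalence group is `H`, the stabilizer of `A`
        {k : G | AffHermitian.IsGParallelFraming S γ (fun x t => ψ x t * k)} =
          AffHermitian.stabilizer E S.A ∧
        (∀ g : ℝ → ℝ → G, AffHermitian.SmoothGroup E g →
          (AffHermitian.IsGParallelFraming S γ (fun x t => ψ x t * g x t) ↔
            (∀ x t, g x t ∈ AffHermitian.stabilizer E S.A) ∧ ∀ x x' t, g x t = g x' t)) ∧
        (∀ k ∈ AffHermitian.stabilizer E S.A, ∀ V : AffHermitian.FrameVars E G,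
          V.Represents γ ψ → (V.act k⁻¹).Represents γ (fun x t => ψ x t * k)) ∧
        -- closed curves: the framing is periodic up to the equivalence group
        (∀ l : ℝ, (∀ x t, γ (x + l) t = γ x t) →
          ∀ t, ∃ k ∈ AffHermitian.stabilizer E S.A, ∀ x, ψ (x + l) t = ψ x t * k))) ∧
    -- the structure equations reduce to the four flow equations
    (∀ V : AffHermitian.FrameVars E G, V.Valued S → V.Smooth →
      (AffHermitian.StructureEqs (fun _ _ => S.e) (fun x t => (0, V.hpar x t + V.hperp x t))
          (fun x t => (V.q x t, 0)) (fun x t => (V.wpar x t + V.wperp x t, 0)) ↔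
        V.FlowEqs S)) ∧
    -- the flow equations are invariant under `H`
    (∀ k ∈ AffHermitian.stabilizer E S.A, ∀ V : AffHermitian.FrameVars E G, V.Valued S →
      V.Smooth → (V.act k).Valued S ∧ (V.act k).Smooth ∧ (V.FlowEqs S ↔ (V.act k).FlowEqs S)) := by
  refine ⟨S.chi_eq_finrank, AffHermitian.affInner_coframe, fun γ hγ hcl => ⟨fun x t =>
    AffHermitian.metric_tangentX S (hcl x t), AffHermitian.exists_isGParallelFraming S hγ hcl,
    fun ψ hψ => ?_⟩, fun V hV hs => AffHermitian.structureEqs_iff_flowEqs S hV hs,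
    fun k hk V hV hs => ⟨hV.act S hk, hs.act k, AffHermitian.flowEqs_act_iff S hs hk⟩⟩
  -- Semisimplicity enters here through the nondegenerate Killing form, which makes `ad` injective.
  have hc := AffHermitian.trivialCenter_of_isKilling E G
  refine ⟨⟨AffHermitian.frameVars S γ ψ, ⟨AffHermitian.valued_frameVars S hψ,
      AffHermitian.represents_frameVars S⟩, fun V hV => AffHermitian.eq_frameVars S hV.1 hV.2⟩,
    AffHermitian.structureEqs_of_framing hc hγ hψ.smooth, fun V hV hr => ?_,
    Set.ext fun k => AffHermitian.isGParallelFraming_mul_const_iff S hψ k,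
    fun g hg => AffHermitian.isGParallelFraming_mul_iff S hψ hg,
    fun k _ V hr => hr.act hc hψ.smooth k, fun l hl t => AffHermitian.exists_period S hψ hl t⟩
  rw [AffHermitian.eq_frameVars S hV hr]
  exact ⟨AffHermitian.smooth_frameVars S hγ hψ.smooth, AffHermitian.flowEqs_frameVars S hγ hψ⟩
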